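/- **Setting.** Let $U,V$ be finite sets with $|U|=n\ge 2$ and $|V|>n$, let $M:U\to V$ be an unknown injection (the true mapping, $|M|=|U|=n$), and put $\alpha=\frac{\log(|V|-n)}{\log n}\ge 0$. *Planted matching.* For $\mu>0$ one observes $W\in\mathbb R^{U\times V}$ with independent entries, $W_{u,v}\sim N(\mu,1)$ if $v=M(u)$ and $W_{u,v}\sim N(0,1)$ otherwise. The score matrix is $S=\mu W$ and the signal strength is $\zeta=\mu^2/2$. *Database alignment.* One observes jointly Gaussian feature vectors $A(u)\in\mathbb R^{D_a}$ ($u\in U$) and $B(v)\in\mathbb R^{D_b}$ ($v\in V$). The $A(u)$ are i.i.d. with covariance $\Sigma_a$, the $B(v)$ are i.i.d. with covariance $\Sigma_b$, $\mathrm{Cov}(A(u),B(v))=\Sigma_{ab}$ if $v=M(u)$ and $0$ otherwise; the means and the covariance are known, and $\Sigma=\begin{pmatrix}\Sigma_a&\Sigma_{ab}\\ \Sigma_{ab}^\top&\Sigma_b\end{pmatrix}$ is positive definite. With $f_{XY}$, $f_X$, $f_Y$ the joint and marginal densities of a correlated pair of feature vectors, the score matrix is $S_{u,v}=\log\frac{f_{XY}(A(u),B(v))}{f_X(A(u))f_Y(B(v))}$,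 and the signal strength $\zeta=I_{XY}$ is the mutual information of such a pair. The *low per-feature correlation condition* is $\|\Sigma_a^{-1/2}\Sigma_{ab}\Sigma_b^{-1/2}\|_2\le\kappa(n)$ (largest singular value), where $\kappa$ is a given function with $\kappa(n)\to0$ as $n\to\infty$. *Algorithms.* Each algorithm returns a $\{0,1\}$-valued maximizer $m$ of $\sum_{u,v}(S_{u,v}-\tau)m_{u,v}$ over real matrices $m\in[0,1]^{U\times V}$, ties being broken arbitrarily. *Maximum likelihood* imposes $\sum_u m_{u,v}\le1$ for all $v$ and $\sum_v m_{u,v}=1$ for all $u$; *maximum row estimation* imposes only $\sum_v m_{u,v}=1$ for all $u$; *threshold testing* imposes neither. For the first two the value of $\tau$ is irrelevant and arbitrary; for threshold testing $\tau$ is suitably chosen as a function of $n,|V|,\zeta$ (and $\beta$). The errors are the misaligned users ($u\in U$ whose row of $m$ is not that of $M$) for maximum likelihood and maximum row estimation, and the false negative plus false positive pairs for threshold testing. **Theorem.** Fix $\beta>0$. In both models, under each of the conditions below, the expected number of errors of the named algorithm is at most $n^{1-\beta+o(1)}$ as $n\to\infty$. For each condition the $o(1)$ is uniform over all instances that satisfy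 it: it depends only on $n$, $\beta$ and, where they occur, on $\kappa$ and on the constants $K$, $c$. For database alignment, the conditions marked $(*)$ in addition require the low per-feature correlation condition, and the parabolic ones among them also require $\alpha\le K$ for a constant $K$. * Threshold testing: * (parabolic) $\zeta\ge(\sqrt{\max\{\alpha,1\}+\beta}+\sqrt\beta)^2\log n$. * Maximum row estimation: * (parabolic) $(*)$ $\zeta\ge(\sqrt{\max\{\alpha,1\}}+\sqrt\beta)^2\log n$ and $\beta\le\max\{\alpha,1\}$; * (linear) $\zeta\ge2(\max\{\alpha,1\}+\beta)\log n$ and $\max\{\alpha,1\}<\beta$. * Maximum likelihood estimation: * (elliptic) $(*)$ $\zeta\ge(1+2\sqrt{\beta(1-\beta)})\log n$ and $\beta\le\min\{1-\alpha,1/2\}$; * (parabolic) $(*)$ $\zeta\ge(\sqrt\alpha+\sqrt\beta)^2\log n$ and $1-\alpha<\beta\le\alpha$; * (vertical) $\zeta\ge2\log n+2\log\frac{3+\sqrt5}{2}$ and $1/2<\beta\le1-\alpha$; * (linear) $\zeta\ge2(\alpha+\beta)\log n$, $\max\{\alpha,1-\alpha\}<\beta$, and $\beta\ge1-\alpha+\frac{c}{\log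 n}$ for a constant $c>0$. (For fixed $\alpha,\beta$ the last condition follows from $\beta>1-\alpha$.) -/

import Mathlib

open MeasureTheory ProbabilityTheory Filter Topology
open scoped ENNReal

noncomputable section

namespace Alignment

/-! ### Estimators as linear programs -/

section Estimators

variable {U V : Type} [Fintype U] [Fintype V]

/-- `⟨S - τ, m⟩` for a score matrix `S` and a real number `τ` subtracted from every entry. -/
def objective (S : U → V → ℝ) (τ : ℝ) (m : U → V → ℝ) : ℝ :=
  ∑ u, ∑ v, (S u v - τ) * m u v

/-- Constraint (a): every column sums to at most one. -/
def ColumnConstraint (m : U → V → ℝ) : Prop := ∀ v, ∑ u, m u v ≤ 1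

/-- Constraint (b): every row sums to one. -/
def RowConstraint (m : U → V → ℝ) : Prop := ∀ u, ∑ v, m u v = 1

/-- Constraint (c): all entries lie in `[0, 1]`. -/
def BoxConstraint (m : U → V → ℝ) : Prop := ∀ u v, m u v ∈ Set.Icc (0 : ℝ) 1

end Estimators

/-- The three algorithms. -/
inductive Algorithm
  | thresholdTesting
  | maxRow
  | maxLikelihood

/-- Feasible region of the linear program of each algorithm. -/
def Algorithm.Feasible {U V : Type} [Fintype U] [Fintype V] :
    Algorithm → (U → V → ℝ) → Prop
  | .thresholdTesting, m => BoxConstraint m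
  | .maxRow, m => RowConstraint m ∧ BoxConstraint m
  | .maxLikelihood, m => ColumnConstraint m ∧ RowConstraint m ∧ BoxConstraint m

/-- `m` is a possible output of the algorithm on the score matrix `S`: a `0/1`-valued optimal
solution of its linear program (ties may be broken in any way). -/
def Algorithm.IsOutput {U V : Type} [Fintype U] [Fintype V]
    (alg : Algorithm) (S : U → V → ℝ) (τ : ℝ) (m : U → V → ℝ) : Prop :=
  alg.Feasible m ∧ (∀ u v, m u v = 0 ∨ m u v = 1) ∧
    ∀ m' : U → V → ℝ, alg.Feasible m' → objective S τ m' ≤ objective S τ m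

/-! ### Errors

The true mapping has size `|U|`, so it is an injection `M : U ↪ V`. -/

section Errors

variable {U V : Type}

open Classical in
/-- The `0/1` matrix that encodes the mapping `M`. -/
def mappingMatrix (M : U ↪ V) (u : U) (v : V) : ℝ := if M u = v then 1 else 0

/-- Number of misaligned users: those `u` whose row in the estimate is not the true one. -/
def misalignedUsers (M : U ↪ V) (m : U → V → ℝ) : ℕ :=
  Set.ncard {u : U | m u ≠ mappingMatrix M u}

/-- Number of pairs that are decided wrongly: false negatives plus false positives. -/
def wrongPairs (M : U ↪ V) (m : U → V → ℝ) : ℕ :=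
  Set.ncard {p : U × V | m p.1 p.2 ≠ mappingMatrix M p.1 p.2}

/-- Number of errors. Threshold testing decides every pair separately, and its errors are the
false negatives and the false positives (at least as many as the misaligned users); the other two
algorithms assign one `v` to each `u`, and their errors are the misaligned users. -/
def Algorithm.numErrors (alg : Algorithm) (M : U ↪ V) (m : U → V → ℝ) : ℕ :=
  match alg with
  | .thresholdTesting => wrongPairs M m
  | .maxRow => misalignedUsers M m
  | .maxLikelihood => misalignedUsers M m

end Errors

/-! ### Planted matching -/

open Classical in
/-- `W` is the weight matrix of the Gaussian bigraph with planted matching `M`: independent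
entries, `N(μ, 1)` on the pairs of `M` and `N(0, 1)` elsewhere. -/
structure IsPlantedMatching {U V Ω : Type} [MeasurableSpace Ω]
    (P : Measure Ω) (M : U ↪ V) (μ : ℝ) (W : U → V → Ω → ℝ) : Prop where
  indep : iIndepFun (fun (p : U × V) (ω : Ω) ↦ W p.1 p.2 ω) P
  law : ∀ u v, HasLaw (W u v) (gaussianReal (if M u = v then μ else 0) 1) P

/-! ### Correlated Gaussian databases -/

open Classical in
/-- `A` and `B` are correlated Gaussian databases with true mapping `M`, means `μa`, `μb` and
covariance `[[Sa, Sab], [Sabᵀ, Sb]]`. By joint Gaussianity the vanishing covariances express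
independence. -/
structure IsCorrelatedDatabases {U V Da Db Ω : Type} [Fintype U] [Fintype V] [Fintype Da]
    [Fintype Db] [MeasurableSpace Ω] (P : Measure Ω) (M : U ↪ V)
    (μa : Da → ℝ) (μb : Db → ℝ) (Sa : Matrix Da Da ℝ) (Sab : Matrix Da Db ℝ) (Sb : Matrix Db Db ℝ)
    (A : U → Da → Ω → ℝ) (B : V → Db → Ω → ℝ) : Prop where
  gaussian : HasGaussianLaw (fun (ω : Ω) (t : (U × Da) ⊕ (V × Db)) ↦
    Sum.elim (fun p : U × Da ↦ A p.1 p.2 ω) (fun q : V × Db ↦ B q.1 q.2 ω) t) P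
  mean_A : ∀ u i, ∫ ω, A u i ω ∂P = μa i
  mean_B : ∀ v j, ∫ ω, B v j ω ∂P = μb j
  cov_A : ∀ u u' i i', covariance (A u i) (A u' i') P = if u = u' then Sa i i' else 0
  cov_B : ∀ v v' j j', covariance (B v j) (B v' j') P = if v = v' then Sb j j' else 0
  cov_AB : ∀ u v i j, covariance (A u i) (B v j) P = if M u = v then Sab i j else 0

/-- Density of the nondegenerate Gaussian law `N(m, S)` on `ℝ^D`. -/
def gaussianDensity {D : Type} [Fintype D] [DecidableEq D] (m : D → ℝ) (S : Matrix D D ℝ)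
    (x : D → ℝ) : ℝ :=
  (Real.sqrt ((2 * Real.pi) ^ Fintype.card D * S.det))⁻¹ *
    Real.exp (-((x - m) ⬝ᵥ S⁻¹.mulVec (x - m)) / 2)

section Information

variable {Da Db : Type} [Fintype Da] [Fintype Db] [DecidableEq Da] [DecidableEq Db]

/-- The joint covariance matrix of a correlated pair of features. -/
def jointCov (Sa : Matrix Da Da ℝ) (Sab : Matrix Da Db ℝ) (Sb : Matrix Db Db ℝ) :
    Matrix (Da ⊕ Db) (Da ⊕ Db) ℝ :=
  Matrix.fromBlocks Sa Sab Sab.transpose Sb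

/-- Information density `log (f_XY(x, y) / (f_X(x) f_Y(y)))`. -/
def infoDensity (μa : Da → ℝ) (μb : Db → ℝ) (Sa : Matrix Da Da ℝ) (Sab : Matrix Da Db ℝ)
    (Sb : Matrix Db Db ℝ) (x : Da → ℝ) (y : Db → ℝ) : ℝ :=
  Real.log (gaussianDensity (Sum.elim μa μb) (jointCov Sa Sab Sb) (Sum.elim x y) /
    (gaussianDensity μa Sa x * gaussianDensity μb Sb y))

/-- Mutual information `I_XY = ∫∫ f_XY log (f_XY / (f_X f_Y))` of a correlated pair of features. -/
def mutualInfo (μa : Da → ℝ) (μb : Db → ℝ) (Sa : Matrix Da Da ℝ) (Sab : Matrix Da Db ℝ)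
    (Sb : Matrix Db Db ℝ) : ℝ :=
  ∫ z : Da ⊕ Db → ℝ, gaussianDensity (Sum.elim μa μb) (jointCov Sa Sab Sb) z *
    infoDensity μa μb Sa Sab Sb (fun i ↦ z (Sum.inl i)) (fun j ↦ z (Sum.inr j))

open scoped MatrixOrder in
/-- `Sa^(-1/2) Sab Sb^(-1/2)`, with the positive semidefinite square roots. -/
def normalizedCrossCov (Sa : Matrix Da Da ℝ) (Sab : Matrix Da Db ℝ) (Sb : Matrix Db Db ℝ) :
    Matrix Da Db ℝ :=
  (CFC.sqrt Sa)⁻¹ * Sab * (CFC.sqrt Sb)⁻¹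

open scoped Matrix.Norms.L2Operator in
/-- The largest singular value of `Sa^(-1/2) Sab Sb^(-1/2)`. -/
def maxCorrelation (Sa : Matrix Da Da ℝ) (Sab : Matrix Da Db ℝ) (Sb : Matrix Db Db ℝ) : ℝ :=
  ‖normalizedCrossCov Sa Sab Sb‖

end Information

/-! ### Asymptotic error bounds -/

/-- `α = log (N - n) / log n` for `|U| = n` and `|V| = N`. -/
def excessExponent (n N : ℕ) : ℝ := Real.log ((N : ℝ) - n) / Real.log n

/-- In planted matching, the expected number of errors of the algorithm, run on the scores `μ W`
with threshold `τ(n, |V|, ζ)`, is at most `n ^ (1 - β + o(1))` where `n = |M| = |U| < |V|` and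
`ζ = μ² / 2`. The bound holds for all instances with `hyp n α ζ`, and the `o(1)` is the same for
all of them. -/
def PlantedErrorBound (alg : Algorithm) (β : ℝ) (τ : ℕ → ℕ → ℝ → ℝ)
    (hyp : (n : ℕ) → (α ζ : ℝ) → Prop) : Prop :=
  ∃ e : ℕ → ℝ, Tendsto e atTop (𝓝 0) ∧
    ∀ (U V Ω : Type) [Fintype U] [Fintype V] [MeasurableSpace Ω]
      (P : Measure Ω) [IsProbabilityMeasure P] (M : U ↪ V) (μ : ℝ) (W : U → V → Ω → ℝ)
      (n N : ℕ) (ζ : ℝ),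
      Fintype.card U = n → Fintype.card V = N → 2 ≤ n → n < N → 0 < μ → ζ = μ ^ 2 / 2 →
      IsPlantedMatching P M μ W →
      hyp n (excessExponent n N) ζ →
      ∀ m : Ω → U → V → ℝ,
        (∀ᵐ ω ∂P, alg.IsOutput (fun u v ↦ μ * W u v ω) (τ n N ζ) (m ω)) →
        ∫⁻ ω, (alg.numErrors M (m ω) : ℝ≥0∞) ∂P ≤ ENNReal.ofReal ((n : ℝ) ^ (1 - β + e n))

/-- In database alignment, the expected number of errors of the algorithm, run on the information
density matrix with threshold `τ(n, |V|, ζ)`, is at most `n ^ (1 - β + o(1))` where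
`n = |M| = |U| < |V|` and `ζ = I_XY`. The bound holds for all instances with `hyp n α ζ r`, where
`r` is the largest singular value of the normalized cross-covariance, and the `o(1)` is the same
for all of them. -/
def DatabaseErrorBound (alg : Algorithm) (β : ℝ) (τ : ℕ → ℕ → ℝ → ℝ)
    (hyp : (n : ℕ) → (α ζ r : ℝ) → Prop) : Prop :=
  ∃ e : ℕ → ℝ, Tendsto e atTop (𝓝 0) ∧
    ∀ (U V Da Db Ω : Type) [Fintype U] [Fintype V] [Fintype Da] [Fintype Db]
      [DecidableEq Da] [DecidableEq Db] [MeasurableSpace Ω]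
      (P : Measure Ω) [IsProbabilityMeasure P] (M : U ↪ V)
      (μa : Da → ℝ) (μb : Db → ℝ)
      (Sa : Matrix Da Da ℝ) (Sab : Matrix Da Db ℝ) (Sb : Matrix Db Db ℝ)
      (A : U → Da → Ω → ℝ) (B : V → Db → Ω → ℝ) (n N : ℕ) (ζ : ℝ),
      Fintype.card U = n → Fintype.card V = N → 2 ≤ n → n < N →
      (jointCov Sa Sab Sb).PosDef → ζ = mutualInfo μa μb Sa Sab Sb →
      IsCorrelatedDatabases P M μa μb Sa Sab Sb A B →
      hyp n (excessExponent n N) ζ (maxCorrelation Sa Sab Sb) →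
      ∀ m : Ω → U → V → ℝ,
        (∀ᵐ ω ∂P, alg.IsOutput
          (fun u v ↦ infoDensity μa μb Sa Sab Sb (fun i ↦ A u i ω) (fun j ↦ B v j ω))
          (τ n N ζ) (m ω)) →
        ∫⁻ ω, (alg.numErrors M (m ω) : ℝ≥0∞) ∂P ≤ ENNReal.ofReal ((n : ℝ) ^ (1 - β + e n))

end Alignment

end

noncomputable section

namespace Alignment

set_option linter.unusedSectionVars false

/-! ### Chains of a partial injection -/

section Chains

variable {U : Type} {r : U → U → Prop}

/-! The scores may be taken to be log-likelihood ratios of a true pair against a false one (in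
planted matching after subtracting `ζ`, which changes no estimate once the threshold is shifted
too). By a change of measure, the exponential moment of weight `p - 1` at a true pair equals that of
weight `p` at a false pair, and it is at most `ρ = exp (-p (1 - p) ζ)`. All bounds are Chernoff
bounds with this tilt `p`; for the two algorithms that compare scores, a truncation level `t` for
the true scores is optimized as well.

For maximum likelihood, the misaligned users split into chains in which each user takes the true
partner of its predecessor. The total gain of the estimate is nonnegative, so the number of errors
is at most a sum over users of one plus a multiple of the gain. True scores below `t` are paid for
user by user, and chains are cut at such users. A chain with its completion (an exit to an unmatched
`v`, a user of low score, or a closing edge) has an alternating edge set, of weight `p - 1` on true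
and `p` on false pairs. Summing exponentials over all duplicate-free lists (`card_errors_le`) and
taking means gives a geometric series of ratio `exp η * exp ((1 - 2p) t) * n * ρ²`
(`lintegral_maxLikelihood_le`). Maximum row estimation and threshold testing need only union bounds.

With `t = (2p - 1) ζ` the cost of a low true score is `exp (-(1 - p)² ζ)`, and the ratio is `n * exp
(-(p² + (1 - p)²) ζ)` up to `exp η`. The choice `1 - p ≈ √β / √(ζ / log n)` yields the elliptic and
parabolic boundaries; `p = 1/2` yields the linear and vertical ones. All reduce to exponent
bookkeeping in `LikelihoodRate`, `RowRate` and `thresholdRate`.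

It remains to bound the moments along paths and cycles by `ρ` per edge. In planted matching the
edges are distinct, hence independent. For databases the edges share vertices, and the moment is an
iterated integral of the operator `K` with kernel `exp (p * score)`. By Cauchy–Schwarz it is
controlled by the Hilbert–Schmidt norm of `K Kᵀ`, whose square is the weight of one four-cycle
(`chainBound_sample`). This suffices because no alternating cycle is shorter than four.

The Gaussian four-cycle integral is explicit: whitening turns the score into a quadratic form, and
an eighth of a turn in sums and differences decouples the integral into two determinants
(`cycleWeight_gaussian`). At `p = 1/2` it equals `ρ⁴` exactly, so the linear and vertical bounds
need no correlation condition. For other `p` each eigenvalue costs a relative error of the order of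
the squared correlation, which low per-feature correlation makes `o(log n)` in the exponent
(`cycleWeight_le`). -/

/-- In a chain, every element other than the last one is related to an element of the tail. -/
lemma eq_getLast_or_exists_rel {u c : U} {l : List U} (hl : List.IsChain r (u :: l))
    (hc : c ∈ u :: l) :
    c = (u :: l).getLast (List.cons_ne_nil u l) ∨ ∃ w ∈ l, r c w := by
  induction l generalizing u with
  | nil => left; simpa using hc
  | cons w l ih =>
    rw [List.isChain_cons_cons] at hl
    rcases List.mem_cons.1 hc with rfl | hc
    · exact Or.inr ⟨w, by simp, hl.1⟩
    · rcases ih hl.2 hc with h | ⟨x, hx, hr⟩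
      · left; simpa using h
      · exact Or.inr ⟨x, by simp [hx], hr⟩

variable [Fintype U]

/-- The number of duplicate-free lists, weighted by the length. -/
lemma sum_nodup_lists_le (f : ℕ → ℝ) (hf : ∀ k, 0 ≤ f k) :
    ∑ l : {l : List U // l.Nodup}, f l.1.length ≤
      ∑ k ∈ Finset.range (Fintype.card U + 1), (Fintype.card U : ℝ) ^ k * f k := by
  classical
  have hmaps : ∀ l ∈ (Finset.univ : Finset {l : List U // l.Nodup}),
      l.1.length ∈ Finset.range (Fintype.card U + 1) := fun l _ ↦ by
    rw [Finset.mem_range, Nat.lt_succ_iff]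
    exact l.2.length_le_card
  rw [← Finset.sum_fiberwise_of_maps_to hmaps]
  refine Finset.sum_le_sum fun k _ ↦ ?_
  rw [Finset.sum_congr rfl (g := fun _ ↦ f k) (fun l hl ↦ by rw [(Finset.mem_filter.1 hl).2]),
    Finset.sum_const, nsmul_eq_mul]
  refine mul_le_mul_of_nonneg_right ?_ (hf k)
  have : (Finset.univ.filter fun l : {l : List U // l.Nodup} ↦ l.1.length = k).card ≤
      Fintype.card (List.Vector U k) := by
    rw [← Fintype.card_subtype]
    exact Fintype.card_le_of_injective (fun l ↦ (⟨l.1.1, l.2⟩ : List.Vector U k))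
      fun a b h ↦ Subtype.ext (Subtype.ext (congrArg List.Vector.toList h))
  rw [card_vector] at this
  exact_mod_cast this

variable [DecidableEq U]

/-- A duplicate-free chain in `T` that cannot be prolonged at its head, except by closing up to a
cycle. -/
structure IsCompleteChain (r : U → U → Prop) (T : Finset U) (u : U) (l : List U) : Prop where
  nodup : (u :: l).Nodup
  chain : List.IsChain r (u :: l)
  mem : ∀ x ∈ u :: l, x ∈ T
  head : ∀ c, r c u → c = (u :: l).getLast (List.cons_ne_nil u l)

/-- A chain of maximal length in `T` works. A predecessor of its head must already lie in it, hence
is its last element. A successor outside it could only follow the last element and would prolong the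
chain, so the complement is again closed under predecessors and the peeling can continue. -/
lemma exists_isCompleteChain (hr₁ : ∀ u w w', r u w → r u w' → w = w')
    (T : Finset U) (hT : ∀ u w, w ∈ T → r u w → u ∈ T) (hne : T.Nonempty) :
    ∃ u l, IsCompleteChain r T u l ∧
      ∀ x w, w ∈ T \ (u :: l).toFinset → r x w → x ∈ T \ (u :: l).toFinset := by
  classical
  let F : Finset {l : List U // l.Nodup} :=
    Finset.univ.filter fun l ↦ List.IsChain r l.1 ∧ ∀ x ∈ l.1, x ∈ T
  obtain ⟨u₀, hu₀⟩ := hne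
  have hF : F.Nonempty := ⟨⟨[u₀], by simp⟩, by simp [F, hu₀]⟩
  obtain ⟨⟨l, hnd⟩, hlF, hmax⟩ := F.exists_max_image (fun l ↦ l.1.length) hF
  simp only [F, Finset.mem_filter, Finset.mem_univ, true_and] at hlF
  have hmax' : ∀ l' : List U, l'.Nodup → List.IsChain r l' → (∀ x ∈ l', x ∈ T) →
      l'.length ≤ l.length := fun l' h₁ h₂ h₃ ↦
    hmax ⟨l', h₁⟩ (by simpa [F] using ⟨h₂, h₃⟩)
  cases l with
  | nil =>
    have := hmax' [u₀] (by simp) (by simp) (by simp [hu₀])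
    simp at this
  | cons u l =>
    obtain ⟨hch, hmem⟩ := hlF
    refine ⟨u, l, ⟨hnd, hch, hmem, fun c hc ↦ ?_⟩, fun x w hw hxw ↦ ?_⟩
    · have hcT : c ∈ T := hT c u (hmem u (by simp)) hc
      have hcl : c ∈ u :: l := by
        by_contra hcl
        have := hmax' (c :: u :: l) (List.nodup_cons.2 ⟨hcl, hnd⟩)
          (List.isChain_cons_cons.2 ⟨hc, hch⟩) (by
            intro x hx
            rcases List.mem_cons.1 hx with rfl | hx
            · exact hcT
            · exact hmem x hx)
        simp at this
      rcases eq_getLast_or_exists_rel hch hcl with h | ⟨w, hw, hrw⟩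
      · exact h
      -- An inner element has its successor in the tail; that successor would be the head, against
      -- duplicate-freeness.
      · have : w = u := hr₁ _ _ _ hrw hc
        subst this
        exact absurd hw (List.nodup_cons.1 hnd).1
    · rw [Finset.mem_sdiff, List.mem_toFinset] at hw ⊢
      refine ⟨hT x w hw.1 hxw, fun hx ↦ ?_⟩
      rcases eq_getLast_or_exists_rel hch hx with h | ⟨y, hy, hry⟩
      · have := hmax' ((u :: l) ++ [w])
          (List.nodup_append.2 ⟨hnd, by simp, by
            intro a ha b hb
            rw [List.mem_singleton] at hb
            rintro rfl
            exact hw.2 (hb ▸ ha)⟩)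
          (List.IsChain.append hch (by simp) (by
            intro a ha b hb
            rw [List.getLast?_eq_some_getLast (List.cons_ne_nil u l)] at ha
            simp only [Option.mem_def, Option.some.injEq, List.head?_cons] at ha hb
            subst ha; subst hb; rw [← h]; exact hxw)) (by
            intro y hy
            rcases List.mem_append.1 hy with hy | hy
            · exact hmem y hy
            · rw [List.mem_singleton] at hy; rw [hy]; exact hw.1)
        simp at this
      · have : y = w := hr₁ _ _ _ hry hxw
        subst this
        exact hw.2 (by simp [hy])

open Classical in
/-- A sum over a set that is closed under a partial injection is bounded by a sum over chains. -/
lemma sum_le_sum_chains (hr₁ : ∀ u w w', r u w → r u w' → w = w') (g : U → ℝ)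
    (Φ : List U → ℝ) (hΦ : ∀ l, 0 ≤ Φ l) (T₀ : Finset U)
    (hg : ∀ T ⊆ T₀, ∀ u l, IsCompleteChain r T u l → ((u :: l).map g).sum ≤ Φ (u :: l))
    (hT₀ : ∀ u w, w ∈ T₀ → r u w → u ∈ T₀) :
    ∑ u ∈ T₀, g u ≤ ∑ l : {l : List U // l.Nodup}, Φ l.1 := by
  -- Peel off one complete chain at a time. Only lists inside the current set are counted on the
  -- right, so the peeled chain is a new summand and no list is charged twice.
  have key : ∀ (k : ℕ) (T : Finset U), T.card ≤ k → T ⊆ T₀ →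
      (∀ u w, w ∈ T → r u w → u ∈ T) →
      ∑ u ∈ T, g u ≤ ∑ l ∈ (Finset.univ : Finset {l : List U // l.Nodup}).filter
        (fun l ↦ l.1 ≠ [] ∧ ∀ x ∈ l.1, x ∈ T), Φ l.1 := by
    intro k
    induction k with
    | zero =>
      intro T hk _ _
      rw [Finset.card_eq_zero.1 (Nat.le_zero.1 hk)]
      simpa using Finset.sum_nonneg fun l _ ↦ hΦ _
    | succ k ih =>
      intro T hk hTT₀ hT
      rcases T.eq_empty_or_nonempty with rfl | hne
      · simpa using Finset.sum_nonneg fun l _ ↦ hΦ _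
      obtain ⟨u, l, hul, hcl⟩ := exists_isCompleteChain hr₁ T hT hne
      have hsub : (u :: l).toFinset ⊆ T := fun x hx ↦ hul.mem x (List.mem_toFinset.1 hx)
      have hcard : (T \ (u :: l).toFinset).card ≤ k := by
        have h1 := Finset.card_sdiff_add_card_eq_card hsub
        have h2 : 0 < (u :: l).toFinset.card := Finset.card_pos.2 ⟨u, by simp⟩
        omega
      have hrest := ih _ hcard (Finset.sdiff_subset.trans hTT₀) hcl
      rw [← Finset.sum_sdiff hsub, List.sum_toFinset g hul.nodup]
      have hmemF : (⟨u :: l, hul.nodup⟩ : {l : List U // l.Nodup}) ∉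
          (Finset.univ : Finset {l : List U // l.Nodup}).filter
            (fun l' ↦ l'.1 ≠ [] ∧ ∀ x ∈ l'.1, x ∈ T \ (u :: l).toFinset) := by
        intro h
        rw [Finset.mem_filter] at h
        have := h.2.2 u (by simp)
        simp at this
      refine (add_le_add hrest (hg T hTT₀ u l hul)).trans ?_
      rw [add_comm, ← Finset.sum_insert (f := fun l : {l : List U // l.Nodup} ↦ Φ l.1) hmemF]
      refine Finset.sum_le_sum_of_subset_of_nonneg ?_ fun _ _ _ ↦ hΦ _
      intro l' hl'
      rw [Finset.mem_insert] at hl'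
      rw [Finset.mem_filter]
      rcases hl' with rfl | hl'
      · exact ⟨Finset.mem_univ _, by simp, hul.mem⟩
      · rw [Finset.mem_filter] at hl'
        exact ⟨Finset.mem_univ _, hl'.2.1, fun x hx ↦ (Finset.mem_sdiff.1 (hl'.2.2 x hx)).1⟩
  refine (key _ T₀ le_rfl subset_rfl hT₀).trans ?_
  exact Finset.sum_le_sum_of_subset_of_nonneg (Finset.filter_subset _ _) fun _ _ _ ↦ hΦ _

end Chains

/-! ### Counting the errors of maximum likelihood -/

section Counting

variable {U V : Type}

/-- The weighted score of an alternating path. Every user of the list contributes its true pair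
with weight `p - 1`, and the pair of a user `w` with the image of the user that precedes `w`
contributes with weight `p`. -/
def chainScore (p : ℝ) (M : U → V) (s : U → V → ℝ) : List U → ℝ
  | [] => 0
  | [u] => (p - 1) * s u (M u)
  | u :: w :: l => (p - 1) * s u (M u) + p * s w (M u) + chainScore p M s (w :: l)

/-- The truncated loss satisfies `-p * max y 0 ≤ (p - 1) * y` for every real `y`: positive `y` needs
`1/2 ≤ p`, negative `y` needs `p ≤ 1`. So truncation trades the weight `-p` of a true pair for `p -
1`, the weight at which its exponential moment matches that of a false pair. The levels `t` add up
to `1 - 2 * p` per user. -/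
lemma gain_le_chainScore {p t : ℝ} (hp : 1 / 2 ≤ p) (hp1 : p ≤ 1) (M σ : U → V) (s : U → V → ℝ) (u : U)
    (l : List U) (hl : List.IsChain (fun u w ↦ σ w = M u ∧ t ≤ s u (M u)) (u :: l)) :
    p * ((u :: l).map fun x ↦ (s x (σ x) - t) - max (s x (M x) - t) 0).sum ≤
      chainScore p M s (u :: l) + p * s u (σ u) + (1 - 2 * p) * t * (u :: l).length := by
  have hy : ∀ y : ℝ, -p * max y 0 ≤ (p - 1) * y := fun y ↦ by
    rcases le_total y 0 with h | h
    · rw [max_eq_right h]; nlinarith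
    · rw [max_eq_left h]; nlinarith
  induction l generalizing u with
  | nil =>
    have := hy (s u (M u) - t)
    simp only [List.map_cons, List.map_nil, List.sum_cons, List.sum_nil, chainScore,
      List.length_cons, List.length_nil]
    push_cast
    nlinarith
  | cons w l ih =>
    rw [List.isChain_cons_cons] at hl
    have h1 := ih w hl.2
    have h2 := hy (s u (M u) - t)
    rw [hl.1.1] at h1
    simp only [List.map_cons, List.sum_cons, chainScore, List.length_cons] at h1 ⊢
    push_cast at h1 ⊢
    nlinarith

variable [Fintype U] [Fintype V]

open Classical in
/-- The total weight of the completions of an alternating path: by an unmatched `v`, by another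
user, or to a cycle. -/
def completionWeight (p t : ℝ) (M : U → V) (s : U → V → ℝ) : List U → ℝ
  | [] => 0
  | u :: l =>
    (∑ v with v ∉ Set.range M, Real.exp (chainScore p M s (u :: l) + p * s u v)) +
    (∑ c with c ∉ u :: l, Real.exp ((1 - p) * t) * Real.exp (chainScore p M s (c :: u :: l))) +
    if l = [] then 0 else
      Real.exp (chainScore p M s (u :: l) +
        p * s u (M ((u :: l).getLast (List.cons_ne_nil u l))))

lemma completionWeight_nonneg (p t : ℝ) (M : U → V) (s : U → V → ℝ) (l : List U) :
    0 ≤ completionWeight p t M s l := by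
  cases l with
  | nil => exact le_rfl
  | cons u l =>
    unfold completionWeight
    have : (0 : ℝ) ≤ if l = [] then 0 else
      Real.exp (chainScore p M s (u :: l) +
        p * s u (M ((u :: l).getLast (List.cons_ne_nil u l)))) := by
      split_ifs <;> positivity
    positivity

open Classical in
/-- A bound for the number of errors of an estimate `σ` that scores at least as well as the true
mapping `M`. -/
lemma card_errors_le {p t η : ℝ} (hp : 1 / 2 ≤ p) (hp1 : p < 1) (hη : 0 < η) (M : U ↪ V)
    (σ : U → V) (hσ : Function.Injective σ) (s : U → V → ℝ)
    (hopt : ∑ u, s u (M u) ≤ ∑ u, s u (σ u)) :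
    ((Finset.univ.filter fun u ↦ σ u ≠ M u).card : ℝ) ≤
      p / (η * (1 - p)) * ∑ u, Real.exp ((1 - p) * t) * Real.exp (chainScore p M s [u]) +
      ∑ l : {l : List U // l.Nodup},
        1 / η * (Real.exp η * Real.exp ((1 - 2 * p) * t)) ^ l.1.length *
          completionWeight p t M s l.1 := by
  set T : Finset U := Finset.univ.filter fun u ↦ σ u ≠ M u with hTdef
  have hp0 : 0 < 1 - p := by linarith
  have hpp : 0 < p := by linarith
  have hT : ∀ u, u ∈ T ↔ σ u ≠ M u := by simp [hTdef]
  have hgain : 0 ≤ ∑ u ∈ T, (s u (σ u) - s u (M u)) := by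
    have : ∑ u ∈ T, (s u (σ u) - s u (M u)) = ∑ u, (s u (σ u) - s u (M u)) := by
      refine Finset.sum_subset (Finset.subset_univ _) fun u _ hu ↦ ?_
      rw [hT, not_not] at hu
      rw [hu, sub_self]
    rw [this, Finset.sum_sub_distrib]
    linarith
  -- The gain of a user is its truncated gain plus `max (t - s u (M u)) 0`; only the first part is
  -- charged to chains, the second is charged to single users.
  let g : U → ℝ := fun u ↦ 1 + p / η * ((s u (σ u) - t) - max (s u (M u) - t) 0)
  have h1 : (T.card : ℝ) ≤ ∑ u ∈ T, g u + p / η * ∑ u, max (t - s u (M u)) 0 := by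
    have e1 : (T.card : ℝ) ≤ T.card + p / η * ∑ u ∈ T, (s u (σ u) - s u (M u)) :=
      le_add_of_nonneg_right (mul_nonneg (by positivity) hgain)
    have e2 : (T.card : ℝ) + p / η * ∑ u ∈ T, (s u (σ u) - s u (M u)) =
        ∑ u ∈ T, g u + p / η * ∑ u ∈ T, max (t - s u (M u)) 0 := by
      have hm : ∀ u, max (t - s u (M u)) 0 = max (s u (M u) - t) 0 - (s u (M u) - t) := fun u ↦ by
        rcases le_total (s u (M u)) t with h | h
        · rw [max_eq_left (by linarith), max_eq_right (by linarith)]; ring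
        · rw [max_eq_right (by linarith), max_eq_left (by linarith)]; ring
      rw [Finset.card_eq_sum_ones, Nat.cast_sum, Finset.mul_sum, Finset.mul_sum,
        ← Finset.sum_add_distrib, ← Finset.sum_add_distrib]
      refine Finset.sum_congr rfl fun u _ ↦ ?_
      rw [hm]
      simp only [g]
      push_cast
      ring
    have e3 : ∑ u ∈ T, max (t - s u (M u)) 0 ≤ ∑ u, max (t - s u (M u)) 0 :=
      Finset.sum_le_sum_of_subset_of_nonneg (Finset.subset_univ _) fun _ _ _ ↦ le_max_right _ _
    have e4 := mul_le_mul_of_nonneg_left e3 (show 0 ≤ p / η by positivity)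
    linarith
  have h2 : p / η * ∑ u, max (t - s u (M u)) 0 ≤
      p / (η * (1 - p)) * ∑ u, Real.exp ((1 - p) * t) * Real.exp (chainScore p M s [u]) := by
    rw [Finset.mul_sum, Finset.mul_sum]
    refine Finset.sum_le_sum fun u _ ↦ ?_
    -- This is `y ≤ exp y`, which turns the shortfall of a low true score into an exponential
    -- moment.
    have e1 : (1 - p) * max (t - s u (M u)) 0 ≤
        Real.exp ((1 - p) * t) * Real.exp (chainScore p M s [u]) := by
      rw [← Real.exp_add]
      simp only [chainScore]
      rcases le_total (t - s u (M u)) 0 with h | h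
      · rw [max_eq_right h, mul_zero]; positivity
      · rw [max_eq_left h]
        have := Real.add_one_le_exp ((1 - p) * t + (p - 1) * s u (M u))
        linarith
    calc p / η * max (t - s u (M u)) 0
        = p / (η * (1 - p)) * ((1 - p) * max (t - s u (M u)) 0) := by field_simp
      _ ≤ _ := mul_le_mul_of_nonneg_left e1 (by positivity)
  have h3 : ∑ u ∈ T, g u ≤ ∑ l : {l : List U // l.Nodup},
      1 / η * (Real.exp η * Real.exp ((1 - 2 * p) * t)) ^ l.1.length *
          completionWeight p t M s l.1 := by
    -- A chain continues through a user only if its true score reaches `t`. Users below `t` end the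
    -- chain, and their deficit pays for the last edge.
    refine sum_le_sum_chains (r := fun u w ↦ σ w = M u ∧ t ≤ s u (M u))
      (fun u w w' h h' ↦ hσ (h.1.trans h'.1.symm)) g
      (fun l ↦ 1 / η * (Real.exp η * Real.exp ((1 - 2 * p) * t)) ^ l.length *
          completionWeight p t M s l)
      (fun l ↦ mul_nonneg (by positivity) (completionWeight_nonneg _ _ _ _ _)) T
      (fun T' hT' u l hul ↦ ?_) (fun u w hw hr ↦ ?_)
    · have hkey := gain_le_chainScore hp hp1.le M σ s u l hul.chain
      have hsum : ((u :: l).map g).sum = (u :: l).length + p / η *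
          ((u :: l).map fun x ↦ (s x (σ x) - t) - max (s x (M x) - t) 0).sum := by
        simp only [g, List.sum_map_add, List.sum_map_mul_left]
        simp [add_comm]
      rw [hsum]
      set k : ℕ := (u :: l).length
      set X := ((u :: l).map fun x ↦ (s x (σ x) - t) - max (s x (M x) - t) 0).sum
      -- Length and gain are merged into a single exponential; `η` is the price of one user in the
      -- exponent.
      have e1 : (k : ℝ) + p / η * X ≤ 1 / η * Real.exp (η * k + p * X) := by
        have := Real.add_one_le_exp (η * k + p * X)
        calc (k : ℝ) + p / η * X = 1 / η * (η * k + p * X) := by field_simp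
          _ ≤ _ := mul_le_mul_of_nonneg_left (by linarith) (by positivity)
      have e2 : Real.exp (η * k + p * X) ≤ (Real.exp η * Real.exp ((1 - 2 * p) * t)) ^ k *
          Real.exp (chainScore p M s (u :: l) + p * s u (σ u)) := by
        rw [← Real.exp_add, ← Real.exp_nat_mul, ← Real.exp_add]
        refine Real.exp_le_exp.2 ?_
        linarith
      have e3 : Real.exp (chainScore p M s (u :: l) + p * s u (σ u)) ≤
          completionWeight p t M s (u :: l) := by
        unfold completionWeight
        have n1 : (0 : ℝ) ≤ ∑ v with v ∉ Set.range M,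
            Real.exp (chainScore p M s (u :: l) + p * s u v) := by positivity
        have n2 : (0 : ℝ) ≤ ∑ c with c ∉ u :: l,
            Real.exp ((1 - p) * t) * Real.exp (chainScore p M s (c :: u :: l)) := by positivity
        have n3 : (0 : ℝ) ≤ if l = [] then 0 else Real.exp (chainScore p M s (u :: l) +
            p * s u (M ((u :: l).getLast (List.cons_ne_nil u l)))) := by
          split_ifs <;> positivity
        -- The head takes either an unmatched `v`, or the true partner of some `c`. In the latter
        -- case `c` closes a cycle, or it is a user outside the chain with a score below `t`.
        by_cases hr : σ u ∈ Set.range M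
        · obtain ⟨c, hc⟩ := hr
          have hcyc : c = (u :: l).getLast (List.cons_ne_nil u l) →
              Real.exp (chainScore p M s (u :: l) + p * s u (σ u)) ≤
              if l = [] then 0 else Real.exp (chainScore p M s (u :: l) +
                p * s u (M ((u :: l).getLast (List.cons_ne_nil u l)))) := by
            intro hlast
            rw [if_neg, ← hlast, hc]
            -- A cycle of a single user would mean that this user is aligned, against its membership
            -- in `T`.
            rintro rfl
            have : c = u := by simpa using hlast
            subst this
            exact (hT c).1 (hT' (hul.mem c (by simp))) hc.symm
          by_cases hgood : t ≤ s c (M c)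
          · have := hcyc (hul.head c ⟨hc.symm, hgood⟩)
            linarith
          · by_cases hmem : c ∈ u :: l
            · rcases eq_getLast_or_exists_rel hul.chain hmem with h | ⟨w, _, hw⟩
              · have := hcyc h
                linarith
              -- An inner user of a chain has a true score of at least `t`.
              · exact absurd hw.2 hgood
            · have : Real.exp (chainScore p M s (u :: l) + p * s u (σ u)) ≤
                  ∑ c with c ∉ u :: l,
                    Real.exp ((1 - p) * t) * Real.exp (chainScore p M s (c :: u :: l)) := by
                refine le_trans ?_ (Finset.single_le_sum
                  (f := fun c ↦ Real.exp ((1 - p) * t) * Real.exp (chainScore p M s (c :: u :: l)))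
                  (fun _ _ ↦ by positivity) (Finset.mem_filter.2 ⟨Finset.mem_univ c, hmem⟩))
                -- Since `s c (M c) < t`, the factor `exp ((1 - p) * (t - s c (M c)))` exceeds one,
                -- so the true pair of `c` may be added to the path for free.
                rw [← Real.exp_add]
                refine Real.exp_le_exp.2 ?_
                simp only [chainScore, ← hc]
                push Not at hgood
                nlinarith
              linarith
        · have : Real.exp (chainScore p M s (u :: l) + p * s u (σ u)) ≤
              ∑ v with v ∉ Set.range M, Real.exp (chainScore p M s (u :: l) + p * s u v) :=
            Finset.single_le_sum
              (f := fun v ↦ Real.exp (chainScore p M s (u :: l) + p * s u v))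
              (fun _ _ ↦ by positivity) (Finset.mem_filter.2 ⟨Finset.mem_univ (σ u), hr⟩)
          linarith
      calc (k : ℝ) + p / η * X ≤ 1 / η * Real.exp (η * k + p * X) := e1
        _ ≤ 1 / η * ((Real.exp η * Real.exp ((1 - 2 * p) * t)) ^ k *
            completionWeight p t M s (u :: l)) :=
          mul_le_mul_of_nonneg_left (e2.trans (mul_le_mul_of_nonneg_left e3 (by positivity)))
            (by positivity)
        _ = _ := by ring
    · rw [hT] at hw ⊢
      intro hu
      have : u = w := hσ (hu.trans hr.1.symm)
      subst this
      exact hw hu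
  linarith

end Counting

/-! ### Bounds for means of nonnegative functions -/

section MeanLE

variable {Ω : Type} [MeasurableSpace Ω] {P : Measure Ω}

/-- `f` is a nonnegative random variable whose mean is at most `b`. -/
structure MeanLE (P : Measure Ω) (f : Ω → ℝ) (b : ℝ) : Prop where
  aemeasurable : AEMeasurable f P
  nonneg : ∀ ω, 0 ≤ f ω
  bound_nonneg : 0 ≤ b
  lintegral_le : ∫⁻ ω, ENNReal.ofReal (f ω) ∂P ≤ ENNReal.ofReal b

lemma MeanLE.mono {f : Ω → ℝ} {b b' : ℝ} (h : MeanLE P f b) (hb : b ≤ b') : MeanLE P f b' :=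
  ⟨h.aemeasurable, h.nonneg, h.bound_nonneg.trans hb,
    h.lintegral_le.trans (ENNReal.ofReal_le_ofReal hb)⟩

lemma MeanLE.add {f g : Ω → ℝ} {a b : ℝ} (hf : MeanLE P f a) (hg : MeanLE P g b) :
    MeanLE P (fun ω ↦ f ω + g ω) (a + b) := by
  refine ⟨hf.aemeasurable.add hg.aemeasurable, fun ω ↦ add_nonneg (hf.nonneg ω) (hg.nonneg ω),
    add_nonneg hf.bound_nonneg hg.bound_nonneg, ?_⟩
  simp_rw [ENNReal.ofReal_add (hf.nonneg _) (hg.nonneg _)]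
  rw [lintegral_add_left' hf.aemeasurable.ennreal_ofReal,
    ENNReal.ofReal_add hf.bound_nonneg hg.bound_nonneg]
  exact add_le_add hf.lintegral_le hg.lintegral_le

lemma MeanLE.zero : MeanLE P (fun _ ↦ (0 : ℝ)) 0 :=
  ⟨aemeasurable_const, fun _ ↦ le_rfl, le_rfl, by simp⟩

lemma MeanLE.sum {ι : Type*} (s : Finset ι) {f : ι → Ω → ℝ} {b : ι → ℝ}
    (h : ∀ i ∈ s, MeanLE P (f i) (b i)) :
    MeanLE P (fun ω ↦ ∑ i ∈ s, f i ω) (∑ i ∈ s, b i) := by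
  classical
  induction s using Finset.induction_on with
  | empty => simpa using MeanLE.zero
  | insert i s hi ih =>
    simp_rw [Finset.sum_insert hi]
    exact (h i (by simp)).add (ih fun j hj ↦ h j (by simp [hj]))

lemma MeanLE.const_mul {f : Ω → ℝ} {b c : ℝ} (hc : 0 ≤ c) (h : MeanLE P f b) :
    MeanLE P (fun ω ↦ c * f ω) (c * b) := by
  refine ⟨h.aemeasurable.const_mul c, fun ω ↦ mul_nonneg hc (h.nonneg ω),
    mul_nonneg hc h.bound_nonneg, ?_⟩
  simp_rw [ENNReal.ofReal_mul hc]
  rw [lintegral_const_mul'' _ h.aemeasurable.ennreal_ofReal]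
  gcongr
  exact h.lintegral_le

lemma MeanLE.exp {f : Ω → ℝ} {b : ℝ} (hf : AEMeasurable f P) (hb : 0 ≤ b)
    (h : ∫⁻ ω, ENNReal.ofReal (Real.exp (f ω)) ∂P ≤ ENNReal.ofReal b) :
    MeanLE P (fun ω ↦ Real.exp (f ω)) b :=
  ⟨Real.measurable_exp.comp_aemeasurable hf, fun _ ↦ (Real.exp_pos _).le, hb, h⟩

lemma MeanLE.lintegral_natCast_le {f : Ω → ℝ} {b : ℝ} (h : MeanLE P f b) {k : Ω → ℕ}
    (hk : ∀ᵐ ω ∂P, (k ω : ℝ) ≤ f ω) : ∫⁻ ω, (k ω : ℝ≥0∞) ∂P ≤ ENNReal.ofReal b := by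
  refine le_trans (lintegral_mono_ae ?_) h.lintegral_le
  filter_upwards [hk] with ω hω
  rw [← ENNReal.ofReal_natCast]
  exact ENNReal.ofReal_le_ofReal hω

end MeanLE

/-! ### Outputs of the algorithms -/

section Outputs

variable {U V : Type} [Fintype U] [Fintype V]

open Classical in
/-- The `0/1` matrix of a function. -/
def functionMatrix (σ : U → V) (u : U) (v : V) : ℝ := if σ u = v then 1 else 0

lemma rowConstraint_functionMatrix (σ : U → V) : RowConstraint (functionMatrix σ) := fun u ↦ by
  rw [Finset.sum_eq_single (σ u)]
  · simp [functionMatrix]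
  · intro v _ hv; simp [functionMatrix, hv.symm]
  · simp

lemma boxConstraint_functionMatrix (σ : U → V) : BoxConstraint (functionMatrix σ) := fun u v ↦ by
  unfold functionMatrix
  split_ifs <;> simp

lemma columnConstraint_functionMatrix {σ : U → V} (hσ : Function.Injective σ) :
    ColumnConstraint (functionMatrix σ) := fun v ↦ by
  classical
  simp only [functionMatrix, Finset.sum_boole]
  have : (Finset.univ.filter fun u ↦ σ u = v).card ≤ 1 :=
    Finset.card_le_one.2 fun a ha b hb ↦ hσ (by
      rw [(Finset.mem_filter.1 ha).2, (Finset.mem_filter.1 hb).2])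
  exact_mod_cast this

lemma objective_functionMatrix (S : U → V → ℝ) (τ : ℝ) (σ : U → V) :
    objective S τ (functionMatrix σ) = ∑ u, (S u (σ u) - τ) := by
  refine Finset.sum_congr rfl fun u _ ↦ ?_
  rw [Finset.sum_eq_single (σ u)]
  · simp [functionMatrix]
  · intro v _ hv; simp [functionMatrix, hv.symm]
  · simp

lemma eq_functionMatrix {m : U → V → ℝ} (hm : ∀ u v, m u v = 0 ∨ m u v = 1)
    (hrow : RowConstraint m) : ∃ σ : U → V, m = functionMatrix σ := by
  classical
  have hex : ∀ u, ∃ v, m u v = 1 := fun u ↦ by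
    by_contra! h
    have := hrow u
    rw [Finset.sum_eq_zero fun v _ ↦ (hm u v).resolve_right (h v)] at this
    exact zero_ne_one this
  choose σ hσ using hex
  refine ⟨σ, ?_⟩
  ext u v
  unfold functionMatrix
  split_ifs with h
  · rw [← h, hσ]
  · refine (hm u v).resolve_right fun h1 ↦ ?_
    have h2 := hrow u
    rw [← Finset.add_sum_erase _ _ (Finset.mem_univ v),
      ← Finset.add_sum_erase _ _ (Finset.mem_erase.2 ⟨h, Finset.mem_univ (σ u)⟩), h1, hσ] at h2
    have h3 : 0 ≤ ∑ x ∈ (Finset.univ.erase v).erase (σ u), m u x :=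
      Finset.sum_nonneg fun x _ ↦ by rcases hm u x with h | h <;> simp [h]
    linarith

lemma functionMatrix_row_eq_iff (M : U ↪ V) (σ : U → V) (u : U) :
    functionMatrix σ u = mappingMatrix M u ↔ σ u = M u := by
  classical
  constructor
  · intro h
    have := congrFun h (σ u)
    unfold functionMatrix mappingMatrix at this
    by_contra hne
    rw [if_pos rfl, if_neg (Ne.symm hne)] at this
    exact one_ne_zero this
  · intro h
    ext v
    simp [functionMatrix, mappingMatrix, h]

open Classical in
lemma misalignedUsers_functionMatrix (M : U ↪ V) (σ : U → V) :
    misalignedUsers M (functionMatrix σ) = (Finset.univ.filter fun u ↦ σ u ≠ M u).card := by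
  rw [misalignedUsers, ← Set.ncard_coe_finset]
  congr 1
  ext u
  simp [functionMatrix_row_eq_iff]

lemma misalignedUsers_le_card (M : U ↪ V) (m : U → V → ℝ) :
    misalignedUsers M m ≤ Fintype.card U := by
  rw [misalignedUsers, ← Nat.card_eq_fintype_card]
  exact Set.ncard_le_card _

/-- The column constraint forces an integral solution to be injective, and the true mapping is
itself a feasible competitor. -/
lemma exists_of_isOutput_maxLikelihood {S : U → V → ℝ} {τ : ℝ} {m : U → V → ℝ}
    (h : Algorithm.maxLikelihood.IsOutput S τ m) (M : U ↪ V) :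
    ∃ σ : U → V, m = functionMatrix σ ∧ Function.Injective σ ∧
      ∑ u, S u (M u) ≤ ∑ u, S u (σ u) := by
  classical
  obtain ⟨⟨hcol, hrow, hbox⟩, h01, hopt⟩ := h
  obtain ⟨σ, rfl⟩ := eq_functionMatrix h01 hrow
  refine ⟨σ, rfl, fun a b hab ↦ ?_, ?_⟩
  · by_contra hne
    have h1 := hcol (σ a)
    rw [← Finset.add_sum_erase _ _ (Finset.mem_univ a),
      ← Finset.add_sum_erase _ _ (Finset.mem_erase.2 ⟨Ne.symm hne, Finset.mem_univ b⟩)] at h1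
    have h2 : 0 ≤ ∑ x ∈ (Finset.univ.erase a).erase b, functionMatrix σ x (σ a) :=
      Finset.sum_nonneg fun x _ ↦ (hbox x _).1
    have h3 : functionMatrix σ a (σ a) = 1 := by simp [functionMatrix]
    have h4 : functionMatrix σ b (σ a) = 1 := by simp [functionMatrix, hab]
    linarith
  · have := hopt (functionMatrix M) ⟨columnConstraint_functionMatrix M.injective,
      rowConstraint_functionMatrix _, boxConstraint_functionMatrix _⟩
    rw [objective_functionMatrix, objective_functionMatrix, Finset.sum_sub_distrib,
      Finset.sum_sub_distrib] at this
    linarith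

/-- Without column constraints a single row may be exchanged for the true one, so optimality holds
row by row. -/
lemma exists_of_isOutput_maxRow {S : U → V → ℝ} {τ : ℝ} {m : U → V → ℝ}
    (h : Algorithm.maxRow.IsOutput S τ m) (M : U ↪ V) :
    ∃ σ : U → V, m = functionMatrix σ ∧ ∀ u, S u (M u) ≤ S u (σ u) := by
  classical
  obtain ⟨⟨hrow, hbox⟩, h01, hopt⟩ := h
  obtain ⟨σ, rfl⟩ := eq_functionMatrix h01 hrow
  refine ⟨σ, rfl, fun u ↦ ?_⟩
  have := hopt (functionMatrix (Function.update σ u (M u)))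
    ⟨rowConstraint_functionMatrix _, boxConstraint_functionMatrix _⟩
  rw [objective_functionMatrix, objective_functionMatrix,
    ← Finset.add_sum_erase _ _ (Finset.mem_univ u),
    ← Finset.add_sum_erase (a := u) (f := fun x ↦ S x (σ x) - τ) _ (Finset.mem_univ u),
    Finset.sum_congr rfl (g := fun x ↦ S x (σ x) - τ) (fun x hx ↦ by
      rw [Function.update_of_ne (Finset.ne_of_mem_erase hx)])] at this
  simp only [Function.update_self] at this
  linarith

/-- Threshold testing decides a pair by comparing its score with the threshold. -/
lemma isOutput_thresholdTesting {S : U → V → ℝ} {τ : ℝ} {m : U → V → ℝ}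
    (h : Algorithm.thresholdTesting.IsOutput S τ m) (u : U) (v : V) :
    (τ < S u v → m u v = 1) ∧ (S u v < τ → m u v = 0) := by
  classical
  obtain ⟨hbox, h01, hopt⟩ := h
  have key : ∀ x ∈ Set.Icc (0 : ℝ) 1, (S u v - τ) * x ≤ (S u v - τ) * m u v := by
    intro x hx
    have := hopt (Function.update m u (Function.update (m u) v x)) (fun a b ↦ by
      by_cases ha : a = u
      · subst ha
        rw [Function.update_self]
        by_cases hb : b = v
        · subst hb; rwa [Function.update_self]
        · rw [Function.update_of_ne hb]; exact hbox _ _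
      · rw [Function.update_of_ne ha]; exact hbox _ _)
    unfold objective at this
    rw [← Finset.add_sum_erase _ _ (Finset.mem_univ u),
      ← Finset.add_sum_erase (a := u) (f := fun a ↦ ∑ b, (S a b - τ) * m a b) _
        (Finset.mem_univ u),
      Finset.sum_congr rfl (g := fun a ↦ ∑ b, (S a b - τ) * m a b) (fun a ha ↦ by
        rw [Function.update_of_ne (Finset.ne_of_mem_erase ha)])] at this
    simp only [Function.update_self] at this
    rw [← Finset.add_sum_erase _ _ (Finset.mem_univ v),
      ← Finset.add_sum_erase (a := v) (f := fun b ↦ (S u b - τ) * m u b) _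
        (Finset.mem_univ v),
      Finset.sum_congr rfl (g := fun b ↦ (S u b - τ) * m u b) (fun b hb ↦ by
        rw [Function.update_of_ne (Finset.ne_of_mem_erase hb)])] at this
    simp only [Function.update_self] at this
    linarith
  have h0 := key 0 (by simp)
  have h1 := key 1 (by simp)
  constructor
  · intro hlt
    rcases h01 u v with h | h
    · rw [h] at h1; linarith
    · exact h
  · intro hlt
    rcases h01 u v with h | h
    · exact h
    · rw [h] at h0; linarith

/-- This allows the planted scores `μ W` to be replaced by log-likelihood ratios, at the price of
shifting the threshold. -/
lemma isOutput_sub_const {alg : Algorithm} {S : U → V → ℝ} {τ c : ℝ} {m : U → V → ℝ}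
    (h : alg.IsOutput S τ m) : alg.IsOutput (fun u v ↦ S u v - c) (τ - c) m := by
  have : ∀ m' : U → V → ℝ, objective (fun u v ↦ S u v - c) (τ - c) m' = objective S τ m' :=
    fun m' ↦ by simp [objective]
  exact ⟨h.1, h.2.1, fun m' hm' ↦ by rw [this, this]; exact h.2.2 m' hm'⟩

end Outputs

/-! ### Expected number of errors in terms of exponential moments -/

section Master

variable {U V Ω : Type} [Fintype U] [Fintype V] [MeasurableSpace Ω]

/-- Exponential moments along alternating paths and cycles, with a factor `ρ` per pair. -/
structure ChainBound (P : Measure Ω) (M : U ↪ V) (S : Ω → U → V → ℝ) (p ρ : ℝ) : Prop where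
  path : ∀ u l, (u :: l).Nodup →
    ∫⁻ ω, ENNReal.ofReal (Real.exp (chainScore p M (S ω) (u :: l))) ∂P ≤
      ENNReal.ofReal (ρ ^ (2 * l.length + 1))
  exit : ∀ u l v, (u :: l).Nodup → (∀ x ∈ u :: l, M x ≠ v) →
    ∫⁻ ω, ENNReal.ofReal (Real.exp (chainScore p M (S ω) (u :: l) + p * S ω u v)) ∂P ≤
      ENNReal.ofReal (ρ ^ (2 * l.length + 2))
  cycle : ∀ u l, (u :: l).Nodup → l ≠ [] →
    ∫⁻ ω, ENNReal.ofReal (Real.exp (chainScore p M (S ω) (u :: l) +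
        p * S ω u (M ((u :: l).getLast (List.cons_ne_nil u l))))) ∂P ≤
      ENNReal.ofReal (ρ ^ (2 * l.length + 2))

lemma ChainBound.mono {P : Measure Ω} {M : U ↪ V} {S : Ω → U → V → ℝ} {p ρ ρ' : ℝ}
    (h : ChainBound P M S p ρ) (hρ : 0 ≤ ρ) (hρ' : ρ ≤ ρ') : ChainBound P M S p ρ' where
  path u l hl := (h.path u l hl).trans (ENNReal.ofReal_le_ofReal (by gcongr))
  exit u l v hl hv := (h.exit u l v hl hv).trans (ENNReal.ofReal_le_ofReal (by gcongr))
  cycle u l hl hne := (h.cycle u l hl hne).trans (ENNReal.ofReal_le_ofReal (by gcongr))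

lemma aemeasurable_chainScore {P : Measure Ω} {S : Ω → U → V → ℝ}
    (hS : ∀ u v, AEMeasurable (fun ω ↦ S ω u v) P) (p : ℝ) (M : U → V) (l : List U) :
    AEMeasurable (fun ω ↦ chainScore p M (S ω) l) P := by
  induction l with
  | nil => exact aemeasurable_const
  | cons u l ih =>
    cases l with
    | nil => exact (hS _ _).const_mul _
    | cons w l => exact (((hS _ _).const_mul _).add ((hS _ _).const_mul _)).add ih

lemma card_not_mem_range (M : U ↪ V) [DecidablePred fun v ↦ v ∉ Set.range M] :
    ((Finset.univ.filter fun v ↦ v ∉ Set.range M).card : ℝ) =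
      (Fintype.card V : ℝ) - Fintype.card U := by
  classical
  have h := Finset.card_filter_add_card_filter_not (s := (Finset.univ : Finset V))
    (fun v ↦ v ∈ Set.range M)
  have h2 : (Finset.univ.filter fun v ↦ v ∈ Set.range M) = Finset.univ.map M := by
    ext v; simp
  rw [h2, Finset.card_map, Finset.card_univ, Finset.card_univ] at h
  rw [← h]
  push_cast
  have h3 : (Finset.univ.filter fun v ↦ v ∉ Set.range M).card =
      (Finset.univ.filter fun v ↦ ¬ v ∈ Set.range M).card := by congr
  rw [h3]
  ring

/-- A path through `k` users has `2k - 1` pairs. An exit or a closing edge makes `2k`, and one more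
user makes `2k + 1`; hence the common factor `ρ ^ (2k)` with one extra `ρ` for the second kind. -/
lemma meanLE_completionWeight {P : Measure Ω} {M : U ↪ V} {S : Ω → U → V → ℝ}
    (hS : ∀ u v, AEMeasurable (fun ω ↦ S ω u v) P) {p ρ : ℝ} (hρ : 0 ≤ ρ)
    (hb : ChainBound P M S p ρ) (t : ℝ) (l : List U) (hl : l.Nodup) :
    MeanLE P (fun ω ↦ completionWeight p t M (S ω) l)
      (if l.length = 0 then 0 else ρ ^ (2 * l.length) *
        ((Fintype.card V - Fintype.card U + 1) +
          Fintype.card U * (Real.exp ((1 - p) * t) * ρ))) := by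
  classical
  cases l with
  | nil => exact MeanLE.zero
  | cons u l =>
    rw [if_neg (by simp)]
    have h1 : MeanLE P (fun ω ↦ ∑ v with v ∉ Set.range M,
        Real.exp (chainScore p M (S ω) (u :: l) + p * S ω u v))
        ((Fintype.card V - Fintype.card U) * ρ ^ (2 * (u :: l).length)) := by
      have := MeanLE.sum (P := P) (Finset.univ.filter fun v ↦ v ∉ Set.range M)
        (f := fun v ω ↦ Real.exp (chainScore p M (S ω) (u :: l) + p * S ω u v))
        (b := fun _ ↦ ρ ^ (2 * (u :: l).length)) (fun v hv ↦
          MeanLE.exp ((aemeasurable_chainScore hS p M _).add ((hS u v).const_mul p))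
            (by positivity)
            (hb.exit u l v hl fun x _ hx ↦ (Finset.mem_filter.1 hv).2 ⟨x, hx⟩))
      rwa [Finset.sum_const, nsmul_eq_mul, card_not_mem_range] at this
    have h2 : MeanLE P (fun ω ↦ ∑ c with c ∉ u :: l,
        Real.exp ((1 - p) * t) * Real.exp (chainScore p M (S ω) (c :: u :: l)))
        (Fintype.card U * (Real.exp ((1 - p) * t) * ρ ^ (2 * (u :: l).length + 1))) := by
      have := MeanLE.sum (P := P) (Finset.univ.filter fun c ↦ c ∉ u :: l)
        (f := fun c ω ↦ Real.exp ((1 - p) * t) * Real.exp (chainScore p M (S ω) (c :: u :: l)))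
        (b := fun _ ↦ Real.exp ((1 - p) * t) * ρ ^ (2 * (u :: l).length + 1)) (fun c hc ↦
          (MeanLE.exp (aemeasurable_chainScore hS p M _) (by positivity)
            (hb.path c (u :: l) (List.nodup_cons.2 ⟨(Finset.mem_filter.1 hc).2, hl⟩))).const_mul
              (by positivity))
      refine this.mono ?_
      rw [Finset.sum_const, nsmul_eq_mul]
      gcongr
      exact Finset.card_le_univ _
    have h3 : MeanLE P (fun ω ↦ if l = [] then 0 else
        Real.exp (chainScore p M (S ω) (u :: l) +
          p * S ω u (M ((u :: l).getLast (List.cons_ne_nil u l))))) (ρ ^ (2 * (u :: l).length)) := by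
      split_ifs with h
      · exact MeanLE.zero.mono (by positivity)
      · exact MeanLE.exp ((aemeasurable_chainScore hS p M _).add ((hS u _).const_mul p))
          (by positivity) (hb.cycle u l hl h)
    refine ((h1.add h2).add h3).mono (le_of_eq ?_)
    ring

lemma sum_geometric_le {x x₀ : ℝ} (hx : 0 ≤ x) (hxx : x ≤ x₀) (hx₀ : x₀ < 1) (n : ℕ) :
    ∑ k ∈ Finset.range (n + 1), (if k = 0 then 0 else x ^ k) ≤ x / (1 - x₀) := by
  rw [Finset.sum_range_succ']
  simp only [Nat.add_eq_zero_iff, one_ne_zero, and_false, if_false, if_true, add_zero, pow_succ]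
  rw [← Finset.sum_mul, le_div_iff₀ (by linarith)]
  have h1 := mul_neg_geom_sum x n
  have h2 : 0 ≤ ∑ i ∈ Finset.range n, x ^ i := by positivity
  have h3 : 0 ≤ x ^ n := by positivity
  have h4 : (∑ i ∈ Finset.range n, x ^ i) * (1 - x₀) ≤ 1 := by nlinarith
  nlinarith

/-- The expected number of errors of maximum likelihood estimation. -/
lemma lintegral_maxLikelihood_le {P : Measure Ω} {M : U ↪ V} {S : Ω → U → V → ℝ}
    (hS : ∀ u v, AEMeasurable (fun ω ↦ S ω u v) P) {p ρ : ℝ} (hρ : 0 ≤ ρ)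
    (hb : ChainBound P M S p ρ) (hp : 1 / 2 ≤ p) (hp1 : p < 1) (hcard : Fintype.card U < Fintype.card V)
    {τ : ℝ} {m : Ω → U → V → ℝ}
    (hm : ∀ᵐ ω ∂P, Algorithm.maxLikelihood.IsOutput (S ω) τ (m ω))
    (t η x₀ : ℝ) (hη : 0 < η) (hx₀ : x₀ < 1)
    (hx : Real.exp η * Real.exp ((1 - 2 * p) * t) * Fintype.card U * ρ ^ 2 ≤ x₀) :
    ∫⁻ ω, (Algorithm.maxLikelihood.numErrors M (m ω) : ℝ≥0∞) ∂P ≤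
      ENNReal.ofReal ((p / (η * (1 - p)) + 1 / (η * (1 - x₀))) *
          (Fintype.card U * (Real.exp ((1 - p) * t) * ρ)) +
        2 / (η * (1 - x₀)) *
          (Real.exp η * Real.exp ((1 - 2 * p) * t) * Fintype.card U * ρ ^ 2) *
          (Fintype.card V - Fintype.card U)) := by
  classical
  have hp0 : 0 < 1 - p := by linarith
  have hx1 : 0 < 1 - x₀ := by linarith
  have hcard' : (Fintype.card U : ℝ) + 1 ≤ Fintype.card V := by exact_mod_cast hcard
  set n : ℝ := (Fintype.card U : ℝ) with hn
  set N : ℝ := (Fintype.card V : ℝ) with hN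
  set D : ℝ := (N - n + 1) + n * (Real.exp ((1 - p) * t) * ρ) with hD
  set c : ℝ := Real.exp η * Real.exp ((1 - 2 * p) * t) with hc
  have hn0 : 0 ≤ n := by positivity
  have hD0 : 0 ≤ D := by
    have : 0 ≤ n * (Real.exp ((1 - p) * t) * ρ) := by positivity
    linarith
  have h1 : MeanLE P (fun ω ↦ p / (η * (1 - p)) *
      ∑ u, Real.exp ((1 - p) * t) * Real.exp (chainScore p M (S ω) [u]))
      (p / (η * (1 - p)) * (n * (Real.exp ((1 - p) * t) * ρ))) := by
    have := (MeanLE.sum (P := P) (Finset.univ : Finset U)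
      (f := fun u ω ↦ Real.exp ((1 - p) * t) * Real.exp (chainScore p M (S ω) [u]))
      (b := fun _ ↦ Real.exp ((1 - p) * t) * ρ) (fun u _ ↦
        (MeanLE.exp (aemeasurable_chainScore hS p M _) hρ (by
          simpa using hb.path u [] (by simp))).const_mul (by positivity))).const_mul
      (show 0 ≤ p / (η * (1 - p)) by positivity)
    rwa [Finset.sum_const, nsmul_eq_mul, Finset.card_univ] at this
  have h2 : MeanLE P (fun ω ↦ ∑ l : {l : List U // l.Nodup},
      1 / η * c ^ l.1.length * completionWeight p t M (S ω) l.1)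
      (1 / η * (c * n * ρ ^ 2 / (1 - x₀)) * D) := by
    have := MeanLE.sum (P := P) (Finset.univ : Finset {l : List U // l.Nodup})
      (f := fun l ω ↦ 1 / η * c ^ l.1.length * completionWeight p t M (S ω) l.1)
      (b := fun l ↦ 1 / η * c ^ l.1.length *
        (if l.1.length = 0 then 0 else ρ ^ (2 * l.1.length) * D))
      (fun l _ ↦ (meanLE_completionWeight hS hρ hb t l.1 l.2).const_mul (by positivity))
    refine this.mono ((sum_nodup_lists_le (fun k ↦ 1 / η * c ^ k *
        (if k = 0 then 0 else ρ ^ (2 * k) * D)) (fun k ↦ ?_)).trans ?_)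
    · split_ifs <;> positivity
    -- At most `n ^ k` lists of length `k`, each with weight `c ^ k * ρ ^ (2k)`, form the geometric
    -- series of ratio `c * n * ρ²`.
    · have e : ∀ k ∈ Finset.range (Fintype.card U + 1), n ^ k * (1 / η * c ^ k *
          (if k = 0 then 0 else ρ ^ (2 * k) * D)) =
          1 / η * D * (if k = 0 then 0 else (c * n * ρ ^ 2) ^ k) := fun k _ ↦ by
        split_ifs
        · simp
        · rw [mul_pow, mul_pow, ← pow_mul]; ring
      rw [Finset.sum_congr rfl e, ← Finset.mul_sum]
      have := mul_le_mul_of_nonneg_left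
        (sum_geometric_le (x := c * n * ρ ^ 2) (by positivity) hx hx₀ (Fintype.card U))
        (show 0 ≤ 1 / η * D by positivity)
      refine this.trans (le_of_eq ?_)
      ring
  refine ((h1.add h2).mono ?_).lintegral_natCast_le ?_
  · have hx0 : 0 ≤ c * n * ρ ^ 2 := by positivity
    -- Here `N - n + 1 ≤ 2 (N - n)` because `n < N`, and the ratio is below one, so the low-score
    -- term keeps its size.
    have hD2 : c * n * ρ ^ 2 * D ≤ 2 * (c * n * ρ ^ 2) * (N - n) +
        n * (Real.exp ((1 - p) * t) * ρ) := by
      rw [hD]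
      have : 0 ≤ n * (Real.exp ((1 - p) * t) * ρ) := by positivity
      nlinarith
    have := mul_le_mul_of_nonneg_left hD2 (show 0 ≤ 1 / (η * (1 - x₀)) by positivity)
    have e1 : 1 / η * (c * n * ρ ^ 2 / (1 - x₀)) * D =
        1 / (η * (1 - x₀)) * (c * n * ρ ^ 2 * D) := by field_simp
    rw [e1]
    refine (add_le_add_right this _).trans (le_of_eq ?_)
    ring
  · filter_upwards [hm] with ω hω
    obtain ⟨σ, hσm, hσ, hopt⟩ := exists_of_isOutput_maxLikelihood hω M
    have := card_errors_le (t := t) hp hp1 hη M σ hσ (S ω) hopt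
    change (misalignedUsers M (m ω) : ℝ) ≤ _
    rw [hσm, misalignedUsers_functionMatrix]
    exact this

/-- The expected number of errors of maximum row estimation. -/
lemma lintegral_maxRow_le {P : Measure Ω} {M : U ↪ V} {S : Ω → U → V → ℝ}
    (hS : ∀ u v, AEMeasurable (fun ω ↦ S ω u v) P) {p ρ : ℝ} (hρ : 0 ≤ ρ)
    (hb : ChainBound P M S p ρ) (hp : 1 / 2 ≤ p) (hp1 : p < 1)
    {τ : ℝ} {m : Ω → U → V → ℝ}
    (hm : ∀ᵐ ω ∂P, Algorithm.maxRow.IsOutput (S ω) τ (m ω)) (t : ℝ) :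
    ∫⁻ ω, (Algorithm.maxRow.numErrors M (m ω) : ℝ≥0∞) ∂P ≤
      ENNReal.ofReal (Fintype.card U * (Real.exp ((1 - p) * t) * ρ) +
        Fintype.card U * (Fintype.card V * (Real.exp ((1 - 2 * p) * t) * ρ ^ 2))) := by
  classical
  have h1 : ∀ u, MeanLE P (fun ω ↦ Real.exp ((1 - p) * t) * Real.exp (chainScore p M (S ω) [u]) +
      ∑ v with M u ≠ v, Real.exp ((1 - 2 * p) * t) *
        Real.exp (chainScore p M (S ω) [u] + p * S ω u v))
      (Real.exp ((1 - p) * t) * ρ +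
        Fintype.card V * (Real.exp ((1 - 2 * p) * t) * ρ ^ 2)) := fun u ↦ by
    have a1 := (MeanLE.exp (aemeasurable_chainScore hS p M [u]) hρ (by
          simpa using hb.path u [] (by simp))).const_mul (Real.exp_pos ((1 - p) * t)).le
    have a2 := MeanLE.sum (P := P) (Finset.univ.filter fun v ↦ M u ≠ v)
      (f := fun v ω ↦ Real.exp ((1 - 2 * p) * t) *
        Real.exp (chainScore p M (S ω) [u] + p * S ω u v))
      (b := fun _ ↦ Real.exp ((1 - 2 * p) * t) * ρ ^ 2)
      (fun v hv ↦ (MeanLE.exp ((aemeasurable_chainScore hS p M [u]).add ((hS u v).const_mul p))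
        (by positivity) (by
          simpa using hb.exit u [] v (by simp) (by simpa using (Finset.mem_filter.1 hv).2))).const_mul
          (by positivity))
    refine a1.add (a2.mono ?_)
    rw [Finset.sum_const, nsmul_eq_mul]
    gcongr
    exact Finset.card_le_univ _
  have h2 := MeanLE.sum (P := P) (Finset.univ : Finset U) (fun u _ ↦ h1 u)
  rw [Finset.sum_const, nsmul_eq_mul, Finset.card_univ, mul_add] at h2
  refine h2.lintegral_natCast_le ?_
  filter_upwards [hm] with ω hω
  obtain ⟨σ, hσm, hopt⟩ := exists_of_isOutput_maxRow hω M
  change (misalignedUsers M (m ω) : ℝ) ≤ _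
  rw [hσm, misalignedUsers_functionMatrix, Finset.card_filter, Nat.cast_sum]
  refine Finset.sum_le_sum fun u _ ↦ ?_
  have n1 : 0 ≤ ∑ v with M u ≠ v, Real.exp ((1 - 2 * p) * t) *
        Real.exp (chainScore p M (S ω) [u] + p * S ω u v) := by positivity
  have n2 : 0 ≤ Real.exp ((1 - p) * t) * Real.exp (chainScore p M (S ω) [u]) := by positivity
  split_ifs with hne
  · push_cast
    -- If the true score reaches `t`, the chosen `v` does at least as well, and `p * S v - (1 - p) *
    -- S (M u) ≥ (2p - 1) * t`, so the term of `v` is at least one. Otherwise the low-score term is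
    -- at least one.
    rcases le_total t (S ω u (M u)) with h | h
    · have : 1 ≤ ∑ v with M u ≠ v, Real.exp ((1 - 2 * p) * t) *
          Real.exp (chainScore p M (S ω) [u] + p * S ω u v) := by
        refine le_trans ?_ (Finset.single_le_sum
          (f := fun v ↦ Real.exp ((1 - 2 * p) * t) *
            Real.exp (chainScore p M (S ω) [u] + p * S ω u v))
          (fun _ _ ↦ by positivity) (Finset.mem_filter.2 ⟨Finset.mem_univ (σ u), Ne.symm hne⟩))
        rw [← Real.exp_add, Real.one_le_exp_iff]
        simp only [chainScore]
        nlinarith [hopt u]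
      linarith
    · have : 1 ≤ Real.exp ((1 - p) * t) * Real.exp (chainScore p M (S ω) [u]) := by
        rw [← Real.exp_add, Real.one_le_exp_iff]
        simp only [chainScore]
        nlinarith
      linarith
  · push_cast
    linarith

/-- The expected number of errors of threshold testing. -/
lemma lintegral_thresholdTesting_le {P : Measure Ω} {M : U ↪ V} {S : Ω → U → V → ℝ}
    (hS : ∀ u v, AEMeasurable (fun ω ↦ S ω u v) P) {p q a b τ : ℝ} (hp : 0 ≤ p) (hq : 0 ≤ q)
    (ha : 0 ≤ a) (hb : 0 ≤ b)
    (htrue : ∀ u, ∫⁻ ω, ENNReal.ofReal (Real.exp (-q * S ω u (M u))) ∂P ≤ ENNReal.ofReal a)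
    (hfalse : ∀ u v, M u ≠ v → ∫⁻ ω, ENNReal.ofReal (Real.exp (p * S ω u v)) ∂P ≤ ENNReal.ofReal b)
    {m : Ω → U → V → ℝ}
    (hm : ∀ᵐ ω ∂P, Algorithm.thresholdTesting.IsOutput (S ω) τ (m ω)) :
    ∫⁻ ω, (Algorithm.thresholdTesting.numErrors M (m ω) : ℝ≥0∞) ∂P ≤
      ENNReal.ofReal (Fintype.card U * (Real.exp (q * τ) * a) +
        Fintype.card U * (Fintype.card V * (Real.exp (-p * τ) * b))) := by
  classical
  have h1 : ∀ x : U × V, MeanLE P (fun ω ↦ if M x.1 = x.2 then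
      Real.exp (q * τ) * Real.exp (-q * S ω x.1 (M x.1)) else
      Real.exp (-p * τ) * Real.exp (p * S ω x.1 x.2))
      (if M x.1 = x.2 then Real.exp (q * τ) * a else Real.exp (-p * τ) * b) := fun x ↦ by
    split_ifs with h
    · exact (MeanLE.exp ((hS _ _).const_mul _) ha (htrue _)).const_mul (by positivity)
    · exact (MeanLE.exp ((hS _ _).const_mul _) hb (hfalse _ _ h)).const_mul (by positivity)
  have h2 := MeanLE.sum (P := P) (Finset.univ : Finset (U × V)) (fun x _ ↦ h1 x)
  refine (h2.mono ?_).lintegral_natCast_le ?_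
  · rw [Fintype.sum_prod_type]
    have : ∀ u : U, ∑ v, (if M u = v then Real.exp (q * τ) * a else Real.exp (-p * τ) * b) ≤
        Real.exp (q * τ) * a + Fintype.card V * (Real.exp (-p * τ) * b) := fun u ↦ by
      have e : ∑ v, (if M u = v then Real.exp (q * τ) * a else Real.exp (-p * τ) * b) ≤
          ∑ v, ((if M u = v then Real.exp (q * τ) * a else 0) + Real.exp (-p * τ) * b) := by
        refine Finset.sum_le_sum fun v _ ↦ ?_
        have : 0 ≤ Real.exp (-p * τ) * b := by positivity
        split_ifs <;> linarith
      refine e.trans (le_of_eq ?_)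
      rw [Finset.sum_add_distrib, Finset.sum_ite_eq, if_pos (Finset.mem_univ _),
        Finset.sum_const, nsmul_eq_mul, Finset.card_univ]
    refine (Finset.sum_le_sum fun u _ ↦ this u).trans (le_of_eq ?_)
    rw [Finset.sum_const, nsmul_eq_mul, Finset.card_univ, mul_add]
  · filter_upwards [hm] with ω hω
    change (wrongPairs M (m ω) : ℝ) ≤ _
    have e1 : wrongPairs M (m ω) = (Finset.univ.filter fun x : U × V ↦
        m ω x.1 x.2 ≠ mappingMatrix M x.1 x.2).card := by
      rw [wrongPairs, ← Set.ncard_coe_finset]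
      congr 1
      ext x
      simp
    rw [e1, Finset.card_filter, Nat.cast_sum]
    refine Finset.sum_le_sum fun x _ ↦ ?_
    obtain ⟨ho1, ho2⟩ := isOutput_thresholdTesting hω x.1 x.2
    by_cases hne : m ω x.1 x.2 ≠ mappingMatrix M x.1 x.2
    · rw [if_pos hne]
      push_cast
      unfold mappingMatrix at hne
      split_ifs with h
      · rw [if_pos h] at hne
        have : S ω x.1 x.2 ≤ τ := by
          by_contra! hlt
          exact hne (ho1 hlt)
        rw [← Real.exp_add, Real.one_le_exp_iff, h]
        nlinarith
      · rw [if_neg h] at hne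
        have : τ ≤ S ω x.1 x.2 := by
          by_contra! hlt
          exact hne (ho2 hlt)
        rw [← Real.exp_add, Real.one_le_exp_iff]
        nlinarith
    · rw [if_neg hne]
      split_ifs <;> push_cast <;> positivity

end Master

/-! ### Asymptotic rates -/

section Rates

/-- The bound for the errors of maximum row estimation at every truncation level. -/
def RowRate (E : ℝ≥0∞) (n N : ℕ) (p ρ : ℝ) : Prop :=
  ∀ t : ℝ, E ≤ ENNReal.ofReal (n * (Real.exp ((1 - p) * t) * ρ) +
    n * (N * (Real.exp ((1 - 2 * p) * t) * ρ ^ 2)))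

/-- The bound for the errors of maximum likelihood estimation at every truncation level. -/
def LikelihoodRate (E : ℝ≥0∞) (n N : ℕ) (p ρ : ℝ) : Prop :=
  ∀ t η x₀ : ℝ, 0 < η → x₀ < 1 →
    Real.exp η * Real.exp ((1 - 2 * p) * t) * n * ρ ^ 2 ≤ x₀ →
    E ≤ ENNReal.ofReal ((p / (η * (1 - p)) + 1 / (η * (1 - x₀))) *
          (n * (Real.exp ((1 - p) * t) * ρ)) +
        2 / (η * (1 - x₀)) *
          (Real.exp η * Real.exp ((1 - 2 * p) * t) * n * ρ ^ 2) * ((N : ℝ) - n))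

variable {n N : ℕ}

lemma natCast_eq_exp_log (hn : 2 ≤ n) : (n : ℝ) = Real.exp (Real.log n) := by
  rw [Real.exp_log (by positivity)]

lemma rpow_eq_exp_log (hn : 2 ≤ n) (y : ℝ) : (n : ℝ) ^ y = Real.exp (Real.log n * y) :=
  Real.rpow_def_of_pos (by positivity) y

lemma log_natCast_pos (hn : 2 ≤ n) : 0 < Real.log n :=
  Real.log_pos (by exact_mod_cast hn)

lemma sub_eq_exp_excessExponent (hn : 2 ≤ n) (hN : n < N) :
    (N : ℝ) - n = Real.exp (excessExponent n N * Real.log n) := by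
  have h : (0 : ℝ) < (N : ℝ) - n := sub_pos.2 (by exact_mod_cast hN)
  rw [excessExponent, div_mul_cancel₀ _ (log_natCast_pos hn).ne', Real.exp_log h]

/-- Split `N = (N - n) + n`; the larger exponent wins, which is the origin of `max α 1`. -/
lemma natCast_le_two_mul_exp (hn : 2 ≤ n) (hN : n < N) :
    (N : ℝ) ≤ 2 * Real.exp (max (excessExponent n N) 1 * Real.log n) := by
  have h1 := sub_eq_exp_excessExponent hn hN
  have hL := log_natCast_pos hn
  have h2 : Real.exp (excessExponent n N * Real.log n) ≤
      Real.exp (max (excessExponent n N) 1 * Real.log n) :=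
    Real.exp_le_exp.2 (mul_le_mul_of_nonneg_right (le_max_left _ _) hL.le)
  have h3 : (n : ℝ) ≤ Real.exp (max (excessExponent n N) 1 * Real.log n) := by
    conv_lhs => rw [natCast_eq_exp_log hn]
    refine Real.exp_le_exp.2 ?_
    have := mul_le_mul_of_nonneg_right (le_max_right (excessExponent n N) 1) hL.le
    linarith
  linarith

/-- Constant factors and finitely many `n` are absorbed in the `o(1)`. -/
lemma exists_exponent (β : ℝ) {C : ℝ} (hC : 0 < C) {ω : ℕ → ℝ} (hω : Tendsto ω atTop (𝓝 0))
    (n₀ : ℕ) : ∃ e : ℕ → ℝ, Tendsto e atTop (𝓝 0) ∧ ∀ n : ℕ, 2 ≤ n →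
      (n₀ ≤ n → C * (n : ℝ) ^ (1 - β + ω n) ≤ (n : ℝ) ^ (1 - β + e n)) ∧
      (n < n₀ → (n : ℝ) ≤ (n : ℝ) ^ (1 - β + e n)) := by
  -- For small `n` the exponent becomes `1`, the trivial bound by `n` errors; for large `n` the
  -- constant is `n ^ (log C / log n)`.
  refine ⟨fun n ↦ if n < n₀ then β else ω n + Real.log C / Real.log n, ?_, fun n hn ↦ ⟨?_, ?_⟩⟩
  · have h1 : Tendsto (fun n : ℕ ↦ ω n + Real.log C / Real.log n) atTop (𝓝 0) := by
      have : Tendsto (fun n : ℕ ↦ Real.log C / Real.log n) atTop (𝓝 0) :=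
        tendsto_const_nhds.div_atTop (Real.tendsto_log_atTop.comp tendsto_natCast_atTop_atTop)
      simpa using hω.add this
    refine h1.congr' ?_
    filter_upwards [eventually_ge_atTop n₀] with n hn
    rw [if_neg (not_lt.2 hn)]
  · intro h
    simp only [if_neg (not_lt.2 h)]
    rw [rpow_eq_exp_log hn, rpow_eq_exp_log hn]
    nth_rewrite 1 [← Real.exp_log hC]
    rw [← Real.exp_add]
    refine le_of_eq (congrArg Real.exp ?_)
    have := (log_natCast_pos hn).ne'
    field_simp
    ring
  · intro h
    simp only [if_pos h]
    rw [sub_add_cancel, Real.rpow_one]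

/-- Maximum likelihood at `p = 1/2`. -/
lemma LikelihoodRate.half {E : ℝ≥0∞} {ζ β η x₀ A : ℝ} (hn : 2 ≤ n) (hη : 0 < η) (hx₀ : x₀ < 1)
    (h : LikelihoodRate E n N (1 / 2) (Real.exp (-ζ / 4)))
    (h1 : Real.exp (η + Real.log n - ζ / 2) ≤ x₀)
    (h2 : Real.exp (η + Real.log n - ζ / 2) * ((N : ℝ) - n) ≤ A * (n : ℝ) ^ (1 - β)) :
    E ≤ ENNReal.ofReal ((1 / η + (1 + 2 * A) / (η * (1 - x₀))) * (n : ℝ) ^ (1 - β)) := by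
  have hx1 : 0 < 1 - x₀ := by linarith
  -- At `p = 1/2` the level drops out of the ratio. It is therefore free, and `2 * (-β * log n + ζ /
  -- 4)` makes the low-score term exactly `n ^ (1 - β)`.
  have hx : Real.exp η * Real.exp ((1 - 2 * (1 / 2)) * (2 * (-β * Real.log n + ζ / 4))) * n *
      Real.exp (-ζ / 4) ^ 2 = Real.exp (η + Real.log n - ζ / 2) := by
    rw [← Real.exp_nat_mul]
    nth_rewrite 2 [natCast_eq_exp_log hn]
    rw [← Real.exp_add, ← Real.exp_add, ← Real.exp_add]
    congr 1
    push_cast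
    ring
  have hEb : (n : ℝ) * (Real.exp ((1 - 1 / 2) * (2 * (-β * Real.log n + ζ / 4))) *
      Real.exp (-ζ / 4)) = (n : ℝ) ^ (1 - β) := by
    rw [rpow_eq_exp_log hn, ← Real.exp_add]
    nth_rewrite 1 [natCast_eq_exp_log hn]
    rw [← Real.exp_add]
    congr 1
    ring
  have := h (2 * (-β * Real.log n + ζ / 4)) η x₀ hη hx₀ (by rw [hx]; exact h1)
  rw [hx, hEb] at this
  refine this.trans (ENNReal.ofReal_le_ofReal ?_)
  have h3 := mul_le_mul_of_nonneg_left h2 (show 0 ≤ 2 / (η * (1 - x₀)) by positivity)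
  have e : (1 / η + (1 + 2 * A) / (η * (1 - x₀))) * (n : ℝ) ^ (1 - β) =
      (1 / 2 / (η * (1 - 1 / 2)) + 1 / (η * (1 - x₀))) * (n : ℝ) ^ (1 - β) +
      2 / (η * (1 - x₀)) * (A * (n : ℝ) ^ (1 - β)) := by
    field_simp
    ring
  rw [e, mul_assoc (2 / (η * (1 - x₀)))]
  linarith

/-- For `β ≤ 1 - α` the whole excess `N - n = n ^ α` is within the budget `n ^ (1 - β)`, so only
convergence of the series matters: the ratio must stay below a constant less than one. -/
lemma likelihoodRate_vertical (β : ℝ) : ∃ C > 0, ∀ (n N : ℕ) (ζ : ℝ) (E : ℝ≥0∞), 2 ≤ n → n < N →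
    β ≤ 1 - excessExponent n N →
    2 * Real.log n + 2 * Real.log ((3 + √5) / 2) ≤ ζ →
    LikelihoodRate E n N (1 / 2) (Real.exp (-ζ / 4)) →
    E ≤ ENNReal.ofReal (C * (n : ℝ) ^ (1 - β)) := by
  have h5 : (2 : ℝ) ≤ √5 := Real.le_sqrt_of_sq_le (by norm_num)
  -- With `η = 1/2` the ratio is at most `exp (1/2)` over the boundary constant; the crude bounds
  -- `2` and `5/2` give `4/5`.
  have hA : Real.exp (1 / 2) / ((3 + √5) / 2) ≤ 4 / 5 := by
    have h1 : Real.exp (1 / 2) ≤ 2 := by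
      have h2 : Real.exp (1 / 2) ^ 2 ≤ 2 ^ 2 := by
        rw [← Real.exp_nat_mul]
        have := Real.exp_one_lt_d9
        norm_num at this ⊢
        linarith
      exact le_of_sq_le_sq h2 (by norm_num)
    rw [div_le_iff₀ (by linarith)]
    linarith
  refine ⟨1 / (1 / 2) + (1 + 2 * 1) / (1 / 2 * (1 - 4 / 5)), by norm_num, ?_⟩
  intro n N ζ E hn hN hβ hζ hE
  have hL := log_natCast_pos hn
  have hx : Real.exp (1 / 2 + Real.log n - ζ / 2) ≤ 4 / 5 := by
    refine le_trans ?_ hA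
    rw [← Real.exp_log (show 0 < (3 + √5) / 2 by linarith), ← Real.exp_sub]
    exact Real.exp_le_exp.2 (by linarith)
  refine hE.half hn (by norm_num) (by norm_num) hx ?_
  rw [sub_eq_exp_excessExponent hn hN, rpow_eq_exp_log hn, one_mul]
  calc Real.exp (1 / 2 + Real.log n - ζ / 2) * Real.exp (excessExponent n N * Real.log n)
      ≤ 1 * Real.exp (excessExponent n N * Real.log n) :=
        mul_le_mul_of_nonneg_right (hx.trans (by norm_num)) (Real.exp_pos _).le
    _ ≤ Real.exp (Real.log n * (1 - β)) := by
        rw [one_mul]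
        refine Real.exp_le_exp.2 ?_
        nlinarith

/-- A margin `c` above `log n` in `ζ / 2` keeps the series convergent; half of it is spent on `η`.
The ratio times `n ^ α` is then at most `exp (c/2) * n ^ (1 - β)`. -/
lemma likelihoodRate_linear (β : ℝ) {c : ℝ} (hc : 0 < c) : ∃ C > 0, ∀ (n N : ℕ) (ζ γ : ℝ)
    (E : ℝ≥0∞), 2 ≤ n → n < N → excessExponent n N ≤ γ →
    Real.log n + c ≤ ζ / 2 → 2 * (γ + β) * Real.log n ≤ ζ →
    LikelihoodRate E n N (1 / 2) (Real.exp (-ζ / 4)) →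
    E ≤ ENNReal.ofReal (C * (n : ℝ) ^ (1 - β)) := by
  have hx₀ : Real.exp (-(c / 2)) < 1 := by rw [Real.exp_lt_one_iff]; linarith
  have hx1 : 0 < 1 - Real.exp (-(c / 2)) := by linarith
  refine ⟨1 / (c / 2) + (1 + 2 * Real.exp (c / 2)) / (c / 2 * (1 - Real.exp (-(c / 2)))),
    by positivity, ?_⟩
  intro n N ζ γ E hn hN hγ hζ₁ hζ₂ hE
  have hL := log_natCast_pos hn
  refine hE.half hn (by linarith) hx₀ (Real.exp_le_exp.2 (by linarith)) ?_
  rw [sub_eq_exp_excessExponent hn hN, rpow_eq_exp_log hn, ← Real.exp_add, ← Real.exp_add]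
  refine Real.exp_le_exp.2 ?_
  nlinarith

/-- The choice of the exponent `p` for a truncation at the level `s ^ 2`. -/
lemma exponent_identities {L ζ z s : ℝ} (hL : 0 < L) (hζ : ζ = z ^ 2 * L) (hs : 0 < s)
    (hsz : 2 * s ≤ z) :
    1 / 2 ≤ 1 - s / z ∧ 1 - s / z < 1 ∧ (1 - (1 - s / z)) ^ 2 * ζ = s ^ 2 * L ∧
      (1 - s / z) ^ 2 * ζ = (z - s) ^ 2 * L := by
  have hz : 0 < z := by linarith
  refine ⟨?_, ?_, ?_, ?_⟩
  · have : s / z ≤ 1 / 2 := by rw [div_le_iff₀ hz]; linarith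
    linarith
  · have : 0 < s / z := by positivity
    linarith
  · rw [hζ]; field_simp; ring
  · rw [hζ]; field_simp

lemma eq_sq_sqrt_div_mul {L ζ : ℝ} (hL : 0 < L) (hζ : 0 ≤ ζ) : ζ = √(ζ / L) ^ 2 * L := by
  rw [Real.sq_sqrt (by positivity)]
  field_simp

lemma le_sqrt_div {L ζ y : ℝ} (hL : 0 < L) (h : y ^ 2 * L ≤ ζ) : y ≤ √(ζ / L) :=
  Real.le_sqrt_of_sq_le (by rwa [le_div_iff₀ hL])

/-- The parameter `γ` treats two boundaries at once: `γ = α` is the parabolic one and `γ = 1 - β`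
the elliptic one. On the ellipse `γ + β = 1`, so the ratio has no room for `exp η`; lowering the
truncation parameter from `√β` to `√β - ε` creates it. `D` is the error in the exponent of `ρ`. -/
lemma likelihoodRate_parabolic_aux {E : ℝ≥0∞} {ζ β γ ε D : ℝ} (hn : 2 ≤ n) (hN : n < N)
    (hL1 : 1 ≤ Real.log n) (hβ : 0 < β) (hβγ : β ≤ γ) (h1 : 1 ≤ β + γ)
    (hα : excessExponent n N ≤ γ) (hζ : (√γ + √β) ^ 2 * Real.log n ≤ ζ)
    (hζ' : ζ ≤ 2 * (γ + β) * Real.log n + 2) (hε0 : 0 ≤ ε) (hεβ : ε ≤ √β / 2)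
    (hε1 : 4 / √β ≤ 2 * ε * Real.log n)
    (hε2 : 8 + 4 / √β + 1 + 2 * D ≤ 2 * ε ^ 2 * Real.log n) (hD : 0 ≤ D)
    (hE : ∀ p : ℝ, 1 / 2 ≤ p → p < 1 →
      LikelihoodRate E n N p (Real.exp (-(p * (1 - p) * ζ) + D))) :
    E ≤ ENNReal.ofReal (7 * Real.exp (Real.log n * (1 - β + 2 * √β * ε) + D)) := by
  set L := Real.log n with hLdef
  have hL : 0 < L := by linarith
  have hsb : 0 < √β := Real.sqrt_pos.2 hβ
  have hbg : √β ≤ √γ := Real.sqrt_le_sqrt hβγ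
  have hb2 : √β ^ 2 = β := Real.sq_sqrt hβ.le
  have hg2 : √γ ^ 2 = γ := Real.sq_sqrt (by linarith)
  have hζ0 : 0 ≤ ζ := le_trans (by positivity) hζ
  set z := √(ζ / L) with hz
  have hζz : ζ = z ^ 2 * L := eq_sq_sqrt_div_mul hL hζ0
  have hzlow : √γ + √β ≤ z := le_sqrt_div hL hζ
  have hzup : z ≤ 2 * √γ + 2 * √β + 2 := by
    have : z ^ 2 ≤ 2 * (γ + β) + 2 := by
      have h3 : z ^ 2 * L ≤ (2 * (γ + β) + 2) * L := by rw [← hζz]; linarith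
      exact le_of_mul_le_mul_right h3 hL
    refine le_of_sq_le_sq (this.trans ?_) (by positivity)
    nlinarith [mul_nonneg (Real.sqrt_nonneg γ) (Real.sqrt_nonneg β)]
  set s := √β - ε with hs
  have hs0 : √β / 2 ≤ s := by linarith
  have hspos : 0 < s := by linarith
  have hsz : 2 * s ≤ z := by linarith
  obtain ⟨hp, hp1, hid1, hid2⟩ := exponent_identities hL hζz hspos hsz
  set p := 1 - s / z with hpdef
  have hzpos : 0 < z := by linarith
  have hp0 : 0 < 1 - p := by linarith
  -- This makes the coefficient of the low-score sum equal to one, uniformly in `p`; the growth of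
  -- `η` is absorbed in the ratio instead.
  set η := p / (1 - p) with hη
  have hη1 : 1 ≤ η := by rw [hη, le_div_iff₀ hp0]; linarith
  -- `η` is unbounded when `γ` is, so its bound is split to match the slack `2 ε (√γ - √β) L + 2 ε²
  -- L` found next: the first summand absorbs the part growing with `√γ`, the second absorbs the
  -- constant and `D`.
  have hηup : η ≤ 4 / √β * (√γ - √β) + (8 + 4 / √β) := by
    have e1 : η ≤ z / s := by
      rw [hη, hpdef, sub_sub_cancel, div_le_div_iff₀ (by positivity) hspos]
      field_simp
      nlinarith
    have e2 : z / s ≤ (2 * √γ + 2 * √β + 2) / (√β / 2) :=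
      div_le_div₀ (by positivity) hzup (by positivity) hs0
    refine e1.trans (e2.trans (le_of_eq ?_))
    field_simp
    ring
  have hkey : (γ + β + 2 * ε * (√γ - √β) + 2 * ε ^ 2) * L ≤ (p ^ 2 + (1 - p) ^ 2) * ζ := by
    rw [add_mul (p ^ 2), hid1, hid2, ← add_mul]
    refine mul_le_mul_of_nonneg_right ?_ hL.le
    have e1 : (√γ + ε) ^ 2 ≤ (z - s) ^ 2 := by
      refine pow_le_pow_left₀ (by positivity) ?_ 2
      linarith
    have e2 : (√γ + ε) ^ 2 + s ^ 2 = γ + β + 2 * ε * (√γ - √β) + 2 * ε ^ 2 := by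
      rw [hs]
      linear_combination hg2 + hb2
    linarith
  have hexp : η + L - (p ^ 2 + (1 - p) ^ 2) * ζ + 2 * D ≤ (1 - γ - β) * L - 1 := by
    have e1 : 4 / √β * (√γ - √β) ≤ 2 * ε * L * (√γ - √β) :=
      mul_le_mul_of_nonneg_right hε1 (by linarith)
    linarith
  set ρ := Real.exp (-(p * (1 - p) * ζ) + D) with hρ
  have hx : Real.exp η * Real.exp ((1 - 2 * p) * ((2 * p - 1) * ζ)) * n * ρ ^ 2 =
      Real.exp (η + L - (p ^ 2 + (1 - p) ^ 2) * ζ + 2 * D) := by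
    rw [hρ, ← Real.exp_nat_mul]
    nth_rewrite 1 [natCast_eq_exp_log hn]
    rw [← Real.exp_add, ← Real.exp_add, ← Real.exp_add]
    congr 1
    push_cast
    ring
  have hEb : (n : ℝ) * (Real.exp ((1 - p) * ((2 * p - 1) * ζ)) * ρ) =
      Real.exp (L - s ^ 2 * L + D) := by
    rw [hρ, ← Real.exp_add, ← hid1]
    nth_rewrite 1 [natCast_eq_exp_log hn]
    rw [← Real.exp_add]
    congr 1
    ring
  have hxx : Real.exp (η + L - (p ^ 2 + (1 - p) ^ 2) * ζ + 2 * D) ≤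
      Real.exp ((1 - γ - β) * L) * (1 / 2) := by
    refine (Real.exp_le_exp.2 hexp).trans ?_
    rw [Real.exp_sub, div_eq_mul_one_div]
    refine mul_le_mul_of_nonneg_left ?_ (Real.exp_pos _).le
    have := Real.add_one_le_exp (1 : ℝ)
    exact one_div_le_one_div_of_le (by norm_num) (by linarith)
  have hle1 : Real.exp ((1 - γ - β) * L) ≤ 1 := by
    rw [Real.exp_le_one_iff]
    exact mul_nonpos_of_nonpos_of_nonneg (by linarith) hL.le
  -- At the level `(2p - 1) ζ` the low-score exponent becomes `-(1 - p)² ζ` and that of the ratio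
  -- `-(p² + (1 - p)²) ζ`, apart from the terms in `η`, `log n` and `D`.
  have := hE p hp hp1 ((2 * p - 1) * ζ) η (1 / 2) (by linarith) (by norm_num)
    (by rw [hx]; linarith)
  rw [hx, hEb] at this
  refine this.trans (ENNReal.ofReal_le_ofReal ?_)
  have hc1 : p / (η * (1 - p)) = 1 := by
    rw [hη]; field_simp
  have hc2 : 1 / (η * (1 - 1 / 2)) ≤ 2 := by
    rw [div_le_iff₀ (by linarith)]; linarith
  have hc3 : 2 / (η * (1 - 1 / 2)) ≤ 4 := by
    rw [div_le_iff₀ (by linarith)]; linarith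
  rw [hc1, sub_eq_exp_excessExponent hn hN]
  set G := Real.exp (L * (1 - β + 2 * √β * ε) + D) with hG
  have hb1 : Real.exp (L - s ^ 2 * L + D) ≤ G := by
    refine Real.exp_le_exp.2 ?_
    have e1 : s ^ 2 = β - 2 * √β * ε + ε ^ 2 := by rw [hs]; linear_combination hb2
    have e2 : 0 ≤ ε ^ 2 * L := by positivity
    rw [e1]
    linarith
  have hb2' : Real.exp ((1 - γ - β) * L) * Real.exp (excessExponent n N * L) ≤ G := by
    rw [← Real.exp_add]
    refine Real.exp_le_exp.2 ?_
    have e1 : excessExponent n N * L ≤ γ * L := mul_le_mul_of_nonneg_right hα hL.le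
    have e2 : 0 ≤ L * (2 * √β * ε) := by positivity
    linarith
  have t1 : (1 + 1 / (η * (1 - 1 / 2))) * Real.exp (L - s ^ 2 * L + D) ≤ 3 * G :=
    mul_le_mul (by linarith) hb1 (Real.exp_pos _).le (by norm_num)
  have t2 : 2 / (η * (1 - 1 / 2)) * Real.exp (η + L - (p ^ 2 + (1 - p) ^ 2) * ζ + 2 * D) *
      Real.exp (excessExponent n N * L) ≤ 4 * (1 / 2) * G := by
    calc _ ≤ 4 * (Real.exp ((1 - γ - β) * L) * (1 / 2)) * Real.exp (excessExponent n N * L) := by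
          gcongr
      _ = 4 * (1 / 2) * (Real.exp ((1 - γ - β) * L) * Real.exp (excessExponent n N * L)) := by ring
      _ ≤ _ := mul_le_mul_of_nonneg_left hb2' (by norm_num)
  have : 0 < G := Real.exp_pos _
  linarith

/-- Maximum likelihood below the elliptic and the parabolic boundary. -/
lemma likelihoodRate_parabolic {β : ℝ} (hβ : 0 < β) {ω : ℕ → ℝ} (hω0 : ∀ n, 0 ≤ ω n)
    (hω : Tendsto ω atTop (𝓝 0)) : ∃ C > 0, ∃ ω' : ℕ → ℝ, Tendsto ω' atTop (𝓝 0) ∧ ∃ n₀ : ℕ,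
    ∀ (n N : ℕ) (ζ γ : ℝ) (E : ℝ≥0∞), 2 ≤ n → n₀ ≤ n → n < N → β ≤ γ → 1 ≤ β + γ →
    excessExponent n N ≤ γ → (√γ + √β) ^ 2 * Real.log n ≤ ζ →
    LikelihoodRate E n N (1 / 2) (Real.exp (-ζ / 4)) →
    (ζ ≤ 2 * (γ + β) * Real.log n + 2 → ∀ p : ℝ, 1 / 2 ≤ p → p < 1 →
      LikelihoodRate E n N p (Real.exp (-(p * (1 - p) * ζ) + ω n * Real.log n))) →
    E ≤ ENNReal.ofReal (C * (n : ℝ) ^ (1 - β + ω' n)) := by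
  obtain ⟨C₁, hC₁, hlin⟩ := likelihoodRate_linear β (c := 1) one_pos
  let q : ℕ → ℝ := fun n ↦ √(Real.log n)
  -- Large enough that `ε² log n` exceeds `2 ω log n` plus a diverging term, yet vanishing, so that
  -- the loss `2 √β ε` in the exponent is `o(1)`.
  let ε : ℕ → ℝ := fun n ↦ √(2 * ω n) + 1 / √(q n)
  have hq : Tendsto q atTop atTop :=
    Real.tendsto_sqrt_atTop.comp (Real.tendsto_log_atTop.comp tendsto_natCast_atTop_atTop)
  have hε : Tendsto ε atTop (𝓝 0) := by
    have h1 : Tendsto (fun n ↦ √(2 * ω n)) atTop (𝓝 0) := by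
      have : Tendsto (fun n ↦ 2 * ω n) atTop (𝓝 0) := by simpa using hω.const_mul 2
      have h0 := (Real.continuous_sqrt.tendsto 0).comp this
      rwa [Real.sqrt_zero] at h0
    have h2 : Tendsto (fun n ↦ 1 / √(q n)) atTop (𝓝 0) :=
      tendsto_const_nhds.div_atTop (Real.tendsto_sqrt_atTop.comp hq)
    have h3 := h1.add h2
    rwa [add_zero] at h3
  have hsb : 0 < √β := Real.sqrt_pos.2 hβ
  have hev : ∀ᶠ n in atTop, 1 ≤ q n ∧ 4 / √β ≤ 2 * q n ∧ 8 + 4 / √β + 1 ≤ 2 * q n ∧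
      ε n ≤ √β / 2 := by
    have h2q : Tendsto (fun n ↦ 2 * q n) atTop atTop := hq.const_mul_atTop two_pos
    filter_upwards [hq.eventually_ge_atTop 1, h2q.eventually_ge_atTop (4 / √β),
      h2q.eventually_ge_atTop (8 + 4 / √β + 1), hε.eventually_le_const (by positivity : 0 < √β / 2)]
      with n h1 h2 h3 h4 using ⟨h1, h2, h3, h4⟩
  obtain ⟨n₀, hn₀⟩ := eventually_atTop.1 hev
  refine ⟨7 + C₁, by linarith, fun n ↦ 2 * √β * ε n + ω n, ?_, n₀, ?_⟩
  · simpa using (hε.const_mul (2 * √β)).add hω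
  intro n N ζ γ E hn hnn hN hβγ h1 hα hζ hhalf hE
  obtain ⟨hq1, hq2, hq3, hq4⟩ := hn₀ n hnn
  have hL := log_natCast_pos hn
  have hqL : q n ^ 2 = Real.log n := Real.sq_sqrt hL.le
  have hL1 : 1 ≤ Real.log n := by rw [← hqL]; nlinarith
  have hε0 : 0 ≤ ε n := by positivity
  have hrpow : (0 : ℝ) < (n : ℝ) ^ (1 - β + (2 * √β * ε n + ω n)) :=
    Real.rpow_pos_of_pos (by positivity) _
  -- Stronger signals are covered by the linear bound with `c = 1`. This keeps `ζ` of order `(γ + β)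
  -- log n`, as needed for bounding `η` and the correlation loss.
  rcases le_total ζ (2 * (γ + β) * Real.log n + 2) with hζ' | hζ'
  · have hr : (√(q n)) ^ 2 = q n := Real.sq_sqrt (by linarith)
    have hr1 : 1 ≤ √(q n) := Real.one_le_sqrt.2 hq1
    have hsw : √(2 * ω n) ^ 2 = 2 * ω n := Real.sq_sqrt (by linarith [hω0 n])
    have hinv : (1 / √(q n)) ^ 2 * Real.log n = q n := by
      rw [div_pow, hr, ← hqL]; field_simp
    have hinv' : q n ≤ 1 / √(q n) * Real.log n := by
      rw [← hqL, one_div, ← div_eq_inv_mul, le_div_iff₀ (by positivity)]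
      have : √(q n) ≤ q n := by nlinarith
      nlinarith
    have := likelihoodRate_parabolic_aux hn hN hL1 hβ hβγ h1 hα hζ hζ' hε0 hq4 (by
        have : 1 / √(q n) * Real.log n ≤ ε n * Real.log n :=
          mul_le_mul_of_nonneg_right (le_add_of_nonneg_left (Real.sqrt_nonneg _)) hL.le
        linarith) (D := ω n * Real.log n) (by
        have e : 2 * ω n + (1 / √(q n)) ^ 2 ≤ ε n ^ 2 := by
          have h0 : 0 ≤ √(2 * ω n) * (1 / √(q n)) := by positivity
          have : ε n ^ 2 = √(2 * ω n) ^ 2 + (1 / √(q n)) ^ 2 +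
              2 * (√(2 * ω n) * (1 / √(q n))) := by simp only [ε]; ring
          rw [this, hsw]; linarith
        have e2 := mul_le_mul_of_nonneg_right e hL.le
        rw [add_mul, hinv] at e2
        have : 0 ≤ ω n * Real.log n := mul_nonneg (hω0 n) hL.le
        linarith) (mul_nonneg (hω0 n) hL.le) (hE hζ')
    refine this.trans (ENNReal.ofReal_le_ofReal ?_)
    have e : Real.exp (Real.log n * (1 - β + 2 * √β * ε n) + ω n * Real.log n) =
        (n : ℝ) ^ (1 - β + (2 * √β * ε n + ω n)) := by
      rw [rpow_eq_exp_log hn]; congr 1; ring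
    rw [e]
    exact mul_le_mul_of_nonneg_right (by linarith) hrpow.le
  · have h2 : 0 ≤ (γ + β - 1) * Real.log n := mul_nonneg (by linarith) hL.le
    refine (hlin n N ζ γ E hn hN hα (by linarith) (by linarith) hhalf).trans
      (ENNReal.ofReal_le_ofReal ?_)
    refine mul_le_mul (by linarith) ?_ (by positivity) (by linarith)
    refine Real.rpow_le_rpow_of_exponent_le (by exact_mod_cast (by omega : 1 ≤ n)) ?_
    have : 0 ≤ 2 * √β * ε n := by positivity
    linarith [hω0 n]

/-- Maximum row estimation below the linear boundary. -/
lemma rowRate_linear {β ζ : ℝ} {E : ℝ≥0∞} (hn : 2 ≤ n) (hN : n < N)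
    (hζ : 2 * (max (excessExponent n N) 1 + β) * Real.log n ≤ ζ)
    (h : RowRate E n N (1 / 2) (Real.exp (-ζ / 4))) :
    E ≤ ENNReal.ofReal (3 * (n : ℝ) ^ (1 - β)) := by
  refine (h (2 * (-β * Real.log n + ζ / 4))).trans (ENNReal.ofReal_le_ofReal ?_)
  have hEb : (n : ℝ) * (Real.exp ((1 - 1 / 2) * (2 * (-β * Real.log n + ζ / 4))) *
      Real.exp (-ζ / 4)) = (n : ℝ) ^ (1 - β) := by
    rw [rpow_eq_exp_log hn, ← Real.exp_add]
    nth_rewrite 1 [natCast_eq_exp_log hn]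
    rw [← Real.exp_add]
    congr 1
    ring
  rw [hEb]
  have e : Real.exp ((1 - 2 * (1 / 2)) * (2 * (-β * Real.log n + ζ / 4))) *
      Real.exp (-ζ / 4) ^ 2 = Real.exp (-ζ / 2) := by
    rw [← Real.exp_nat_mul, ← Real.exp_add]; congr 1; push_cast; ring
  rw [e]
  have h2 : (n : ℝ) * (N * Real.exp (-ζ / 2)) ≤ 2 * (n : ℝ) ^ (1 - β) := by
    calc (n : ℝ) * (N * Real.exp (-ζ / 2))
        ≤ n * (2 * Real.exp (max (excessExponent n N) 1 * Real.log n) * Real.exp (-ζ / 2)) := by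
          gcongr; exact natCast_le_two_mul_exp hn hN
      _ = 2 * Real.exp (Real.log n + max (excessExponent n N) 1 * Real.log n - ζ / 2) := by
          nth_rewrite 1 [natCast_eq_exp_log hn]
          rw [Real.exp_sub, Real.exp_add, neg_div, Real.exp_neg]
          field_simp
      _ ≤ _ := by
          rw [rpow_eq_exp_log hn]
          refine mul_le_mul_of_nonneg_left (Real.exp_le_exp.2 ?_) zero_le_two
          linarith
  linarith

/-- Maximum row estimation below the parabolic boundary. -/
lemma rowRate_parabolic {β ζ ω : ℝ} {E : ℝ≥0∞} (hβ : 0 < β) (hω : 0 ≤ ω) (hn : 2 ≤ n) (hN : n < N)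
    (hβa : β ≤ max (excessExponent n N) 1)
    (hζ : (√(max (excessExponent n N) 1) + √β) ^ 2 * Real.log n ≤ ζ)
    (hhalf : RowRate E n N (1 / 2) (Real.exp (-ζ / 4)))
    (h : ζ ≤ 2 * (max (excessExponent n N) 1 + β) * Real.log n → ∀ p : ℝ, 1 / 2 ≤ p → p < 1 →
      RowRate E n N p (Real.exp (-(p * (1 - p) * ζ) + ω * Real.log n))) :
    E ≤ ENNReal.ofReal (3 * (n : ℝ) ^ (1 - β + 2 * ω)) := by
  have hL := log_natCast_pos hn
  have hNle := natCast_le_two_mul_exp hn hN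
  set a := max (excessExponent n N) 1 with ha
  have hn1 : (1 : ℝ) ≤ n := by exact_mod_cast (by omega : 1 ≤ n)
  -- Beyond the linear boundary `p = 1/2` suffices, without any correlation condition.
  rcases le_total ζ (2 * (a + β) * Real.log n) with hζ' | hζ'
  swap
  · refine (rowRate_linear hn hN hζ' hhalf).trans (ENNReal.ofReal_le_ofReal ?_)
    refine mul_le_mul_of_nonneg_left (Real.rpow_le_rpow_of_exponent_le hn1 (by linarith))
      (by norm_num)
  set L := Real.log n
  have hsb : 0 < √β := Real.sqrt_pos.2 hβ
  have hba : √β ≤ √a := Real.sqrt_le_sqrt hβa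
  have hζ0 : 0 ≤ ζ := le_trans (by positivity) hζ
  have hζz := eq_sq_sqrt_div_mul hL hζ0
  have hzlow : √a + √β ≤ √(ζ / L) := le_sqrt_div hL hζ
  set z := √(ζ / L)
  obtain ⟨hp, hp1, hid1, hid2⟩ := exponent_identities hL hζz hsb (by linarith)
  set p := 1 - √β / z
  -- Same tilt as for maximum likelihood, but with the exact parameter `√β`: there is no series to
  -- sum, hence no slack is needed.
  refine (h hζ' p hp hp1 ((2 * p - 1) * ζ)).trans (ENNReal.ofReal_le_ofReal ?_)
  rw [Real.sq_sqrt hβ.le] at hid1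
  have hsum : (a + β) * L ≤ (p ^ 2 + (1 - p) ^ 2) * ζ := by
    rw [add_mul (p ^ 2), hid1, hid2, ← add_mul]
    refine mul_le_mul_of_nonneg_right ?_ hL.le
    have : √a ^ 2 ≤ (z - √β) ^ 2 := pow_le_pow_left₀ (by positivity) (by linarith) 2
    rw [Real.sq_sqrt (by linarith)] at this
    linarith
  have hEb : (n : ℝ) * (Real.exp ((1 - p) * ((2 * p - 1) * ζ)) *
      Real.exp (-(p * (1 - p) * ζ) + ω * L)) ≤ (n : ℝ) ^ (1 - β + 2 * ω) := by
    rw [rpow_eq_exp_log hn, ← Real.exp_add]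
    nth_rewrite 1 [natCast_eq_exp_log hn]
    rw [← Real.exp_add]
    refine Real.exp_le_exp.2 ?_
    have : 0 ≤ ω * L := by positivity
    nlinarith
  have hsq : Real.exp ((1 - 2 * p) * ((2 * p - 1) * ζ)) *
      Real.exp (-(p * (1 - p) * ζ) + ω * L) ^ 2 =
      Real.exp (-((p ^ 2 + (1 - p) ^ 2) * ζ) + 2 * (ω * L)) := by
    rw [← Real.exp_nat_mul, ← Real.exp_add]; congr 1; push_cast; ring
  rw [hsq]
  have h2 : (n : ℝ) * (N * Real.exp (-((p ^ 2 + (1 - p) ^ 2) * ζ) + 2 * (ω * L))) ≤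
      2 * (n : ℝ) ^ (1 - β + 2 * ω) := by
    calc (n : ℝ) * (N * Real.exp (-((p ^ 2 + (1 - p) ^ 2) * ζ) + 2 * (ω * L)))
        ≤ n * (2 * Real.exp (a * L) *
          Real.exp (-((p ^ 2 + (1 - p) ^ 2) * ζ) + 2 * (ω * L))) := by gcongr
      _ = 2 * Real.exp (L + a * L + (-((p ^ 2 + (1 - p) ^ 2) * ζ) + 2 * (ω * L))) := by
          nth_rewrite 1 [natCast_eq_exp_log hn]
          rw [Real.exp_add (L + a * L), Real.exp_add L]
          ring
      _ ≤ _ := by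
          rw [rpow_eq_exp_log hn]
          refine mul_le_mul_of_nonneg_left (Real.exp_le_exp.2 ?_) zero_le_two
          linarith
  linarith

/-- The threshold for the information density. -/
def densityThreshold (β : ℝ) (n : ℕ) (ζ : ℝ) : ℝ := ζ - 2 * √(β * ζ * Real.log n)

/-- Threshold testing below the parabolic boundary. -/
lemma thresholdRate {β ζ : ℝ} {E : ℝ≥0∞} (hβ : 0 < β) (hn : 2 ≤ n) (hN : n < N)
    (hζ : (√(max (excessExponent n N) 1 + β) + √β) ^ 2 * Real.log n ≤ ζ)
    (h : ∀ p : ℝ, 0 ≤ p → p ≤ 1 → E ≤ ENNReal.ofReal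
      (n * (Real.exp ((1 - p) * densityThreshold β n ζ) * Real.exp (-(p * (1 - p) * ζ))) +
        n * (N * (Real.exp (-p * densityThreshold β n ζ) * Real.exp (-(p * (1 - p) * ζ)))))) :
    E ≤ ENNReal.ofReal (3 * (n : ℝ) ^ (1 - β)) := by
  have hL := log_natCast_pos hn
  have hNle := natCast_le_two_mul_exp hn hN
  have ha1 : 1 ≤ max (excessExponent n N) 1 := le_max_right _ _
  set a := max (excessExponent n N) 1 with ha
  set L := Real.log n with hLdef
  have hsb : 0 < √β := Real.sqrt_pos.2 hβ
  have hba : √β ≤ √(a + β) := Real.sqrt_le_sqrt (by linarith)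
  have hζ0 : 0 ≤ ζ := le_trans (by positivity) hζ
  have hζz := eq_sq_sqrt_div_mul hL hζ0
  have hzlow : √(a + β) + √β ≤ √(ζ / L) := le_sqrt_div hL hζ
  set z := √(ζ / L)
  obtain ⟨hp, hp1, hid1, hid2⟩ := exponent_identities hL hζz hsb (by linarith)
  have hz : 0 < z := by linarith
  -- The threshold is the level `(2p - 1) ζ` with `1 - p = √β / z`: false negatives cost `exp (-(1 -
  -- p)² ζ)`, exactly `n ^ (-β)`, and false positives cost `exp (-p² ζ)`.
  have hτ : densityThreshold β n ζ = (2 * (1 - √β / z) - 1) * ζ := by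
    have : √(β * ζ * L) = √β * (z * L) := by
      have : β * ζ * L = β * (z * L) ^ 2 := by rw [hζz]; ring
      rw [this, Real.sqrt_mul hβ.le, Real.sqrt_sq (by positivity)]
    rw [densityThreshold, ← hLdef, this]
    have e : √β / z * ζ = √β * (z * L) := by
      nth_rewrite 1 [hζz]; field_simp
    linear_combination 2 * e
  set p := 1 - √β / z
  refine (h p (by linarith) hp1.le).trans (ENNReal.ofReal_le_ofReal ?_)
  rw [Real.sq_sqrt hβ.le] at hid1
  have hsum : (a + β) * L ≤ p ^ 2 * ζ := by
    rw [hid2]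
    refine mul_le_mul_of_nonneg_right ?_ hL.le
    have : √(a + β) ^ 2 ≤ (z - √β) ^ 2 := pow_le_pow_left₀ (by positivity) (by linarith) 2
    rwa [Real.sq_sqrt (by linarith)] at this
  have e1 : (n : ℝ) * (Real.exp ((1 - p) * densityThreshold β n ζ) *
      Real.exp (-(p * (1 - p) * ζ))) = (n : ℝ) ^ (1 - β) := by
    rw [hτ, rpow_eq_exp_log hn, ← Real.exp_add]
    nth_rewrite 1 [natCast_eq_exp_log hn]
    rw [← Real.exp_add]
    congr 1
    linear_combination -hid1
  have e2 : Real.exp (-p * densityThreshold β n ζ) * Real.exp (-(p * (1 - p) * ζ)) =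
      Real.exp (-(p ^ 2 * ζ)) := by
    rw [hτ, ← Real.exp_add]; congr 1; ring
  rw [e1, e2]
  have h2 : (n : ℝ) * (N * Real.exp (-(p ^ 2 * ζ))) ≤ 2 * (n : ℝ) ^ (1 - β) := by
    calc (n : ℝ) * (N * Real.exp (-(p ^ 2 * ζ)))
        ≤ n * (2 * Real.exp (a * L) * Real.exp (-(p ^ 2 * ζ))) := by gcongr
      _ = 2 * Real.exp (L + a * L + (-(p ^ 2 * ζ))) := by
          nth_rewrite 1 [natCast_eq_exp_log hn]
          rw [Real.exp_add (L + a * L), Real.exp_add L]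
          ring
      _ ≤ _ := by
          rw [rpow_eq_exp_log hn]
          refine mul_le_mul_of_nonneg_left (Real.exp_le_exp.2 ?_) zero_le_two
          linarith
  linarith

end Rates

/-! ### Planted matching -/

section Planted

variable {U V : Type}

/-- The pairs on an alternating path. -/
def chainEdges (M : U → V) : List U → List (U × V)
  | [] => []
  | [u] => [(u, M u)]
  | u :: w :: l => (u, M u) :: (w, M u) :: chainEdges M (w :: l)

lemma fst_mem_of_mem_chainEdges (M : U → V) {l : List U} {e : U × V} (he : e ∈ chainEdges M l) :
    e.1 ∈ l := by
  induction l with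
  | nil => simp [chainEdges] at he
  | cons u l ih =>
    cases l with
    | nil => simp [chainEdges] at he; simp [he]
    | cons w l =>
      simp only [chainEdges, List.mem_cons] at he
      rcases he with rfl | rfl | he
      · simp
      · simp
      · exact List.mem_cons_of_mem _ (ih he)

lemma snd_mem_of_mem_chainEdges (M : U → V) {l : List U} {e : U × V} (he : e ∈ chainEdges M l) :
    ∃ x ∈ l, M x = e.2 := by
  induction l with
  | nil => simp [chainEdges] at he
  | cons u l ih =>
    cases l with
    | nil => simp [chainEdges] at he; exact ⟨u, by simp, by simp [he]⟩
    | cons w l =>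
      simp only [chainEdges, List.mem_cons] at he
      rcases he with rfl | rfl | he
      · exact ⟨u, by simp, rfl⟩
      · exact ⟨u, by simp, rfl⟩
      · obtain ⟨x, hx, h⟩ := ih he
        exact ⟨x, List.mem_cons_of_mem _ hx, h⟩

lemma nodup_chainEdges (M : U ↪ V) {l : List U} (hl : l.Nodup) : (chainEdges M l).Nodup := by
  induction l with
  | nil => simp [chainEdges]
  | cons u l ih =>
    cases l with
    | nil => simp [chainEdges]
    | cons w l =>
      have hu := (List.nodup_cons.1 hl).1
      have hnot : ∀ x, (x, M u) ∉ chainEdges M (w :: l) := fun x hx ↦ by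
        obtain ⟨y, hy, h⟩ := snd_mem_of_mem_chainEdges M hx
        exact hu (M.injective h ▸ hy)
      have huw : u ≠ w := fun h ↦ hu (by simp [h])
      simp only [chainEdges, List.nodup_cons, List.mem_cons, not_or]
      exact ⟨⟨by simp [huw], hnot u⟩, hnot w, ih (List.nodup_cons.1 hl).2⟩

lemma length_chainEdges (M : U → V) (u : U) (l : List U) :
    (chainEdges M (u :: l)).length = 2 * l.length + 1 := by
  induction l generalizing u with
  | nil => simp [chainEdges]
  | cons w l ih =>
    simp only [chainEdges, List.length_cons, ih]
    ring

open Classical in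
/-- The weight of a pair in the score of an alternating path. -/
def pairWeight (p : ℝ) (M : U → V) (e : U × V) : ℝ := if M e.1 = e.2 then p - 1 else p

lemma chainScore_eq_sum (p : ℝ) (M : U ↪ V) (s : U → V → ℝ) {l : List U} (hl : l.Nodup) :
    chainScore p M s l = ((chainEdges M l).map fun e ↦ pairWeight p M e * s e.1 e.2).sum := by
  induction l with
  | nil => simp [chainEdges, chainScore]
  | cons u l ih =>
    cases l with
    | nil => simp [chainEdges, chainScore, pairWeight]
    | cons w l =>
      have huw : w ≠ u := fun h ↦ (List.nodup_cons.1 hl).1 (by simp [h])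
      simp only [chainEdges, chainScore, List.map_cons, List.sum_cons,
        ih (List.nodup_cons.1 hl).2]
      simp [pairWeight, huw]
      ring

variable {Ω : Type} [MeasurableSpace Ω] {P : Measure Ω}

/-- Distinct entries are independent. The centred scores have mean `±ζ` and variance `2ζ`, with `ζ =
μ² / 2`, so weight `p - 1` on a true pair and weight `p` on a false one both have moment `exp (-p (1
- p) ζ)`. -/
lemma lintegral_exp_sum_pairs {M : U ↪ V} {μ : ℝ} {W : U → V → Ω → ℝ}
    (hW : IsPlantedMatching P M μ W) (p : ℝ) (l : List (U × V)) (hl : l.Nodup) :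
    ∫⁻ ω, ENNReal.ofReal (Real.exp ((l.map fun e ↦ pairWeight p M e *
        (μ * W e.1 e.2 ω - μ ^ 2 / 2)).sum)) ∂P =
      ENNReal.ofReal (Real.exp (-(p * (1 - p) * (μ ^ 2 / 2))) ^ l.length) := by
  classical
  have : IsProbabilityMeasure P := hW.indep.isProbabilityMeasure
  let X : U × V → Ω → ℝ := fun e ω ↦ pairWeight p M e * (μ * W e.1 e.2 ω - μ ^ 2 / 2)
  have hX : iIndepFun X P := hW.indep.comp (fun e x ↦ pairWeight p M e * (μ * x - μ ^ 2 / 2))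
    (fun e ↦ by fun_prop)
  have hlaw : ∀ e, HasLaw (X e) _ P := fun e ↦
    gaussianReal_const_mul (gaussianReal_sub_const (gaussianReal_const_mul (hW.law e.1 e.2) μ)
      (μ ^ 2 / 2)) (pairWeight p M e)
  have hmgf : ∀ e, mgf (X e) P 1 = Real.exp (-(p * (1 - p) * (μ ^ 2 / 2))) := fun e ↦ by
    rw [mgf_gaussianReal (hlaw e).map_eq]
    congr 1
    unfold pairWeight
    split_ifs
    · push_cast
      ring
    · push_cast
      ring
  have hsum := hX.mgf_sum₀ (t := 1) (fun e ↦ (hlaw e).aemeasurable) l.toFinset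
  rw [Finset.prod_congr rfl (fun e _ ↦ hmgf e), Finset.prod_const,
    List.toFinset_card_of_nodup hl] at hsum
  -- A positive moment generating function certifies integrability, as the integral of a
  -- non-integrable function is zero by default.
  have hpos : 0 < mgf (∑ e ∈ l.toFinset, X e) P 1 := by rw [hsum]; positivity
  have hInt : Integrable (fun ω ↦ Real.exp (1 * (∑ e ∈ l.toFinset, X e) ω)) P := mgf_pos_iff.1 hpos
  rw [← hsum, mgf, ofReal_integral_eq_lintegral_ofReal hInt (ae_of_all _ fun _ ↦ (Real.exp_pos _).le)]
  refine lintegral_congr fun ω ↦ ?_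
  rw [one_mul, Finset.sum_apply, List.sum_toFinset _ hl]

lemma aemeasurable_plantedScore {M : U ↪ V} {μ : ℝ} {W : U → V → Ω → ℝ}
    (hW : IsPlantedMatching P M μ W) (u : U) (v : V) :
    AEMeasurable (fun ω ↦ μ * W u v ω - μ ^ 2 / 2) P :=
  ((hW.law u v).aemeasurable.const_mul μ).sub_const _

/-- Only distinctness of edges is at stake: the exit edge ends at an unused `v`, and the closing
edge is new because the path has at least two users. -/
lemma chainBound_planted {M : U ↪ V} {μ : ℝ} {W : U → V → Ω → ℝ}
    (hW : IsPlantedMatching P M μ W) (p : ℝ) :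
    ChainBound P M (fun ω u v ↦ μ * W u v ω - μ ^ 2 / 2) p
      (Real.exp (-(p * (1 - p) * (μ ^ 2 / 2)))) where
  path u l hl := by
    simp_rw [chainScore_eq_sum p M _ hl]
    rw [lintegral_exp_sum_pairs hW p _ (nodup_chainEdges M hl), length_chainEdges]
  exit u l v hl hv := by
    have hmem : (u, v) ∉ chainEdges M (u :: l) := fun h ↦ by
      obtain ⟨x, hx, hxv⟩ := snd_mem_of_mem_chainEdges M h
      exact hv x hx hxv
    have := lintegral_exp_sum_pairs hW p ((u, v) :: chainEdges M (u :: l))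
      (List.nodup_cons.2 ⟨hmem, nodup_chainEdges M hl⟩)
    rw [List.length_cons, length_chainEdges] at this
    refine le_of_eq ?_
    rw [← this]
    refine lintegral_congr fun ω ↦ ?_
    rw [chainScore_eq_sum p M _ hl, List.map_cons, List.sum_cons, add_comm]
    simp [pairWeight, hv u (by simp)]
  cycle u l hl hne := by
    set z := (u :: l).getLast (List.cons_ne_nil u l) with hz
    have hzl : z ∈ l := by
      rw [hz, List.getLast_cons hne]
      exact List.getLast_mem hne
    have huz : u ≠ z := fun h ↦ (List.nodup_cons.1 hl).1 (h ▸ hzl)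
    have hmem : (u, M z) ∉ chainEdges M (u :: l) := fun h ↦ by
      cases l with
      | nil => exact hne rfl
      | cons w l =>
        have hu := (List.nodup_cons.1 hl).1
        simp only [chainEdges, List.mem_cons, Prod.mk.injEq] at h
        rcases h with h | h | h
        · exact huz (M.injective h.2).symm
        · exact hu (by simp [h.1])
        · exact hu (fst_mem_of_mem_chainEdges M h)
    have := lintegral_exp_sum_pairs hW p ((u, M z) :: chainEdges M (u :: l))
      (List.nodup_cons.2 ⟨hmem, nodup_chainEdges M hl⟩)
    rw [List.length_cons, length_chainEdges] at this
    refine le_of_eq ?_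
    rw [← this]
    refine lintegral_congr fun ω ↦ ?_
    rw [chainScore_eq_sum p M _ hl, List.map_cons, List.sum_cons, add_comm]
    simp [pairWeight, huz]

end Planted

/-! ### Iterated integral operators with a positive kernel -/

section Kernels

variable {X Y : Type} [MeasurableSpace X] [MeasurableSpace Y]

/-- The Cauchy–Schwarz inequality. -/
lemma sq_lintegral_mul_le (μ : Measure X) {f g : X → ℝ≥0∞} (hf : Measurable f) (hg : Measurable g) :
    (∫⁻ x, f x * g x ∂μ) ^ 2 ≤ (∫⁻ x, f x ^ 2 ∂μ) * ∫⁻ x, g x ^ 2 ∂μ := by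
  have h := ENNReal.lintegral_mul_le_Lp_mul_Lq μ Real.HolderConjugate.two_two hf.aemeasurable
    hg.aemeasurable
  have e : ∀ a : ℝ≥0∞, (a ^ (1 / 2 : ℝ)) ^ 2 = a := fun a ↦ by
    rw [← ENNReal.rpow_natCast, ← ENNReal.rpow_mul]; simp
  have h2 := pow_le_pow_left' h 2
  rw [mul_pow, e, e] at h2
  simpa using h2

/-- The integral operator with kernel `k`. -/
def kernelOp (k : X → Y → ℝ≥0∞) (ν : Measure Y) (φ : Y → ℝ≥0∞) (x : X) : ℝ≥0∞ :=
  ∫⁻ y, k x y * φ y ∂ν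

/-- The kernel of the composition of the integral operator with its transpose. -/
def gramKernel (k : X → Y → ℝ≥0∞) (ν : Measure Y) (x x' : X) : ℝ≥0∞ := ∫⁻ y, k x y * k x' y ∂ν

variable {k : X → Y → ℝ≥0∞} {νX : Measure X} {νY : Measure Y} [SFinite νX] [SFinite νY]

lemma measurable_kernelOp (hk : Measurable (Function.uncurry k)) {φ : Y → ℝ≥0∞}
    (hφ : Measurable φ) : Measurable (kernelOp k νY φ) :=
  Measurable.lintegral_prod_right' (f := fun z : X × Y ↦ k z.1 z.2 * φ z.2)
    (hk.mul (hφ.comp measurable_snd))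

lemma measurable_gramKernel (hk : Measurable (Function.uncurry k)) :
    Measurable (Function.uncurry (gramKernel k νY)) :=
  Measurable.lintegral_prod_right' (f := fun z : (X × X) × Y ↦ k z.1.1 z.2 * k z.1.2 z.2)
    ((hk.comp (by fun_prop : Measurable fun z : (X × X) × Y ↦ (z.1.1, z.2))).mul
      (hk.comp (by fun_prop : Measurable fun z : (X × X) × Y ↦ (z.1.2, z.2))))

/-- The operator and its transpose, composed. -/
def transferOp (k : X → Y → ℝ≥0∞) (νX : Measure X) (νY : Measure Y) (φ : Y → ℝ≥0∞) : Y → ℝ≥0∞ :=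
  kernelOp (fun y x ↦ k x y) νX (kernelOp k νY φ)

lemma measurable_swap_kernel (hk : Measurable (Function.uncurry k)) :
    Measurable (Function.uncurry fun y x ↦ k x y) := hk.comp measurable_swap

lemma measurable_transferOp (hk : Measurable (Function.uncurry k)) {φ : Y → ℝ≥0∞}
    (hφ : Measurable φ) : Measurable (transferOp k νX νY φ) :=
  measurable_kernelOp (measurable_swap_kernel hk) (measurable_kernelOp hk hφ)

lemma measurable_transferOp_iterate (hk : Measurable (Function.uncurry k)) {φ : Y → ℝ≥0∞}
    (hφ : Measurable φ) (j : ℕ) : Measurable ((transferOp k νX νY)^[j] φ) := by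
  induction j with
  | zero => exact hφ
  | succ j ih =>
    rw [Function.iterate_succ_apply']
    exact measurable_transferOp hk ih

/-- This is `K (Kᵀ K) = (K Kᵀ) K`, by Tonelli. It moves the iteration to the Gram kernel, on which
Cauchy–Schwarz acts. -/
lemma kernelOp_transferOp (hk : Measurable (Function.uncurry k)) {φ : Y → ℝ≥0∞}
    (hφ : Measurable φ) : kernelOp k νY (transferOp k νX νY φ) =
      kernelOp (gramKernel k νY) νX (kernelOp k νY φ) := by
  ext x
  have hψ := measurable_kernelOp (νY := νY) hk hφ
  set ψ := kernelOp k νY φ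
  simp only [transferOp, kernelOp, gramKernel]
  have h1 : ∀ y, k x y * ∫⁻ x', k x' y * ψ x' ∂νX = ∫⁻ x', k x y * (k x' y * ψ x') ∂νX :=
    fun y ↦ (lintegral_const_mul _ ((hk.comp measurable_prodMk_right).mul hψ)).symm
  have h2 : ∀ x', (∫⁻ y, k x y * k x' y ∂νY) * ψ x' = ∫⁻ y, k x y * (k x' y * ψ x') ∂νY :=
    fun x' ↦ by
      have m : ∀ x, Measurable fun y ↦ k x y := fun x ↦ hk.comp measurable_prodMk_left
      have mm : Measurable fun y ↦ k x y * k x' y := (m x).mul (m x')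
      rw [← lintegral_mul_const _ mm]
      exact lintegral_congr fun y ↦ by ring
  change ∫⁻ y, k x y * ∫⁻ x', k x' y * ψ x' ∂νX ∂νY =
    ∫⁻ x', (∫⁻ y, k x y * k x' y ∂νY) * ψ x' ∂νX
  simp_rw [h1, h2]
  refine lintegral_lintegral_swap (Measurable.aemeasurable ?_)
  have m1 : Measurable fun z : Y × X ↦ k x z.1 :=
    hk.comp (measurable_const.prodMk measurable_fst)
  have m2 : Measurable fun z : Y × X ↦ k z.2 z.1 := hk.comp measurable_swap
  exact m1.mul (m2.mul (hψ.comp measurable_snd))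

lemma kernelOp_transferOp_iterate (hk : Measurable (Function.uncurry k)) {φ : Y → ℝ≥0∞}
    (hφ : Measurable φ) (j : ℕ) : kernelOp k νY ((transferOp k νX νY)^[j] φ) =
      (kernelOp (gramKernel k νY) νX)^[j] (kernelOp k νY φ) := by
  induction j with
  | zero => rfl
  | succ j ih =>
    rw [Function.iterate_succ_apply', Function.iterate_succ_apply',
      kernelOp_transferOp hk (measurable_transferOp_iterate hk hφ j), ih]

/-- The weight of a four-cycle. -/
def cycleWeight (k : X → Y → ℝ≥0∞) (νX : Measure X) (νY : Measure Y) : ℝ≥0∞ :=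
  ∫⁻ x, ∫⁻ x', gramKernel k νY x x' ^ 2 ∂νX ∂νX

/-- The operator norm is at most the Hilbert–Schmidt norm; `cycleWeight` is the square of the latter
for `K Kᵀ`. -/
lemma lintegral_sq_kernelOp_gramKernel_le (hk : Measurable (Function.uncurry k)) {ψ : X → ℝ≥0∞}
    (hψ : Measurable ψ) : ∫⁻ x, kernelOp (gramKernel k νY) νX ψ x ^ 2 ∂νX ≤
      cycleWeight k νX νY * ∫⁻ x, ψ x ^ 2 ∂νX := by
  have hg := measurable_gramKernel (νY := νY) hk
  rw [cycleWeight, ← lintegral_mul_const _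
    (Measurable.lintegral_prod_right' (f := fun z : X × X ↦ gramKernel k νY z.1 z.2 ^ 2)
      (hg.pow_const 2))]
  exact lintegral_mono fun x ↦ sq_lintegral_mul_le νX (hg.comp measurable_prodMk_left) hψ

lemma measurable_gram_iterate (hk : Measurable (Function.uncurry k)) {ψ : X → ℝ≥0∞}
    (hψ : Measurable ψ) (j : ℕ) : Measurable ((kernelOp (gramKernel k νY) νX)^[j] ψ) := by
  induction j with
  | zero => exact hψ
  | succ j ih =>
    rw [Function.iterate_succ_apply']
    exact measurable_kernelOp (measurable_gramKernel hk) ih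

lemma lintegral_sq_gram_iterate_le (hk : Measurable (Function.uncurry k)) {ψ : X → ℝ≥0∞}
    (hψ : Measurable ψ) (j : ℕ) : ∫⁻ x, (kernelOp (gramKernel k νY) νX)^[j] ψ x ^ 2 ∂νX ≤
      cycleWeight k νX νY ^ j * ∫⁻ x, ψ x ^ 2 ∂νX := by
  induction j with
  | zero => simp
  | succ j ih =>
    rw [Function.iterate_succ_apply', pow_succ', mul_assoc]
    exact (lintegral_sq_kernelOp_gramKernel_le hk (measurable_gram_iterate hk hψ j)).trans
      (mul_le_mul_right ih _)

lemma gramKernel_comm (x x' : X) : gramKernel k νY x x' = gramKernel k νY x' x := by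
  simp only [gramKernel, mul_comm]

variable [IsProbabilityMeasure νX] [IsProbabilityMeasure νY]

lemma sq_lintegral_le {f : X → ℝ≥0∞} (hf : Measurable f) :
    (∫⁻ x, f x ∂νX) ^ 2 ≤ ∫⁻ x, f x ^ 2 ∂νX := by
  simpa using sq_lintegral_mul_le νX hf measurable_one

lemma cycleWeight_eq (hk : Measurable (Function.uncurry k)) :
    cycleWeight k νX νY = ∫⁻ z : X × X, ∫⁻ w : Y × Y,
      (k z.1 w.1 * k z.2 w.1) * (k z.1 w.2 * k z.2 w.2) ∂(νY.prod νY) ∂(νX.prod νX) := by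
  have hg := measurable_gramKernel (νY := νY) hk
  have m : ∀ x, Measurable fun y ↦ k x y := fun x ↦ hk.comp measurable_prodMk_left
  rw [cycleWeight, lintegral_lintegral (f := fun x x' ↦ gramKernel k νY x x' ^ 2)
    (hg.pow_const 2).aemeasurable]
  refine lintegral_congr fun z ↦ ?_
  rw [lintegral_prod_mul (f := fun y ↦ k z.1 y * k z.2 y) (g := fun y ↦ k z.1 y * k z.2 y)
    ((m _).mul (m _)).aemeasurable ((m _).mul (m _)).aemeasurable, sq]
  rfl

/-- The left side is the integral of the kernel of `Kᵀ K` over a probability space, hence at most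
its Hilbert–Schmidt norm. The norms of `Kᵀ K` and `K Kᵀ` agree, as both square to the four-cycle
integral. -/
lemma lintegral_sq_kernelOp_one_le (hk : Measurable (Function.uncurry k)) {ρ : ℝ≥0∞}
    (hρ : cycleWeight k νX νY ≤ ρ ^ 4) :
    ∫⁻ x, kernelOp k νY 1 x ^ 2 ∂νX ≤ ρ ^ 2 := by
  have m1 : ∀ y, Measurable fun x ↦ k x y := fun y ↦ hk.comp measurable_prodMk_right
  have m2 : ∀ x, Measurable fun y ↦ k x y := fun x ↦ hk.comp measurable_prodMk_left
  have hgm : Measurable fun w : Y × Y ↦ gramKernel (fun y x ↦ k x y) νX w.1 w.2 :=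
    measurable_gramKernel (measurable_swap_kernel hk)
  have h1 : ∫⁻ x, kernelOp k νY 1 x ^ 2 ∂νX =
      ∫⁻ w : Y × Y, gramKernel (fun y x ↦ k x y) νX w.1 w.2 ∂(νY.prod νY) := by
    have e : ∀ x, kernelOp k νY 1 x ^ 2 = ∫⁻ w : Y × Y, k x w.1 * k x w.2 ∂(νY.prod νY) := fun x ↦ by
      rw [lintegral_prod_mul (f := fun y ↦ k x y) (g := fun y ↦ k x y) (m2 x).aemeasurable
        (m2 x).aemeasurable, sq]
      simp [kernelOp]
    simp_rw [e, gramKernel]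
    refine lintegral_lintegral_swap (Measurable.aemeasurable ?_)
    exact (hk.comp (by fun_prop : Measurable fun z : X × (Y × Y) ↦ (z.1, z.2.1))).mul
      (hk.comp (by fun_prop : Measurable fun z : X × (Y × Y) ↦ (z.1, z.2.2)))
  have h2 : ∫⁻ w : Y × Y, gramKernel (fun y x ↦ k x y) νX w.1 w.2 ^ 2 ∂(νY.prod νY) =
      cycleWeight k νX νY := by
    rw [cycleWeight_eq hk]
    have e : ∀ w : Y × Y, gramKernel (fun y x ↦ k x y) νX w.1 w.2 ^ 2 = ∫⁻ z : X × X,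
        (k z.1 w.1 * k z.2 w.1) * (k z.1 w.2 * k z.2 w.2) ∂(νX.prod νX) := fun w ↦ by
      have mm : Measurable fun x ↦ k x w.1 * k x w.2 := (m1 _).mul (m1 _)
      rw [sq, gramKernel, ← lintegral_prod_mul mm.aemeasurable mm.aemeasurable]
      exact lintegral_congr fun z ↦ by ring
    simp_rw [e]
    refine lintegral_lintegral_swap (Measurable.aemeasurable ?_)
    have a1 : Measurable fun z : (Y × Y) × (X × X) ↦ k z.2.1 z.1.1 :=
      hk.comp (by fun_prop : Measurable fun z : (Y × Y) × (X × X) ↦ (z.2.1, z.1.1))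
    have a2 : Measurable fun z : (Y × Y) × (X × X) ↦ k z.2.2 z.1.1 :=
      hk.comp (by fun_prop : Measurable fun z : (Y × Y) × (X × X) ↦ (z.2.2, z.1.1))
    have a3 : Measurable fun z : (Y × Y) × (X × X) ↦ k z.2.1 z.1.2 :=
      hk.comp (by fun_prop : Measurable fun z : (Y × Y) × (X × X) ↦ (z.2.1, z.1.2))
    have a4 : Measurable fun z : (Y × Y) × (X × X) ↦ k z.2.2 z.1.2 :=
      hk.comp (by fun_prop : Measurable fun z : (Y × Y) × (X × X) ↦ (z.2.2, z.1.2))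
    exact (a1.mul a2).mul (a3.mul a4)
  rw [h1, ← ENNReal.pow_le_pow_left_iff two_ne_zero]
  refine (sq_lintegral_le hgm).trans ?_
  rw [h2, ← pow_mul]
  exact hρ

/-- The path integral is the mean of `(K Kᵀ)^j K 1`; bound it by the `L²` norm, where each `K Kᵀ`
costs `ρ²` and `K 1` costs `ρ`. -/
lemma lintegral_path_le (hk : Measurable (Function.uncurry k)) {ρ : ℝ≥0∞}
    (hρ : cycleWeight k νX νY ≤ ρ ^ 4) (j : ℕ) :
    ∫⁻ x, kernelOp k νY ((transferOp k νX νY)^[j] 1) x ∂νX ≤ ρ ^ (2 * j + 1) := by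
  have hκ : Measurable (kernelOp k νY 1) := measurable_kernelOp hk measurable_one
  rw [kernelOp_transferOp_iterate hk measurable_one, ← ENNReal.pow_le_pow_left_iff two_ne_zero]
  refine (sq_lintegral_le (measurable_gram_iterate hk hκ j)).trans
    ((lintegral_sq_gram_iterate_le hk hκ j).trans ?_)
  calc cycleWeight k νX νY ^ j * ∫⁻ x, kernelOp k νY 1 x ^ 2 ∂νX
      ≤ (ρ ^ 4) ^ j * ρ ^ 2 :=
        mul_le_mul' (pow_le_pow_left' hρ j) (lintegral_sq_kernelOp_one_le hk hρ)
    _ = _ := by ring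

/-- The exit edge contributes a second `K 1`, so the integral is the inner product of `K 1` with `(K
Kᵀ)^j K 1`. -/
lemma lintegral_exit_le (hk : Measurable (Function.uncurry k)) {ρ : ℝ≥0∞}
    (hρ : cycleWeight k νX νY ≤ ρ ^ 4) (j : ℕ) :
    ∫⁻ x, kernelOp k νY 1 x * kernelOp k νY ((transferOp k νX νY)^[j] 1) x ∂νX ≤
      ρ ^ (2 * j + 2) := by
  have hκ : Measurable (kernelOp k νY 1) := measurable_kernelOp hk measurable_one
  rw [kernelOp_transferOp_iterate hk measurable_one, ← ENNReal.pow_le_pow_left_iff two_ne_zero]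
  have hκ2 := lintegral_sq_kernelOp_one_le hk hρ
  calc _ ≤ (∫⁻ x, kernelOp k νY 1 x ^ 2 ∂νX) *
        ∫⁻ x, (kernelOp (gramKernel k νY) νX)^[j] (kernelOp k νY 1) x ^ 2 ∂νX :=
        sq_lintegral_mul_le νX hκ (measurable_gram_iterate hk hκ j)
    _ ≤ ρ ^ 2 * ((ρ ^ 4) ^ j * ρ ^ 2) :=
        mul_le_mul' hκ2 ((lintegral_sq_gram_iterate_le hk hκ j).trans
          (mul_le_mul' (pow_le_pow_left' hρ j) hκ2))
    _ = _ := by ring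

/-- A cycle with at least four edges is the inner product of a row of the Gram kernel with `(K
Kᵀ)^j` applied to the same row. Integrating over the row gives the four-cycle weight back; this is
why the shift `j + 1` is essential. -/
lemma lintegral_cycle_le (hk : Measurable (Function.uncurry k)) {ρ : ℝ≥0∞}
    (hρ : cycleWeight k νX νY ≤ ρ ^ 4) (j : ℕ) :
    ∫⁻ x, kernelOp k νY ((transferOp k νX νY)^[j + 1] (k x)) x ∂νX ≤ ρ ^ (2 * (j + 1) + 2) := by
  have hg := measurable_gramKernel (νY := νY) hk
  have hgx : ∀ x, Measurable (gramKernel k νY x) := fun x ↦ hg.comp measurable_prodMk_left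
  have hkx : ∀ x, Measurable (k x) := fun x ↦ hk.comp measurable_prodMk_left
  have hop : ∀ x, kernelOp k νY (k x) = gramKernel k νY x := fun x ↦ by
    ext x'
    rw [gramKernel_comm]
    rfl
  have hpt : ∀ x, kernelOp k νY ((transferOp k νX νY)^[j + 1] (k x)) x ≤
      ρ ^ (2 * j) * ∫⁻ x', gramKernel k νY x x' ^ 2 ∂νX := fun x ↦ by
    rw [kernelOp_transferOp_iterate hk (hkx x), hop, Function.iterate_succ_apply',
      ← ENNReal.pow_le_pow_left_iff two_ne_zero]
    calc _ ≤ (∫⁻ x', gramKernel k νY x x' ^ 2 ∂νX) *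
          ∫⁻ x', (kernelOp (gramKernel k νY) νX)^[j] (gramKernel k νY x) x' ^ 2 ∂νX :=
          sq_lintegral_mul_le νX (hgx x) (measurable_gram_iterate hk (hgx x) j)
      _ ≤ (∫⁻ x', gramKernel k νY x x' ^ 2 ∂νX) *
          ((ρ ^ 4) ^ j * ∫⁻ x', gramKernel k νY x x' ^ 2 ∂νX) :=
          mul_le_mul' le_rfl ((lintegral_sq_gram_iterate_le hk (hgx x) j).trans
            (mul_le_mul' (pow_le_pow_left' hρ j) le_rfl))
      _ = _ := by ring
  calc _ ≤ ∫⁻ x, ρ ^ (2 * j) * ∫⁻ x', gramKernel k νY x x' ^ 2 ∂νX ∂νX := lintegral_mono hpt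
    _ = ρ ^ (2 * j) * cycleWeight k νX νY := by
        rw [lintegral_const_mul _ (Measurable.lintegral_prod_right'
          (f := fun z : X × X ↦ gramKernel k νY z.1 z.2 ^ 2) (hg.pow_const 2))]
        rfl
    _ ≤ ρ ^ (2 * j) * ρ ^ 4 := mul_le_mul' le_rfl hρ
    _ = _ := by ring

end Kernels

/-! ### Alternating paths in a correlated data set -/

section Data

variable {X Y : Type} [MeasurableSpace X] [MeasurableSpace Y]

/-- The weight of the continuation of an alternating path by a list of pairs. -/
def continuationWeight (p : ℝ) (sc : X → Y → ℝ) (φ : Y → ℝ≥0∞) :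
    (j : ℕ) → Y → (Fin j → X × Y) → ℝ≥0∞
  | 0, y, _ => φ y
  | j + 1, y, zs => ENNReal.ofReal (Real.exp (p * sc (zs 0).1 y)) *
      (ENNReal.ofReal (Real.exp ((p - 1) * sc (zs 0).1 (zs 0).2)) *
        continuationWeight p sc φ j (zs 0).2 (Fin.tail zs))

lemma measurable_continuationWeight (p : ℝ) {sc : X → Y → ℝ}
    (hsc : Measurable (Function.uncurry sc)) {α : Type} [MeasurableSpace α]
    {φ : α → Y → ℝ≥0∞} (hφ : Measurable (Function.uncurry φ)) (j : ℕ) :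
    Measurable fun q : α × Y × (Fin j → X × Y) ↦
      continuationWeight p sc (φ q.1) j q.2.1 q.2.2 := by
  induction j with
  | zero => exact hφ.comp (by fun_prop : Measurable fun q : α × Y × (Fin 0 → X × Y) ↦ (q.1, q.2.1))
  | succ j ih =>
    have h1 : Measurable fun q : α × Y × (Fin (j + 1) → X × Y) ↦ sc (q.2.2 0).1 q.2.1 :=
      hsc.comp (by fun_prop :
        Measurable fun q : α × Y × (Fin (j + 1) → X × Y) ↦ ((q.2.2 0).1, q.2.1))
    have h2 : Measurable fun q : α × Y × (Fin (j + 1) → X × Y) ↦ sc (q.2.2 0).1 (q.2.2 0).2 :=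
      hsc.comp (by fun_prop :
        Measurable fun q : α × Y × (Fin (j + 1) → X × Y) ↦ ((q.2.2 0).1, (q.2.2 0).2))
    have h3 : Measurable fun q : α × Y × (Fin (j + 1) → X × Y) ↦
        continuationWeight p sc (φ q.1) j (q.2.2 0).2 (Fin.tail q.2.2) :=
      ih.comp (by
        have : Measurable fun q : α × Y × (Fin (j + 1) → X × Y) ↦ Fin.tail q.2.2 := by
          unfold Fin.tail; fun_prop
        fun_prop : Measurable fun q : α × Y × (Fin (j + 1) → X × Y) ↦
          (q.1, (q.2.2 0).2, Fin.tail q.2.2))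
    exact (Real.measurable_exp.comp (h1.const_mul p)).ennreal_ofReal.mul
      ((Real.measurable_exp.comp (h2.const_mul (p - 1))).ennreal_ofReal.mul h3)

variable {νX : Measure X} {νY : Measure Y} [IsProbabilityMeasure νX] [IsProbabilityMeasure νY]

/-- The law of a correlated pair with log-likelihood ratio `sc`. -/
def pairLaw (νX : Measure X) (νY : Measure Y) (sc : X → Y → ℝ) : Measure (X × Y) :=
  (νX.prod νY).withDensity fun z ↦ ENNReal.ofReal (Real.exp (sc z.1 z.2))

/-- A power of the likelihood ratio. -/
def likelihoodKernel (p : ℝ) (sc : X → Y → ℝ) (x : X) (y : Y) : ℝ≥0∞ :=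
  ENNReal.ofReal (Real.exp (p * sc x y))

lemma measurable_likelihoodKernel (p : ℝ) {sc : X → Y → ℝ}
    (hsc : Measurable (Function.uncurry sc)) :
    Measurable (Function.uncurry (likelihoodKernel p sc)) :=
  (Real.measurable_exp.comp (hsc.const_mul p)).ennreal_ofReal

/-- The change of measure: weight `p - 1` under the correlated law is weight `p` under the product
law. After it, true and false pairs carry the same kernel. -/
lemma lintegral_pairLaw (p : ℝ) {sc : X → Y → ℝ} (hsc : Measurable (Function.uncurry sc))
    {F : X × Y → ℝ≥0∞} (hF : Measurable F) :
    ∫⁻ z, ENNReal.ofReal (Real.exp ((p - 1) * sc z.1 z.2)) * F z ∂(pairLaw νX νY sc) =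
      ∫⁻ x, ∫⁻ y, likelihoodKernel p sc x y * F (x, y) ∂νY ∂νX := by
  have h1 : Measurable fun z : X × Y ↦ ENNReal.ofReal (Real.exp (sc z.1 z.2)) :=
    (Real.measurable_exp.comp hsc).ennreal_ofReal
  have h2 : Measurable fun z : X × Y ↦ ENNReal.ofReal (Real.exp ((p - 1) * sc z.1 z.2)) :=
    (Real.measurable_exp.comp (hsc.const_mul (p - 1))).ennreal_ofReal
  have hG : Measurable fun z ↦ ENNReal.ofReal (Real.exp ((p - 1) * sc z.1 z.2)) * F z := h2.mul hF
  rw [pairLaw, lintegral_withDensity_eq_lintegral_mul _ h1 hG,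
    lintegral_prod _ (h1.mul hG).aemeasurable]
  refine lintegral_congr fun x ↦ lintegral_congr fun y ↦ ?_
  simp only [Pi.mul_apply, likelihoodKernel]
  rw [← mul_assoc, ← ENNReal.ofReal_mul (Real.exp_pos _).le, ← Real.exp_add]
  congr 3
  ring

lemma lintegral_pi_succ {Z : Type} [MeasurableSpace Z] (π : Measure Z) [IsProbabilityMeasure π]
    (j : ℕ) {F : Z → (Fin j → Z) → ℝ≥0∞} (hF : Measurable (Function.uncurry F)) :
    ∫⁻ zs : Fin (j + 1) → Z, F (zs 0) (Fin.tail zs) ∂(Measure.pi fun _ ↦ π) =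
      ∫⁻ z, ∫⁻ zs, F z zs ∂(Measure.pi fun _ ↦ π) ∂π := by
  have h := measurePreserving_piFinSuccAbove (fun _ : Fin (j + 1) ↦ π) 0
  rw [lintegral_lintegral hF.aemeasurable]
  exact h.lintegral_comp (f := fun q : Z × (Fin j → Z) ↦ F q.1 q.2) hF

lemma lintegral_continuationWeight (p : ℝ) {sc : X → Y → ℝ}
    (hsc : Measurable (Function.uncurry sc)) [IsProbabilityMeasure (pairLaw νX νY sc)]
    {φ : Y → ℝ≥0∞} (hφ : Measurable φ) (j : ℕ) (y : Y) :
    ∫⁻ zs, continuationWeight p sc φ j y zs ∂(Measure.pi fun _ : Fin j ↦ pairLaw νX νY sc) =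
      (transferOp (likelihoodKernel p sc) νX νY)^[j] φ y := by
  induction j generalizing y with
  | zero => simp [continuationWeight]
  | succ j ih =>
    have hcont := measurable_continuationWeight p hsc (α := Unit) (φ := fun _ ↦ φ)
      (hφ.comp measurable_snd) j
    have hk := measurable_likelihoodKernel p hsc
    have hk1 : Measurable fun z : X × Y ↦ ENNReal.ofReal (Real.exp (p * sc z.1 y)) :=
      hk.comp (measurable_fst.prodMk measurable_const)
    have hk2 : Measurable fun z : X × Y ↦ ENNReal.ofReal (Real.exp ((p - 1) * sc z.1 z.2)) :=
      (Real.measurable_exp.comp (hsc.const_mul (p - 1))).ennreal_ofReal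
    have hcz : Measurable fun q : (X × Y) × (Fin j → X × Y) ↦
        continuationWeight p sc φ j q.1.2 q.2 :=
      hcont.comp (by fun_prop : Measurable fun q : (X × Y) × (Fin j → X × Y) ↦ ((), q.1.2, q.2))
    have hcz' : ∀ z : X × Y, Measurable fun zs : Fin j → X × Y ↦
        continuationWeight p sc φ j z.2 zs := fun z ↦ hcz.comp measurable_prodMk_left
    simp only [continuationWeight]
    rw [lintegral_pi_succ (pairLaw νX νY sc) j
      (F := fun z zs ↦ ENNReal.ofReal (Real.exp (p * sc z.1 y)) *
      (ENNReal.ofReal (Real.exp ((p - 1) * sc z.1 z.2)) *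
        continuationWeight p sc φ j z.2 zs))
      ((hk1.comp measurable_fst).mul ((hk2.comp measurable_fst).mul hcz))]
    have e : ∀ z : X × Y, ∫⁻ zs, ENNReal.ofReal (Real.exp (p * sc z.1 y)) *
        (ENNReal.ofReal (Real.exp ((p - 1) * sc z.1 z.2)) * continuationWeight p sc φ j z.2 zs)
        ∂(Measure.pi fun _ : Fin j ↦ pairLaw νX νY sc) =
        ENNReal.ofReal (Real.exp ((p - 1) * sc z.1 z.2)) * (likelihoodKernel p sc z.1 y *
          (transferOp (likelihoodKernel p sc) νX νY)^[j] φ z.2) := fun z ↦ by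
      rw [lintegral_const_mul _ ((hcz' z).const_mul _), lintegral_const_mul _ (hcz' z), ih]
      simp only [likelihoodKernel]
      ring
    simp_rw [e]
    have hT := measurable_transferOp_iterate (νX := νX) (νY := νY) hk hφ j
    rw [lintegral_pairLaw p hsc (F := fun z ↦ likelihoodKernel p sc z.1 y *
          (transferOp (likelihoodKernel p sc) νX νY)^[j] φ z.2)
      (hk1.mul (hT.comp measurable_snd)), Function.iterate_succ_apply']
    simp only [transferOp, kernelOp]
    refine lintegral_congr fun x ↦ ?_
    have hm : Measurable fun y' ↦ likelihoodKernel p sc x y' *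
        (transferOp (likelihoodKernel p sc) νX νY)^[j] φ y' :=
      (hk.comp measurable_prodMk_left).mul hT
    rw [← lintegral_const_mul _ hm]
    exact lintegral_congr fun y' ↦ by ring

/-- The mean weight of an alternating path, with an end weight that depends on its first vertex. -/
lemma lintegral_chain (p : ℝ) {sc : X → Y → ℝ}
    (hsc : Measurable (Function.uncurry sc)) [IsProbabilityMeasure (pairLaw νX νY sc)]
    {φ : X → Y → ℝ≥0∞} (hφ : Measurable (Function.uncurry φ)) (j : ℕ) :
    ∫⁻ zs : Fin (j + 1) → X × Y, ENNReal.ofReal (Real.exp ((p - 1) * sc (zs 0).1 (zs 0).2)) *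
        continuationWeight p sc (φ (zs 0).1) j (zs 0).2 (Fin.tail zs)
        ∂(Measure.pi fun _ ↦ pairLaw νX νY sc) =
      ∫⁻ x, kernelOp (likelihoodKernel p sc) νY
        ((transferOp (likelihoodKernel p sc) νX νY)^[j] (φ x)) x ∂νX := by
  have hcont := measurable_continuationWeight p hsc hφ j
  have hk2 : Measurable fun z : X × Y ↦ ENNReal.ofReal (Real.exp ((p - 1) * sc z.1 z.2)) :=
    (Real.measurable_exp.comp (hsc.const_mul (p - 1))).ennreal_ofReal
  have hcz : Measurable fun q : (X × Y) × (Fin j → X × Y) ↦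
      continuationWeight p sc (φ q.1.1) j q.1.2 q.2 :=
    hcont.comp (by fun_prop : Measurable fun q : (X × Y) × (Fin j → X × Y) ↦ (q.1.1, q.1.2, q.2))
  rw [lintegral_pi_succ (pairLaw νX νY sc) j
    (F := fun z zs ↦ ENNReal.ofReal (Real.exp ((p - 1) * sc z.1 z.2)) *
      continuationWeight p sc (φ z.1) j z.2 zs)
    ((hk2.comp measurable_fst).mul hcz)]
  have e : ∀ z : X × Y, ∫⁻ zs, ENNReal.ofReal (Real.exp ((p - 1) * sc z.1 z.2)) *
      continuationWeight p sc (φ z.1) j z.2 zs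
      ∂(Measure.pi fun _ : Fin j ↦ pairLaw νX νY sc) =
      ENNReal.ofReal (Real.exp ((p - 1) * sc z.1 z.2)) *
        ∫⁻ zs, continuationWeight p sc (φ z.1) j z.2 zs
          ∂(Measure.pi fun _ : Fin j ↦ pairLaw νX νY sc) := fun z ↦
    lintegral_const_mul _ (hcz.comp measurable_prodMk_left)
  simp_rw [e]
  rw [lintegral_pairLaw p hsc (F := fun z ↦ ∫⁻ zs, continuationWeight p sc (φ z.1) j z.2 zs
          ∂(Measure.pi fun _ : Fin j ↦ pairLaw νX νY sc)) hcz.lintegral_prod_right']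
  refine lintegral_congr fun x ↦ lintegral_congr fun y ↦ ?_
  have hφx : Measurable (φ x) := hφ.comp measurable_prodMk_left
  exact congrArg _ (lintegral_continuationWeight p hsc hφx j y)

end Data

/-! ### Correlated samples -/

section Sample

variable {U V X Y Ω : Type} [MeasurableSpace X] [MeasurableSpace Y] [MeasurableSpace Ω]

/-- `A` and `B` are samples such that the matched pairs are independent with likelihood ratio
`exp (sc x y)`, and the other pairs are unrelated. -/
structure IsCorrelatedSample (P : Measure Ω) (M : U ↪ V) (νX : Measure X) (νY : Measure Y)
    (sc : X → Y → ℝ) (A : U → Ω → X) (B : V → Ω → Y) : Prop where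
  indep : iIndepFun (fun u ω ↦ (A u ω, B (M u) ω)) P
  law : ∀ u, HasLaw (fun ω ↦ (A u ω, B (M u) ω)) (pairLaw νX νY sc) P
  law_left : ∀ u, HasLaw (A u) νX P
  law_right : ∀ v, HasLaw (B v) νY P
  indep_unmatched : ∀ (v : V) (j : ℕ) (f : Fin j → U), (∀ i, M (f i) ≠ v) →
    IndepFun (fun ω i ↦ (A (f i) ω, B (M (f i)) ω)) (B v) P

/-- The weight of an alternating path in terms of its matched pairs. -/
lemma ofReal_exp_chainScore (p : ℝ) (sc : X → Y → ℝ) (φ : Y → ℝ≥0∞) (M : U → V) (a : U → X)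
    (b : V → Y) (u : U) (l : List U) :
    ENNReal.ofReal (Real.exp (chainScore p M (fun u v ↦ sc (a u) (b v)) (u :: l))) *
        φ (b (M ((u :: l).getLast (List.cons_ne_nil u l)))) =
      ENNReal.ofReal (Real.exp ((p - 1) * sc (a u) (b (M u)))) *
        continuationWeight p sc φ l.length (b (M u)) fun i ↦ (a (l.get i), b (M (l.get i))) := by
  induction l generalizing u with
  | nil => simp [chainScore, continuationWeight]
  | cons w l ih =>
    have h := ih w
    have e : continuationWeight p sc φ (w :: l).length (b (M u))
        (fun i ↦ (a ((w :: l).get i), b (M ((w :: l).get i)))) =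
        ENNReal.ofReal (Real.exp (p * sc (a w) (b (M u)))) *
      (ENNReal.ofReal (Real.exp ((p - 1) * sc (a w) (b (M w)))) *
        continuationWeight p sc φ l.length (b (M w)) fun i ↦ (a (l.get i), b (M (l.get i)))) := rfl
    rw [e, ← h, chainScore, Real.exp_add, Real.exp_add, ENNReal.ofReal_mul (by positivity),
      ENNReal.ofReal_mul (by positivity), List.getLast_cons (List.cons_ne_nil w l)]
    ring

variable {P : Measure Ω} {M : U ↪ V} {νX : Measure X} {νY : Measure Y} {sc : X → Y → ℝ}
  {A : U → Ω → X} {B : V → Ω → Y} [IsProbabilityMeasure νX] [IsProbabilityMeasure νY]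

lemma transferOp_iterate_const_mul {k : X → Y → ℝ≥0∞} (hk : Measurable (Function.uncurry k))
    {φ : Y → ℝ≥0∞} (hφ : Measurable φ) (c : ℝ≥0∞) (j : ℕ) :
    (transferOp k νX νY)^[j] (fun y ↦ c * φ y) = fun y ↦ c * (transferOp k νX νY)^[j] φ y := by
  have hop : ∀ {X Y : Type} [MeasurableSpace X] [MeasurableSpace Y] {k : X → Y → ℝ≥0∞}
      {ν : Measure Y} {φ : Y → ℝ≥0∞}, Measurable (Function.uncurry k) → Measurable φ →
      kernelOp k ν (fun y ↦ c * φ y) = fun x ↦ c * kernelOp k ν φ x := by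
    intro X Y _ _ k ν φ hk hφ
    ext x
    have hm : Measurable fun y ↦ k x y * φ y := (hk.comp measurable_prodMk_left).mul hφ
    simp only [kernelOp]
    rw [← lintegral_const_mul _ hm]
    exact lintegral_congr fun y ↦ by ring
  induction j with
  | zero => rfl
  | succ j ih =>
    have hT := measurable_transferOp_iterate (νX := νX) (νY := νY) hk hφ j
    rw [Function.iterate_succ_apply', ih, Function.iterate_succ_apply', transferOp, hop hk hT,
      hop (measurable_swap_kernel hk) (measurable_kernelOp hk hT)]
    rfl

lemma IsCorrelatedSample.hasLaw_pi (h : IsCorrelatedSample P M νX νY sc A B)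
    [IsProbabilityMeasure (pairLaw νX νY sc)] {l : List U} (hl : l.Nodup) :
    HasLaw (fun ω (i : Fin l.length) ↦ (A (l.get i) ω, B (M (l.get i)) ω))
      (Measure.pi fun _ ↦ pairLaw νX νY sc) P where
  aemeasurable := aemeasurable_pi_lambda _ fun i ↦ (h.law _).aemeasurable
  map_eq := by
    rw [iIndepFun.map_fun_eq_pi_map (fun i ↦ (h.law (l.get i)).aemeasurable)
      (h.indep.precomp (List.nodup_iff_injective_get.1 hl))]
    congr 1
    ext1 i
    exact (h.law _).map_eq

/-- The end weight may depend on the first feature so as to serve every case: `1` for a plain path,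
`K 1` at the first feature for an exit, the kernel itself for a cycle. -/
lemma lintegral_sample_path (h : IsCorrelatedSample P M νX νY sc A B)
    (hsc : Measurable (Function.uncurry sc)) [IsProbabilityMeasure (pairLaw νX νY sc)] (p : ℝ)
    {φ : X → Y → ℝ≥0∞} (hφ : Measurable (Function.uncurry φ)) {u : U} {l : List U}
    (hl : (u :: l).Nodup) :
    ∫⁻ ω, ENNReal.ofReal (Real.exp (chainScore p M (fun u v ↦ sc (A u ω) (B v ω)) (u :: l))) *
        φ (A u ω) (B (M ((u :: l).getLast (List.cons_ne_nil u l))) ω) ∂P =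
      ∫⁻ x, kernelOp (likelihoodKernel p sc) νY
        ((transferOp (likelihoodKernel p sc) νX νY)^[l.length] (φ x)) x ∂νX := by
  have hcont := measurable_continuationWeight p hsc hφ l.length
  have hk2 : Measurable fun z : X × Y ↦ ENNReal.ofReal (Real.exp ((p - 1) * sc z.1 z.2)) :=
    (Real.measurable_exp.comp (hsc.const_mul (p - 1))).ennreal_ofReal
  have htail : Measurable fun zs : Fin (l.length + 1) → X × Y ↦ Fin.tail zs := by
    unfold Fin.tail; fun_prop
  have hF : Measurable fun zs : Fin (l.length + 1) → X × Y ↦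
      ENNReal.ofReal (Real.exp ((p - 1) * sc (zs 0).1 (zs 0).2)) *
        continuationWeight p sc (φ (zs 0).1) l.length (zs 0).2 (Fin.tail zs) :=
    (hk2.comp (measurable_pi_apply 0)).mul (hcont.comp (by fun_prop :
      Measurable fun zs : Fin (l.length + 1) → X × Y ↦ ((zs 0).1, (zs 0).2, Fin.tail zs)))
  rw [← lintegral_chain p hsc hφ l.length]
  have hlaw := h.hasLaw_pi hl
  exact (lintegral_congr fun ω ↦ ofReal_exp_chainScore p sc (φ (A u ω)) M (fun u ↦ A u ω)
    (fun v ↦ B v ω) u l).trans (HasLaw.lintegral_comp hlaw hF.aemeasurable)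

/-- The feature of the exit `v` is independent of the whole path, so it can be integrated out first.
-/
lemma lintegral_sample_exit (h : IsCorrelatedSample P M νX νY sc A B)
    (hsc : Measurable (Function.uncurry sc)) [IsProbabilityMeasure (pairLaw νX νY sc)] (p : ℝ)
    {u : U} {l : List U} {v : V} (hl : (u :: l).Nodup) (hv : ∀ x ∈ u :: l, M x ≠ v) :
    ∫⁻ ω, ENNReal.ofReal (Real.exp (chainScore p M (fun u v ↦ sc (A u ω) (B v ω)) (u :: l))) *
        likelihoodKernel p sc (A u ω) (B v ω) ∂P =
      ∫⁻ ω, ENNReal.ofReal (Real.exp (chainScore p M (fun u v ↦ sc (A u ω) (B v ω)) (u :: l))) *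
        kernelOp (likelihoodKernel p sc) νY 1 (A u ω) ∂P := by
  have : IsProbabilityMeasure P := h.indep.isProbabilityMeasure
  have hk := measurable_likelihoodKernel p hsc
  have hcont := measurable_continuationWeight p hsc (α := Unit) (φ := fun _ ↦ 1)
    (measurable_one.comp measurable_snd) l.length
  have hk2 : Measurable fun z : X × Y ↦ ENNReal.ofReal (Real.exp ((p - 1) * sc z.1 z.2)) :=
    (Real.measurable_exp.comp (hsc.const_mul (p - 1))).ennreal_ofReal
  have htail : Measurable fun zs : Fin (l.length + 1) → X × Y ↦ Fin.tail zs := by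
    unfold Fin.tail; fun_prop
  let G : (Fin (l.length + 1) → X × Y) → ℝ≥0∞ := fun zs ↦
      ENNReal.ofReal (Real.exp ((p - 1) * sc (zs 0).1 (zs 0).2)) *
        continuationWeight p sc 1 l.length (zs 0).2 (Fin.tail zs)
  have hG : Measurable G :=
    (hk2.comp (measurable_pi_apply 0)).mul (hcont.comp (by fun_prop :
      Measurable fun zs : Fin (l.length + 1) → X × Y ↦ ((), (zs 0).2, Fin.tail zs)))
  have hGe : ∀ ω, ENNReal.ofReal (Real.exp (chainScore p M (fun u v ↦ sc (A u ω) (B v ω))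
      (u :: l))) = G fun i ↦ (A ((u :: l).get i) ω, B (M ((u :: l).get i)) ω) := fun ω ↦ by
    have := ofReal_exp_chainScore p sc 1 M (fun u ↦ A u ω) (fun v ↦ B v ω) u l
    rw [Pi.one_apply, mul_one] at this
    exact this
  have hlaw := h.hasLaw_pi hl
  have hjoint := (h.indep_unmatched v _ (fun i ↦ (u :: l).get i)
    fun i ↦ hv _ (List.get_mem _ i)).hasLaw_prod hlaw (h.law_right v)
  have hF : Measurable fun q : (Fin (l.length + 1) → X × Y) × Y ↦
      G q.1 * likelihoodKernel p sc (q.1 0).1 q.2 :=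
    (hG.comp measurable_fst).mul (hk.comp (by fun_prop :
      Measurable fun q : (Fin (l.length + 1) → X × Y) × Y ↦ ((q.1 0).1, q.2)))
  have hF' : Measurable fun zs : Fin (l.length + 1) → X × Y ↦
      G zs * kernelOp (likelihoodKernel p sc) νY 1 (zs 0).1 :=
    hG.mul ((measurable_kernelOp hk measurable_one).comp (by fun_prop :
      Measurable fun zs : Fin (l.length + 1) → X × Y ↦ (zs 0).1))
  simp_rw [hGe]
  refine (HasLaw.lintegral_comp hjoint hF.aemeasurable).trans
    (Eq.trans ?_ (HasLaw.lintegral_comp hlaw hF'.aemeasurable).symm)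
  refine (lintegral_prod _ hF.aemeasurable).trans (lintegral_congr fun zs ↦ ?_)
  have hkz : Measurable fun y ↦ likelihoodKernel p sc (zs 0).1 y := hk.comp measurable_prodMk_left
  change ∫⁻ y, G zs * likelihoodKernel p sc (zs 0).1 y ∂νY = _
  rw [lintegral_const_mul _ hkz]
  simp [kernelOp]

/-- The fourth root of the four-cycle weight serves as the price of one edge, although consecutive
edges share features and are dependent. -/
lemma chainBound_sample (h : IsCorrelatedSample P M νX νY sc A B)
    (hsc : Measurable (Function.uncurry sc)) [IsProbabilityMeasure (pairLaw νX νY sc)]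
    {p ρ : ℝ} (hρ : 0 ≤ ρ)
    (hQ : cycleWeight (likelihoodKernel p sc) νX νY ≤ ENNReal.ofReal ρ ^ 4) :
    ChainBound P M (fun ω u v ↦ sc (A u ω) (B v ω)) p ρ where
  path u l hl := by
    have hk := measurable_likelihoodKernel p hsc
    have := lintegral_sample_path h hsc p (φ := fun _ ↦ 1) (measurable_one.comp measurable_snd) hl
    simp only [Pi.one_apply, mul_one] at this
    rw [this, ENNReal.ofReal_pow hρ]
    exact lintegral_path_le hk hQ l.length
  exit u l v hl hv := by
    have hk := measurable_likelihoodKernel p hsc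
    have hκ := measurable_kernelOp (νY := νY) hk measurable_one
    have e : ∀ ω, ENNReal.ofReal (Real.exp (chainScore p M (fun u v ↦ sc (A u ω) (B v ω)) (u :: l) +
        p * sc (A u ω) (B v ω))) = ENNReal.ofReal (Real.exp (chainScore p M
          (fun u v ↦ sc (A u ω) (B v ω)) (u :: l))) * likelihoodKernel p sc (A u ω) (B v ω) :=
      fun ω ↦ by rw [Real.exp_add, ENNReal.ofReal_mul (by positivity)]; rfl
    simp_rw [e]
    rw [lintegral_sample_exit h hsc p hl hv, ENNReal.ofReal_pow hρ,
      lintegral_sample_path h hsc p (φ := fun x _ ↦ kernelOp (likelihoodKernel p sc) νY 1 x)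
      (hκ.comp measurable_fst) hl]
    refine le_trans (le_of_eq (lintegral_congr fun x ↦ ?_)) (lintegral_exit_le hk hQ l.length)
    have hT := measurable_transferOp_iterate (νX := νX) (νY := νY) hk measurable_one l.length
    have := transferOp_iterate_const_mul (νX := νX) (νY := νY) hk measurable_one
      (kernelOp (likelihoodKernel p sc) νY 1 x) l.length
    simp only [Pi.one_apply, mul_one] at this
    rw [this]
    have hm : Measurable fun y ↦ likelihoodKernel p sc x y *
        (transferOp (likelihoodKernel p sc) νX νY)^[l.length] 1 y :=
      (hk.comp measurable_prodMk_left).mul hT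
    simp only [kernelOp] at hm ⊢
    rw [← lintegral_const_mul _ hm]
    exact lintegral_congr fun y ↦ by ring
  cycle u l hl hne := by
    have hk := measurable_likelihoodKernel p hsc
    -- A closed path has at least two users; this supplies the exponent `j + 1` for the cycle bound.
    obtain ⟨j, hj⟩ := Nat.exists_eq_succ_of_ne_zero (List.length_pos_iff.2 hne).ne'
    have e : ∀ ω, ENNReal.ofReal (Real.exp (chainScore p M (fun u v ↦ sc (A u ω) (B v ω)) (u :: l) +
        p * sc (A u ω) (B (M ((u :: l).getLast (List.cons_ne_nil u l))) ω))) =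
        ENNReal.ofReal (Real.exp (chainScore p M (fun u v ↦ sc (A u ω) (B v ω)) (u :: l))) *
        likelihoodKernel p sc (A u ω) (B (M ((u :: l).getLast (List.cons_ne_nil u l))) ω) :=
      fun ω ↦ by rw [Real.exp_add, ENNReal.ofReal_mul (by positivity)]; rfl
    simp_rw [e]
    rw [lintegral_sample_path h hsc p hk hl, ENNReal.ofReal_pow hρ, hj]
    exact lintegral_cycle_le hk hQ j

lemma lintegral_exp_unmatched (h : IsCorrelatedSample P M νX νY sc A B)
    (hsc : Measurable (Function.uncurry sc)) (p : ℝ) {u : U} {v : V} (huv : M u ≠ v) :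
    ∫⁻ ω, ENNReal.ofReal (Real.exp (p * sc (A u ω) (B v ω))) ∂P =
      ∫⁻ z, likelihoodKernel p sc z.1 z.2 ∂(νX.prod νY) := by
  have : IsProbabilityMeasure P := h.indep.isProbabilityMeasure
  have hk := measurable_likelihoodKernel p hsc
  have hind : IndepFun (A u) (B v) P := (h.indep_unmatched v 1 (fun _ ↦ u) fun _ ↦ huv).comp
    (φ := fun zs : Fin 1 → X × Y ↦ (zs 0).1) (by fun_prop) measurable_id
  exact HasLaw.lintegral_comp (hind.hasLaw_prod (h.law_left u) (h.law_right v)) hk.aemeasurable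

lemma lintegral_exp_matched (h : IsCorrelatedSample P M νX νY sc A B)
    (hsc : Measurable (Function.uncurry sc)) (p : ℝ) (u : U) :
    ∫⁻ ω, ENNReal.ofReal (Real.exp ((p - 1) * sc (A u ω) (B (M u) ω))) ∂P =
      ∫⁻ z, likelihoodKernel p sc z.1 z.2 ∂(νX.prod νY) := by
  have hk2 : Measurable fun z : X × Y ↦ ENNReal.ofReal (Real.exp ((p - 1) * sc z.1 z.2)) :=
    (Real.measurable_exp.comp (hsc.const_mul (p - 1))).ennreal_ofReal
  have hk := measurable_likelihoodKernel p hsc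
  refine (HasLaw.lintegral_comp (h.law u) hk2.aemeasurable).trans
    (Eq.trans ?_ (lintegral_prod _ hk.aemeasurable).symm)
  simpa using lintegral_pairLaw (νX := νX) (νY := νY) p hsc (F := 1) measurable_one

end Sample

/-! ### Gaussian vectors -/

section Gaussian

open Matrix

variable {D : Type} [Fintype D]

/-- The law of a vector of independent standard Gaussians. -/
def stdGaussianPi (D : Type) [Fintype D] : Measure (D → ℝ) := Measure.pi fun _ ↦ gaussianReal 0 1

instance : IsProbabilityMeasure (stdGaussianPi D) := by unfold stdGaussianPi; infer_instance

lemma measurable_mulVec {m n : Type} [Fintype n] (A : Matrix m n ℝ) :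
    Measurable fun x : n → ℝ ↦ A *ᵥ x :=
  measurable_pi_lambda _ fun _ ↦ Finset.measurable_fun_sum _ fun j _ ↦
    (measurable_pi_apply j).const_mul _

lemma measurable_quadratic (B : Matrix D D ℝ) : Measurable fun x : D → ℝ ↦ x ⬝ᵥ B *ᵥ x :=
  Finset.measurable_fun_sum _ fun i _ ↦
    (measurable_pi_apply i).mul ((measurable_pi_apply i).comp (measurable_mulVec B))

lemma gaussianReal_measure_eq_integral (s : Set ℝ) :
    gaussianReal 0 1 s = ENNReal.ofReal (∫ x in s, gaussianPDFReal 0 1 x) := by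
  rw [gaussianReal_apply _ one_ne_zero, ofReal_integral_eq_lintegral_ofReal
    (integrable_gaussianPDFReal 0 1).integrableOn
    (ae_of_all _ fun x ↦ gaussianPDFReal_nonneg 0 1 x)]
  rfl

variable [DecidableEq D]

lemma prod_gaussianPDFReal (x : D → ℝ) :
    ∏ i, gaussianPDFReal 0 1 (x i) = gaussianDensity 0 1 x := by
  simp only [gaussianPDFReal, gaussianDensity, Finset.prod_mul_distrib, ← Real.exp_sum]
  congr 1
  · have h : (0 : ℝ) ≤ 2 * Real.pi := by positivity
    rw [Finset.prod_const, det_one, mul_one, inv_pow, Finset.card_univ]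
    congr 1
    rw [NNReal.coe_one, mul_one]
    exact (Real.sqrt_eq_iff_mul_self_eq (by positivity) (by positivity)).2 (by
      rw [← mul_pow, Real.mul_self_sqrt h]) |>.symm
  · simp [dotProduct, Finset.sum_div, sq, neg_div]

lemma measurable_gaussianDensity (m : D → ℝ) (S : Matrix D D ℝ) :
    Measurable (gaussianDensity m S) := by
  unfold gaussianDensity
  exact (Real.measurable_exp.comp (((measurable_quadratic S⁻¹).comp
    (measurable_id.sub_const m)).neg.div_const 2)).const_mul _

lemma gaussianDensity_pos (m : D → ℝ) {S : Matrix D D ℝ} (hS : S.PosDef) (x : D → ℝ) :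
    0 < gaussianDensity m S x := by
  have := hS.det_pos
  unfold gaussianDensity
  positivity

lemma stdGaussianPi_eq_withDensity :
    stdGaussianPi D = volume.withDensity fun x ↦ ENNReal.ofReal (gaussianDensity 0 1 x) := by
  refine Measure.pi_eq fun s hs ↦ ?_
  have hInt : Integrable (fun x : D → ℝ ↦ ∏ i, gaussianPDFReal 0 1 (x i)) :=
    Integrable.fintype_prod fun _ ↦ integrable_gaussianPDFReal 0 1
  have hnn : ∀ x : D → ℝ, 0 ≤ ∏ i, gaussianPDFReal 0 1 (x i) := fun x ↦
    Finset.prod_nonneg fun i _ ↦ gaussianPDFReal_nonneg 0 1 _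
  simp_rw [← prod_gaussianPDFReal]
  rw [withDensity_apply _ (MeasurableSet.univ_pi hs),
    ← ofReal_integral_eq_lintegral_ofReal hInt.integrableOn (ae_of_all _ hnn),
    volume_pi, Measure.restrict_pi_pi,
    integral_fintype_prod_eq_prod (f := fun _ x ↦ gaussianPDFReal 0 1 x),
    ENNReal.ofReal_prod_of_nonneg]
  · exact Finset.prod_congr rfl fun i _ ↦ (gaussianReal_measure_eq_integral (s i)).symm
  · exact fun i _ ↦ integral_nonneg fun x ↦ gaussianPDFReal_nonneg 0 1 x

/-- The quadratic form pulls back exactly, and the normalizing constants differ by the Jacobian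
`|A.det|`. -/
lemma gaussianDensity_affine (m : D → ℝ) {A R S : Matrix D D ℝ} (hA : A.det ≠ 0)
    (hAS : A * R * Aᵀ = S) (x : D → ℝ) :
    gaussianDensity m S (m + A *ᵥ x) * |A.det| = gaussianDensity 0 R x := by
  have hS : S.det = |A.det| ^ 2 * R.det := by
    rw [← hAS, det_mul, det_mul, det_transpose, sq_abs, sq, mul_right_comm]
  have hq : A *ᵥ x ⬝ᵥ S⁻¹ *ᵥ (A *ᵥ x) = x ⬝ᵥ R⁻¹ *ᵥ x := by
    have hu : IsUnit A.det := hA.isUnit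
    have hut : IsUnit Aᵀ.det := by rwa [det_transpose]
    have e : S⁻¹ *ᵥ (A *ᵥ x) = (Aᵀ)⁻¹ *ᵥ (R⁻¹ *ᵥ x) := by
      rw [← hAS, Matrix.mul_inv_rev, Matrix.mul_inv_rev, mulVec_mulVec, Matrix.mul_assoc,
        Matrix.mul_assoc, nonsing_inv_mul _ hu, Matrix.mul_one, mulVec_mulVec]
    rw [e, ← vecMul_transpose, ← dotProduct_mulVec, mulVec_mulVec _ Aᵀ, mul_nonsing_inv _ hut,
      one_mulVec]
  have hpos := abs_pos.2 hA
  unfold gaussianDensity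
  rw [add_sub_cancel_left, hq, hS, mul_left_comm, Real.sqrt_mul (by positivity),
    Real.sqrt_sq hpos.le, mul_inv, sub_zero]
  field_simp

lemma map_affine_stdGaussianPi (m : D → ℝ) {A S : Matrix D D ℝ} (hA : A.det ≠ 0)
    (hAS : A * Aᵀ = S) :
    (stdGaussianPi D).map (fun x ↦ m + A *ᵥ x) =
      volume.withDensity fun x ↦ ENNReal.ofReal (gaussianDensity m S x) := by
  have hmeas : Measurable fun x : D → ℝ ↦ m + A *ᵥ x := (measurable_mulVec A).const_add m
  have hg := (measurable_gaussianDensity m S).ennreal_ofReal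
  have hvol : (volume : Measure (D → ℝ)).map (fun x ↦ m + A *ᵥ x) =
      ENNReal.ofReal |A.det|⁻¹ • volume := by
    have h1 := Real.map_matrix_volume_pi_eq_smul_volume_pi hA
    have h2 := Measure.map_map (μ := volume) (measurable_const_add m) (measurable_mulVec A)
    refine h2.symm.trans ?_
    change (Measure.map (toLin' A) volume).map (fun x ↦ m + x) = _
    rw [h1, Measure.map_smul, (measurePreserving_add_left volume m).map_eq, abs_inv]
  have hpos : 0 < |A.det| := abs_pos.2 hA
  refine Measure.ext_of_lintegral _ fun F hF ↦ ?_
  rw [lintegral_map hF hmeas, stdGaussianPi_eq_withDensity,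
    lintegral_withDensity_eq_lintegral_mul _ (measurable_gaussianDensity 0 1).ennreal_ofReal
      (g := fun x ↦ F (m + A *ᵥ x)) (hF.comp hmeas), lintegral_withDensity_eq_lintegral_mul _ hg hF]
  have e : ∀ x, ((fun x : D → ℝ ↦ ENNReal.ofReal (gaussianDensity 0 1 x)) *
      fun x ↦ F (m + A *ᵥ x)) x = ENNReal.ofReal |A.det| * ((fun y ↦
        ENNReal.ofReal (gaussianDensity m S y)) * F) (m + A *ᵥ x) := fun x ↦ by
    simp only [Pi.mul_apply]
    rw [← gaussianDensity_affine m (R := 1) (S := S) hA (by rwa [Matrix.mul_one]), mul_comm (gaussianDensity m S _),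
      ENNReal.ofReal_mul hpos.le, mul_assoc]
  have hcalc := lintegral_map (μ := volume) (hg.mul hF) hmeas
  rw [hvol, lintegral_smul_measure, smul_eq_mul] at hcalc
  refine (lintegral_congr e).trans ?_
  rw [lintegral_const_mul' _ _ ENNReal.ofReal_ne_top, ← hcalc, ← mul_assoc,
    ← ENNReal.ofReal_mul hpos.le, mul_inv_cancel₀ hpos.ne', ENNReal.ofReal_one, one_mul]

open scoped MatrixOrder in
lemma sqrt_mul_transpose_sqrt {S : Matrix D D ℝ} (hS : S.PosDef) :
    CFC.sqrt S * (CFC.sqrt S)ᵀ = S := by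
  have h0 : (0 : Matrix D D ℝ) ≤ S := hS.posSemidef.nonneg
  have h1 : (CFC.sqrt S).PosSemidef := Matrix.nonneg_iff_posSemidef.1 (CFC.sqrt_nonneg S)
  have h2 : (CFC.sqrt S)ᵀ = CFC.sqrt S := by simpa using h1.isHermitian.eq
  rw [h2, CFC.sqrt_mul_sqrt_self S h0]

open scoped MatrixOrder in
lemma det_sqrt_pos {S : Matrix D D ℝ} (hS : S.PosDef) : 0 < (CFC.sqrt S).det := by
  have h1 : (CFC.sqrt S).PosSemidef := Matrix.nonneg_iff_posSemidef.1 (CFC.sqrt_nonneg S)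
  refine lt_of_le_of_ne h1.det_nonneg fun h ↦ hS.det_pos.ne' ?_
  rw [← sqrt_mul_transpose_sqrt hS, det_mul, ← h, zero_mul]

open scoped MatrixOrder in
lemma map_sqrt_stdGaussianPi (m : D → ℝ) {S : Matrix D D ℝ} (hS : S.PosDef) :
    (stdGaussianPi D).map (fun x ↦ m + CFC.sqrt S *ᵥ x) =
      volume.withDensity fun x ↦ ENNReal.ofReal (gaussianDensity m S x) :=
  map_affine_stdGaussianPi m (det_sqrt_pos hS).ne' (sqrt_mul_transpose_sqrt hS)

lemma map_orthogonal_stdGaussianPi {A : Matrix D D ℝ} (hA : A * Aᵀ = 1) :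
    (stdGaussianPi D).map (fun x ↦ A *ᵥ x) = stdGaussianPi D := by
  have hdet : A.det ≠ 0 := fun h ↦ by
    have := congrArg det hA
    simp [h] at this
  have := map_affine_stdGaussianPi 0 hdet hA
  simpa [stdGaussianPi_eq_withDensity] using this

lemma lintegral_gaussianDensity (m : D → ℝ) {S : Matrix D D ℝ} (hS : S.PosDef) :
    ∫⁻ x, ENNReal.ofReal (gaussianDensity m S x) = 1 := by
  have h := congrArg (fun μ : Measure (D → ℝ) ↦ μ Set.univ) (map_sqrt_stdGaussianPi m hS)
  simp only [withDensity_apply _ MeasurableSet.univ, Measure.restrict_univ] at h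
  rw [← h, Measure.map_apply ((measurable_mulVec _).const_add m) MeasurableSet.univ]
  simp

/-- The moment generating function of a quadratic form. -/
lemma lintegral_exp_quadratic {B : Matrix D D ℝ} (hB : (1 + B).PosDef) :
    ∫⁻ x, ENNReal.ofReal (Real.exp (-(x ⬝ᵥ B *ᵥ x) / 2)) ∂(stdGaussianPi D) =
      ENNReal.ofReal (Real.sqrt (1 + B).det)⁻¹ := by
  have hq : Measurable fun x : D → ℝ ↦ ENNReal.ofReal (Real.exp (-(x ⬝ᵥ B *ᵥ x) / 2)) :=
    (Real.measurable_exp.comp ((measurable_quadratic B).neg.div_const 2)).ennreal_ofReal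
  have hd := hB.det_pos
  have hu : IsUnit (1 + B).det := hd.ne'.isUnit
  -- The exponential tilts the standard density into that of covariance `(1 + B)⁻¹`; the ratio of
  -- normalizing constants is the value.
  have e : ∀ x : D → ℝ, ((fun x : D → ℝ ↦ ENNReal.ofReal (gaussianDensity 0 1 x)) *
      fun x ↦ ENNReal.ofReal (Real.exp (-(x ⬝ᵥ B *ᵥ x) / 2))) x =
      ENNReal.ofReal (Real.sqrt (1 + B).det)⁻¹ *
        ENNReal.ofReal (gaussianDensity 0 (1 + B)⁻¹ x) := fun x ↦ by
    simp only [Pi.mul_apply]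
    rw [← ENNReal.ofReal_mul (gaussianDensity_pos 0 PosDef.one x).le,
      ← ENNReal.ofReal_mul (by positivity)]
    congr 1
    simp only [gaussianDensity, sub_zero, nonsing_inv_nonsing_inv _ hu, inv_one, det_one, mul_one,
      one_mulVec, add_mulVec, dotProduct_add, det_nonsing_inv, Ring.inverse_eq_inv']
    rw [Real.sqrt_mul (by positivity), Real.sqrt_inv, neg_add, add_div, Real.exp_add]
    have := Real.sqrt_pos.2 hd
    field_simp
  rw [stdGaussianPi_eq_withDensity, lintegral_withDensity_eq_lintegral_mul _
    (measurable_gaussianDensity 0 1).ennreal_ofReal hq, lintegral_congr e,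
    lintegral_const_mul _ (measurable_gaussianDensity _ _).ennreal_ofReal,
    lintegral_gaussianDensity 0 hB.inv, mul_one]

end Gaussian

/-! ### Correlated Gaussian databases as correlated samples -/

section GaussianLaw

open Matrix

variable {Ω Ω' D : Type} [Fintype D] [MeasurableSpace Ω] [MeasurableSpace Ω']
  {P : Measure Ω} {Q : Measure Ω'}

/-- A Gaussian vector is determined in law by its means and covariances. -/
lemma map_eq_map_of_hasGaussianLaw {X : Ω → D → ℝ} {Y : Ω' → D → ℝ} (hX : HasGaussianLaw X P)
    (hY : HasGaussianLaw Y Q) (hm : ∀ i, ∫ ω, X ω i ∂P = ∫ ω, Y ω i ∂Q)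
    (hc : ∀ i j, cov[fun ω ↦ X ω i, fun ω ↦ X ω j; P] = cov[fun ω ↦ Y ω i, fun ω ↦ Y ω j; Q]) :
    P.map X = Q.map Y := by
  classical
  have : IsProbabilityMeasure P := hX.isProbabilityMeasure
  have : IsProbabilityMeasure Q := hY.isProbabilityMeasure
  have : IsGaussian (P.map X) := hX.isGaussian_map
  have : IsGaussian (Q.map Y) := hY.isGaussian_map
  have key : ∀ {Ω : Type} [MeasurableSpace Ω] {P : Measure Ω} {X : Ω → D → ℝ}
      (_ : HasGaussianLaw X P) (L : StrongDual ℝ (D → ℝ)),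
      ∫ ω, L (X ω) ∂P = ∑ i, L (Pi.single i 1) * ∫ ω, X ω i ∂P ∧
      Var[fun ω ↦ L (X ω); P] = ∑ i, ∑ j, L (Pi.single i 1) * (L (Pi.single j 1) *
        cov[fun ω ↦ X ω i, fun ω ↦ X ω j; P]) := by
    intro Ω _ P X hX L
    have : IsProbabilityMeasure P := hX.isProbabilityMeasure
    have hL : ∀ x, L x = ∑ i, L (Pi.single i 1) * x i := fun x ↦ by
      conv_lhs => rw [pi_eq_sum_univ' x]
      simp [mul_comm]
    have h2 : ∀ i, MemLp (fun ω ↦ X ω i) 2 P := fun i ↦ (hX.eval i).memLp_two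
    have hm2 : ∀ i, MemLp (fun ω ↦ L (Pi.single i 1) * X ω i) 2 P := fun i ↦ (h2 i).const_mul _
    simp_rw [hL (X _)]
    refine ⟨?_, ?_⟩
    · rw [integral_finsetSum _ fun i _ ↦ (hm2 i).integrable one_le_two]
      simp_rw [integral_const_mul]
    · rw [← covariance_self (memLp_finsetSum _ fun i _ ↦ hm2 i).aemeasurable,
        covariance_fun_sum_fun_sum hm2 hm2]
      simp_rw [covariance_const_mul_left, covariance_const_mul_right]
  refine Measure.ext_of_charFunDual ?_
  ext L
  rw [hX.charFunDual_map_eq_fun, hY.charFunDual_map_eq_fun]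
  rw [(key hX L).1, (key hX L).2, (key hY L).1, (key hY L).2]
  simp_rw [hm, hc]

open scoped MatrixOrder in
-- Means and covariances determine a Gaussian law; compare with `multivariateGaussian`, which is the
-- image of the standard law under `x ↦ m + √S x` and so has the stated density.
lemma hasLaw_gaussianDensity [DecidableEq D] {X : Ω → D → ℝ} (hX : HasGaussianLaw X P)
    {m : D → ℝ} {S : Matrix D D ℝ} (hS : S.PosDef) (hm : ∀ i, ∫ ω, X ω i ∂P = m i)
    (hc : ∀ i j, cov[fun ω ↦ X ω i, fun ω ↦ X ω j; P] = S i j) :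
    HasLaw X (volume.withDensity fun x ↦ ENNReal.ofReal (gaussianDensity m S x)) P where
  aemeasurable := hX.aemeasurable
  map_eq := by
    have hmap : (multivariateGaussian (WithLp.toLp 2 m) S).map (WithLp.ofLp) =
        (stdGaussianPi D).map (fun x ↦ m + CFC.sqrt S *ᵥ x) := by
      rw [multivariateGaussian, ← map_pi_eq_stdGaussian,
        Measure.map_map (by fun_prop) (by fun_prop), Measure.map_map (by fun_prop) (by fun_prop)]
      rfl
    rw [← map_sqrt_stdGaussianPi m hS, ← hmap]
    have hG : HasGaussianLaw (WithLp.ofLp : EuclideanSpace ℝ D → D → ℝ)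
        (multivariateGaussian (WithLp.toLp 2 m) S) :=
      (IsGaussian.hasGaussianLaw_id (μ := multivariateGaussian (WithLp.toLp 2 m) S)).map_equiv
        (EuclideanSpace.equiv D ℝ)
    refine map_eq_map_of_hasGaussianLaw hX hG (fun i ↦ ?_) fun i j ↦ ?_
    · rw [hm]
      have h := integral_id_multivariateGaussian (μ := WithLp.toLp 2 m) (S := S)
      have h' := (EuclideanSpace.proj (𝕜 := ℝ) i).integral_comp_id_comm
        (μ := multivariateGaussian (WithLp.toLp 2 m) S) IsGaussian.integrable_id
      rw [h] at h'
      exact h'.symm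
    · rw [hc]
      exact (covariance_eval_multivariateGaussian hS.posSemidef i j).symm

end GaussianLaw

/-! ### Joint laws and independence in the databases -/

section Databases

open Matrix

variable {Da Db : Type} [Fintype Da] [Fintype Db] [DecidableEq Da] [DecidableEq Db]
  {μa : Da → ℝ} {μb : Db → ℝ} {Sa : Matrix Da Da ℝ} {Sab : Matrix Da Db ℝ} {Sb : Matrix Db Db ℝ}

lemma posDef_left (h : (jointCov Sa Sab Sb).PosDef) : Sa.PosDef :=
  h.submatrix (e := Sum.inl) Sum.inl_injective

lemma posDef_right (h : (jointCov Sa Sab Sb).PosDef) : Sb.PosDef :=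
  h.submatrix (e := Sum.inr) Sum.inr_injective

/-- The Gaussian law with a density. -/
def densityLaw {D : Type} [Fintype D] [DecidableEq D] (m : D → ℝ) (S : Matrix D D ℝ) :
    Measure (D → ℝ) := volume.withDensity fun x ↦ ENNReal.ofReal (gaussianDensity m S x)

lemma isProbabilityMeasure_densityLaw {D : Type} [Fintype D] [DecidableEq D] (m : D → ℝ)
    {S : Matrix D D ℝ} (hS : S.PosDef) : IsProbabilityMeasure (densityLaw m S) :=
  ⟨by rw [densityLaw, withDensity_apply _ MeasurableSet.univ, Measure.restrict_univ,
    lintegral_gaussianDensity m hS]⟩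

lemma measurable_sumElim {α β : Type} :
    Measurable fun z : (α → ℝ) × (β → ℝ) ↦ (Sum.elim z.1 z.2 : α ⊕ β → ℝ) :=
  measurable_pi_lambda _ fun i ↦ by
    cases i with
    | inl i => exact (measurable_pi_apply i).comp measurable_fst
    | inr i => exact (measurable_pi_apply i).comp measurable_snd

lemma measurable_infoDensity :
    Measurable (Function.uncurry (infoDensity μa μb Sa Sab Sb)) :=
  Real.measurable_log.comp (((measurable_gaussianDensity _ _).comp measurable_sumElim).div
    (((measurable_gaussianDensity _ _).comp measurable_fst).mul
      ((measurable_gaussianDensity _ _).comp measurable_snd)))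

/-- Multiplying the product of the marginal densities by the exponential of the information density
restores the joint density. -/
lemma map_densityLaw_joint (h : (jointCov Sa Sab Sb).PosDef) :
    (densityLaw (Sum.elim μa μb) (jointCov Sa Sab Sb)).map
        (fun z ↦ (fun i ↦ z (Sum.inl i), fun j ↦ z (Sum.inr j))) =
      pairLaw (densityLaw μa Sa) (densityLaw μb Sb) (infoDensity μa μb Sa Sab Sb) := by
  have ha := posDef_left h
  have hb := posDef_right h
  have : IsProbabilityMeasure (densityLaw μa Sa) := isProbabilityMeasure_densityLaw μa ha
  have : IsProbabilityMeasure (densityLaw μb Sb) := isProbabilityMeasure_densityLaw μb hb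
  have hmp := volume_measurePreserving_sumPiEquivProdPi_symm (fun _ : Da ⊕ Db ↦ ℝ)
  have hma := (measurable_gaussianDensity μa Sa).ennreal_ofReal
  have hmb := (measurable_gaussianDensity μb Sb).ennreal_ofReal
  have hmj := (measurable_gaussianDensity (Sum.elim μa μb) (jointCov Sa Sab Sb)).ennreal_ofReal
  have hinfo : Measurable fun z : (Da → ℝ) × (Db → ℝ) ↦
      ENNReal.ofReal (Real.exp (infoDensity μa μb Sa Sab Sb z.1 z.2)) :=
    (Real.measurable_exp.comp measurable_infoDensity).ennreal_ofReal
  have hsplit : Measurable fun z : Da ⊕ Db → ℝ ↦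
      ((fun i ↦ z (Sum.inl i), fun j ↦ z (Sum.inr j)) : (Da → ℝ) × (Db → ℝ)) := by fun_prop
  have hmab : Measurable fun z : (Da → ℝ) × (Db → ℝ) ↦
      ENNReal.ofReal (gaussianDensity μa Sa z.1) * ENNReal.ofReal (gaussianDensity μb Sb z.2) :=
    (hma.comp measurable_fst).mul (hmb.comp measurable_snd)
  refine Measure.ext_of_lintegral _ fun F hF ↦ ?_
  have hFs : Measurable fun z : Da ⊕ Db → ℝ ↦ F (fun i ↦ z (Sum.inl i), fun j ↦ z (Sum.inr j)) :=
    hF.comp hsplit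
  rw [lintegral_map hF hsplit, pairLaw, densityLaw,
    lintegral_withDensity_eq_lintegral_mul _ hmj hFs,
    ← hmp.lintegral_comp (hmj.mul hFs)]
  unfold densityLaw
  rw [prod_withDensity hma hmb, lintegral_withDensity_eq_lintegral_mul _ hinfo hF,
    lintegral_withDensity_eq_lintegral_mul _ hmab (hinfo.mul hF)]
  refine lintegral_congr fun z ↦ ?_
  have e : (MeasurableEquiv.sumPiEquivProdPi fun _ : Da ⊕ Db ↦ ℝ).symm z = Sum.elim z.1 z.2 := by
    ext i; cases i <;> rfl
  have h1 := gaussianDensity_pos μa ha z.1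
  have h2 := gaussianDensity_pos μb hb z.2
  have h3 := gaussianDensity_pos (Sum.elim μa μb) h (Sum.elim z.1 z.2)
  simp only [Pi.mul_apply, e, Sum.elim_inl, Sum.elim_inr]
  rw [infoDensity, Real.exp_log (by positivity), ← mul_assoc,
    ← ENNReal.ofReal_mul h1.le, ← ENNReal.ofReal_mul (by positivity)]
  congr 2
  field_simp

variable {U V Ω : Type} [Fintype U] [Fintype V] [MeasurableSpace Ω] {P : Measure Ω} {M : U ↪ V}
  {A : U → Da → Ω → ℝ} {B : V → Db → Ω → ℝ}

/-- Every subvector of the data is Gaussian. -/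
lemma hasGaussianLaw_subvector (h : IsCorrelatedDatabases P M μa μb Sa Sab Sb A B) {ι : Type}
    [Fintype ι] (f : ι → (U × Da) ⊕ (V × Db)) :
    HasGaussianLaw (fun ω i ↦ Sum.elim (fun p : U × Da ↦ A p.1 p.2 ω)
      (fun q : V × Db ↦ B q.1 q.2 ω) (f i)) P :=
  h.gaussian.map_fun (ContinuousLinearMap.pi fun i ↦ ContinuousLinearMap.proj (f i))

/-- By joint Gaussianity each independence claim reduces to vanishing covariances between blocks;
injectivity of `M` makes the second halves of different pairs uncorrelated. -/
lemma isCorrelatedSample_databases (hS : (jointCov Sa Sab Sb).PosDef)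
    (h : IsCorrelatedDatabases P M μa μb Sa Sab Sb A B) :
    IsCorrelatedSample P M (densityLaw μa Sa) (densityLaw μb Sb) (infoDensity μa μb Sa Sab Sb)
      (fun u ω i ↦ A u i ω) (fun v ω j ↦ B v j ω) := by
  classical
  let pairData : U → Da ⊕ Db → Ω → ℝ := fun u ↦ Sum.elim (A u) (B (M u))
  let pairIndex : U → Da ⊕ Db → (U × Da) ⊕ (V × Db) :=
    fun u ↦ Sum.map (fun i ↦ (u, i)) (fun j ↦ (M u, j))
  have hdata : ∀ u k ω, pairData u k ω = Sum.elim (fun p : U × Da ↦ A p.1 p.2 ω)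
      (fun q : V × Db ↦ B q.1 q.2 ω) (pairIndex u k) := fun u k ω ↦ by
    cases k <;> rfl
  have hsplit : Measurable fun z : Da ⊕ Db → ℝ ↦
      ((fun i ↦ z (Sum.inl i), fun j ↦ z (Sum.inr j)) : (Da → ℝ) × (Db → ℝ)) := by fun_prop
  have hcov : ∀ u u' k k', u ≠ u' → cov[pairData u k, pairData u' k'; P] = 0 := by
    intro u u' k k' huu
    cases k with
    | inl i =>
      cases k' with
      | inl i' => simp [pairData, h.cov_A, huu]
      | inr j' => simp [pairData, h.cov_AB, huu]
    | inr j =>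
      cases k' with
      | inl i' => simp [pairData, covariance_comm (B (M u) j), h.cov_AB, huu.symm]
      | inr j' => simp [pairData, h.cov_B, huu]
  refine ⟨?_, fun u ↦ ?_, fun u ↦ ?_, fun v ↦ ?_, fun v j f hf ↦ ?_⟩
  · have hG : HasGaussianLaw (fun ω u k ↦ pairData u k ω) P := by
      simp_rw [hdata]
      exact h.gaussian.map_fun (ContinuousLinearMap.pi fun u ↦ ContinuousLinearMap.pi fun k ↦
        ContinuousLinearMap.proj (pairIndex u k))
    exact (hG.iIndepFun_of_covariance_eval fun u u' huu k k' ↦ hcov u u' k k' huu).comp _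
      fun _ ↦ hsplit
  · have hG : HasGaussianLaw (fun ω k ↦ pairData u k ω) P := by
      simp_rw [hdata]
      exact hasGaussianLaw_subvector h (pairIndex u)
    have hlaw := hasLaw_gaussianDensity hG hS (m := Sum.elim μa μb)
      (fun k ↦ by
        cases k with
        | inl i => exact h.mean_A u i
        | inr j => exact h.mean_B (M u) j)
      (fun k k' ↦ by
        cases k with
        | inl i =>
          cases k' with
          | inl i' => exact (h.cov_A u u i i').trans (if_pos rfl)
          | inr j' => exact (h.cov_AB u (M u) i j').trans (if_pos rfl)
        | inr j =>
          cases k' with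
          | inl i' =>
            change cov[B (M u) j, A u i'; P] = _
            rw [covariance_comm]
            exact (h.cov_AB u (M u) i' j).trans (if_pos rfl)
          | inr j' => exact (h.cov_B (M u) (M u) j j').trans (if_pos rfl))
    have hmap : HasLaw (fun z : Da ⊕ Db → ℝ ↦ (fun i ↦ z (Sum.inl i), fun j ↦ z (Sum.inr j)))
        (pairLaw (densityLaw μa Sa) (densityLaw μb Sb) (infoDensity μa μb Sa Sab Sb))
        (densityLaw (Sum.elim μa μb) (jointCov Sa Sab Sb)) :=
      ⟨hsplit.aemeasurable, map_densityLaw_joint hS⟩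
    exact hmap.comp hlaw
  · exact hasLaw_gaussianDensity (hasGaussianLaw_subvector h fun i : Da ↦ Sum.inl (u, i))
      (posDef_left hS) (fun i ↦ h.mean_A u i) fun i i' ↦ by simpa using h.cov_A u u i i'
  · exact hasLaw_gaussianDensity (hasGaussianLaw_subvector h fun j : Db ↦ Sum.inr (v, j))
      (posDef_right hS) (fun j ↦ h.mean_B v j) fun j j' ↦ by simpa using h.cov_B v v j j'
  · have hG : HasGaussianLaw (fun ω ↦ (fun q : Fin j × (Da ⊕ Db) ↦ pairData (f q.1) q.2 ω,
        fun i ↦ B v i ω)) P := by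
      simp_rw [hdata]
      exact h.gaussian.map_fun ((ContinuousLinearMap.pi fun q : Fin j × (Da ⊕ Db) ↦
        ContinuousLinearMap.proj (pairIndex (f q.1) q.2)).prod
        (ContinuousLinearMap.pi fun i : Db ↦ ContinuousLinearMap.proj (Sum.inr (v, i))))
    have hind := hG.indepFun_of_covariance_eval (X := fun q : Fin j × (Da ⊕ Db) ↦
      pairData (f q.1) q.2) (Y := B v) fun q i ↦ by
      obtain ⟨x, k⟩ := q
      cases k with
      | inl i' => simpa [pairData, hf x] using h.cov_AB (f x) v i' i
      | inr j' => simpa [pairData, hf x] using h.cov_B (M (f x)) v j' i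
    have hm : Measurable fun (z : Fin j × (Da ⊕ Db) → ℝ) (x : Fin j) ↦
        ((fun i ↦ z (x, Sum.inl i), fun i ↦ z (x, Sum.inr i)) : (Da → ℝ) × (Db → ℝ)) := by
      fun_prop
    exact hind.comp hm measurable_id

lemma isProbabilityMeasure_pairLaw (h : (jointCov Sa Sab Sb).PosDef) :
    IsProbabilityMeasure
      (pairLaw (densityLaw μa Sa) (densityLaw μb Sb) (infoDensity μa μb Sa Sab Sb)) := by
  have := isProbabilityMeasure_densityLaw (Sum.elim μa μb) h
  rw [← map_densityLaw_joint h]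
  exact Measure.isProbabilityMeasure_map (by fun_prop)

end Databases

/-! ### The spectrum of the normalized covariance -/

section Spectrum

open Matrix

variable {D : Type} [Fintype D] [DecidableEq D]

/-- The symmetric matrix with eigenvectors the columns of `O` and eigenvalues `g`. -/
def spectralMatrix (O : Matrix D D ℝ) (g : D → ℝ) : Matrix D D ℝ := O * diagonal g * Oᵀ

lemma exists_spectralMatrix {E : Matrix D D ℝ} (hE : E.IsHermitian) :
    ∃ (O : Matrix D D ℝ) (e : D → ℝ), O * Oᵀ = 1 ∧ Oᵀ * O = 1 ∧ E = spectralMatrix O e := by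
  refine ⟨hE.eigenvectorUnitary, hE.eigenvalues, ?_, ?_, ?_⟩
  · simpa [star_eq_conjTranspose] using Unitary.coe_mul_star_self hE.eigenvectorUnitary
  · simpa [star_eq_conjTranspose] using Unitary.coe_star_mul_self hE.eigenvectorUnitary
  · have h := hE.spectral_theorem
    rw [Unitary.conjStarAlgAut_apply] at h
    simpa [spectralMatrix, star_eq_conjTranspose, Function.comp_def] using h

variable {O : Matrix D D ℝ}

lemma spectralMatrix_add (g h : D → ℝ) :
    spectralMatrix O g + spectralMatrix O h = spectralMatrix O (g + h) := by
  simp only [spectralMatrix]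
  rw [← Matrix.add_mul, ← Matrix.mul_add, diagonal_add]
  rfl

lemma smul_spectralMatrix (c : ℝ) (g : D → ℝ) :
    c • spectralMatrix O g = spectralMatrix O (c • g) := by
  simp only [spectralMatrix, diagonal_smul, mul_smul_comm, smul_mul_assoc]

lemma spectralMatrix_one (hO : O * Oᵀ = 1) : spectralMatrix O 1 = 1 := by
  simp [spectralMatrix, hO]

lemma spectralMatrix_mul (hO : Oᵀ * O = 1) (g h : D → ℝ) :
    spectralMatrix O g * spectralMatrix O h = spectralMatrix O (g * h) := by
  have e : O * diagonal g * Oᵀ * (O * diagonal h * Oᵀ) =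
      O * diagonal g * (Oᵀ * O) * diagonal h * Oᵀ := by simp only [Matrix.mul_assoc]
  simp only [spectralMatrix]
  rw [e, hO, Matrix.mul_one, Matrix.mul_assoc O, diagonal_mul_diagonal]
  rfl

lemma det_spectralMatrix (hO : O * Oᵀ = 1) (g : D → ℝ) :
    (spectralMatrix O g).det = ∏ i, g i := by
  have h := congrArg det hO
  rw [det_mul, det_one] at h
  rw [spectralMatrix, det_mul, det_mul, det_diagonal, mul_right_comm, h, one_mul]

lemma inv_spectralMatrix (hO : O * Oᵀ = 1) (hO' : Oᵀ * O = 1) {g : D → ℝ} (hg : ∀ i, g i ≠ 0) :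
    (spectralMatrix O g)⁻¹ = spectralMatrix O g⁻¹ := by
  refine inv_eq_right_inv ?_
  rw [spectralMatrix_mul hO', ← spectralMatrix_one hO]
  congr 1
  ext i
  simp [hg i]

lemma posDef_spectralMatrix_iff (hO : O * Oᵀ = 1) {g : D → ℝ} :
    (spectralMatrix O g).PosDef ↔ ∀ i, 0 < g i := by
  have hu : IsUnit O := (isUnit_iff_isUnit_det O).2 (isUnit_det_of_right_inverse hO)
  have h := IsUnit.posDef_star_right_conjugate_iff (x := diagonal g) hu
  rw [star_eq_conjTranspose, conjTranspose_eq_transpose_of_trivial] at h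
  exact h.trans posDef_diagonal_iff

lemma lintegral_exp_spectralMatrix (hO : O * Oᵀ = 1) {g : D → ℝ} (hg : ∀ i, 0 < 1 + g i) :
    ∫⁻ x, ENNReal.ofReal (Real.exp (-(x ⬝ᵥ spectralMatrix O g *ᵥ x) / 2)) ∂(stdGaussianPi D) =
      ENNReal.ofReal (Real.exp (-(∑ i, Real.log (1 + g i)) / 2)) := by
  have h1 : 1 + spectralMatrix O g = spectralMatrix O (1 + g) := by
    rw [← spectralMatrix_one hO, spectralMatrix_add]
  rw [lintegral_exp_quadratic, h1, det_spectralMatrix hO]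
  · congr 1
    have hpos : ∀ i, 0 < (1 + g) i := hg
    rw [neg_div, Real.exp_neg, Real.sqrt_eq_rpow, Real.rpow_def_of_pos
      (Finset.prod_pos fun i _ ↦ hpos i), Real.log_prod fun i _ ↦ (hpos i).ne']
    simp only [Pi.add_apply, Pi.one_apply]
    ring_nf
  · rw [h1, posDef_spectralMatrix_iff hO]
    exact hg

variable {Da Db : Type} [Fintype Da] [Fintype Db] [DecidableEq Da] [DecidableEq Db]

/-- The off-diagonal part of the normalized covariance matrix. -/
def crossMatrix (C : Matrix Da Db ℝ) : Matrix (Da ⊕ Db) (Da ⊕ Db) ℝ := fromBlocks 0 C Cᵀ 0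

lemma isHermitian_crossMatrix (C : Matrix Da Db ℝ) : (crossMatrix C).IsHermitian := by
  rw [IsHermitian, conjTranspose_eq_transpose_of_trivial, crossMatrix, fromBlocks_transpose]
  simp

/-- The reflection that negates the second block. -/
def blockReflection (Da Db : Type) [DecidableEq Da] [DecidableEq Db] :
    Matrix (Da ⊕ Db) (Da ⊕ Db) ℝ := fromBlocks 1 0 0 (-1)

lemma blockReflection_mul_self : blockReflection Da Db * blockReflection Da Db = 1 := by
  simp [blockReflection, fromBlocks_multiply]

lemma transpose_blockReflection : (blockReflection Da Db)ᵀ = blockReflection Da Db := by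
  simp [blockReflection, fromBlocks_transpose]

lemma blockReflection_conj (C : Matrix Da Db ℝ) :
    blockReflection Da Db * crossMatrix C * blockReflection Da Db = -crossMatrix C := by
  simp [blockReflection, crossMatrix, fromBlocks_multiply, fromBlocks_neg]

lemma blockReflection_conj_one_add (C : Matrix Da Db ℝ) (a : ℝ) :
    blockReflection Da Db * (1 + a • crossMatrix C) * blockReflection Da Db =
      1 - a • crossMatrix C := by
  rw [Matrix.mul_add, Matrix.add_mul, Matrix.mul_one, blockReflection_mul_self, mul_smul_comm,
    smul_mul_assoc, blockReflection_conj, smul_neg, sub_eq_add_neg]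

/-- Negating the second block conjugates `E` to `-E`, so the spectrum is symmetric about zero. This
turns sums over `e` into sums over `e²`. -/
lemma det_one_add_crossMatrix (C : Matrix Da Db ℝ) (a : ℝ) :
    (1 + a • crossMatrix C).det = (1 - a • crossMatrix C).det := by
  have h := congrArg det (blockReflection_mul_self (Da := Da) (Db := Db))
  rw [det_mul, det_one] at h
  rw [← blockReflection_conj_one_add, det_mul, det_mul, mul_right_comm, h, one_mul]

lemma posDef_one_sub_crossMatrix {C : Matrix Da Db ℝ} (h : (1 + crossMatrix C).PosDef) :
    (1 - crossMatrix C).PosDef := by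
  have hu : IsUnit (blockReflection Da Db) := (isUnit_iff_isUnit_det _).2
    (isUnit_det_of_right_inverse blockReflection_mul_self)
  have h2 := (IsUnit.posDef_star_right_conjugate_iff (x := 1 + crossMatrix C) hu).2 h
  rw [star_eq_conjTranspose, conjTranspose_eq_transpose_of_trivial,
    transpose_blockReflection] at h2
  have h3 := blockReflection_conj_one_add C 1
  rw [one_smul] at h3
  rwa [h3] at h2

/-- A diagonalization of the normalized covariance. -/
structure IsCorrelationSpectrum (C : Matrix Da Db ℝ) (O : Matrix (Da ⊕ Db) (Da ⊕ Db) ℝ)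
    (e : Da ⊕ Db → ℝ) : Prop where
  right : O * Oᵀ = 1
  left : Oᵀ * O = 1
  eq : crossMatrix C = spectralMatrix O e
  lower : ∀ i, 0 < 1 + e i
  upper : ∀ i, 0 < 1 - e i

lemma exists_isCorrelationSpectrum {C : Matrix Da Db ℝ} (h : (1 + crossMatrix C).PosDef) :
    ∃ O e, IsCorrelationSpectrum C O e := by
  obtain ⟨O, e, hO, hO', hE⟩ := exists_spectralMatrix (isHermitian_crossMatrix C)
  refine ⟨O, e, hO, hO', hE, fun i ↦ ?_, fun i ↦ ?_⟩
  · rw [hE, ← spectralMatrix_one hO, spectralMatrix_add, posDef_spectralMatrix_iff hO] at h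
    exact h i
  · have h2 := posDef_one_sub_crossMatrix h
    rw [hE, ← spectralMatrix_one hO, sub_eq_add_neg, ← neg_one_smul ℝ, smul_spectralMatrix,
      spectralMatrix_add, posDef_spectralMatrix_iff hO] at h2
    simpa [sub_eq_add_neg] using h2 i

variable {C : Matrix Da Db ℝ} {O : Matrix (Da ⊕ Db) (Da ⊕ Db) ℝ} {e : Da ⊕ Db → ℝ}

lemma IsCorrelationSpectrum.sq_lt_one (h : IsCorrelationSpectrum C O e) (i : Da ⊕ Db) :
    e i ^ 2 < 1 := by nlinarith [h.lower i, h.upper i]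

lemma IsCorrelationSpectrum.one_add_mul_pos (h : IsCorrelationSpectrum C O e) {a : ℝ}
    (ha : |a| ≤ 1) (i : Da ⊕ Db) : 0 < 1 + a * e i := by
  have he : |e i| < 1 := abs_lt.2 ⟨by linarith [h.lower i], by linarith [h.upper i]⟩
  have h1 : |a * e i| < 1 := by
    rw [abs_mul]
    exact (mul_le_of_le_one_left (abs_nonneg _) ha).trans_lt he
  linarith [(abs_lt.1 h1).1]

lemma IsCorrelationSpectrum.inv_one_add (h : IsCorrelationSpectrum C O e) :
    (1 + crossMatrix C)⁻¹ - 1 = spectralMatrix O (fun i ↦ (1 + e i)⁻¹ - 1) := by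
  have h1 : 1 + crossMatrix C = spectralMatrix O (1 + e) := by
    rw [h.eq, ← spectralMatrix_one h.right, spectralMatrix_add]
  rw [h1, inv_spectralMatrix h.right h.left (g := 1 + e) fun i ↦ (h.lower i).ne', sub_eq_add_neg,
    ← neg_one_smul ℝ (1 : Matrix _ _ ℝ), ← spectralMatrix_one h.right, smul_spectralMatrix,
    spectralMatrix_add]
  congr 1
  ext i
  simp [sub_eq_add_neg]

/-- The reflected matrix is `(1 - E)⁻¹ - 1`, which has the same eigenvectors as the original. Hence
the sum of both, which appears in the four-cycle, is diagonalized too. -/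
lemma IsCorrelationSpectrum.inv_one_sub (h : IsCorrelationSpectrum C O e) :
    blockReflection Da Db * ((1 + crossMatrix C)⁻¹ - 1) * blockReflection Da Db =
      spectralMatrix O (fun i ↦ (1 - e i)⁻¹ - 1) := by
  have h1 : 1 - crossMatrix C = spectralMatrix O (1 - e) := by
    rw [h.eq, ← spectralMatrix_one h.right, sub_eq_add_neg, ← neg_one_smul ℝ, smul_spectralMatrix,
      spectralMatrix_add]
    congr 1
    ext i
    simp [sub_eq_add_neg]
  have hJ : (blockReflection Da Db)⁻¹ = blockReflection Da Db :=
    inv_eq_right_inv blockReflection_mul_self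
  have h3 := blockReflection_conj_one_add C 1
  rw [one_smul] at h3
  have h2 : blockReflection Da Db * (1 + crossMatrix C)⁻¹ * blockReflection Da Db =
      (1 - crossMatrix C)⁻¹ := by
    rw [← h3, Matrix.mul_inv_rev, Matrix.mul_inv_rev, hJ, Matrix.mul_assoc]
  rw [Matrix.mul_sub, Matrix.sub_mul, h2, Matrix.mul_one, blockReflection_mul_self, h1,
    inv_spectralMatrix h.right h.left (g := 1 - e) fun i ↦ (h.upper i).ne', sub_eq_add_neg,
    ← neg_one_smul ℝ (1 : Matrix _ _ ℝ), ← spectralMatrix_one h.right, smul_spectralMatrix,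
    spectralMatrix_add]
  congr 1
  ext i
  simp [sub_eq_add_neg]

lemma IsCorrelationSpectrum.det_one_add (h : IsCorrelationSpectrum C O e) (a : ℝ) :
    (1 + a • crossMatrix C).det = ∏ i, (1 + a * e i) := by
  rw [h.eq, smul_spectralMatrix, ← spectralMatrix_one h.right, spectralMatrix_add,
    det_spectralMatrix h.right]
  rfl

/-- The spectrum is symmetric. -/
lemma IsCorrelationSpectrum.sum_log (h : IsCorrelationSpectrum C O e) {a : ℝ} (ha : |a| ≤ 1) :
    ∑ i, Real.log (1 + a * e i) = (∑ i, Real.log (1 - a ^ 2 * e i ^ 2)) / 2 := by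
  have h1 := h.one_add_mul_pos ha
  have h2 : ∀ i, 0 < 1 - a * e i := fun i ↦ by
    have := h.one_add_mul_pos (a := -a) (by rwa [abs_neg]) i
    linarith
  have hsymm : ∑ i, Real.log (1 + a * e i) = ∑ i, Real.log (1 - a * e i) := by
    rw [← Real.log_prod fun i _ ↦ (h1 i).ne', ← Real.log_prod fun i _ ↦ (h2 i).ne',
      ← h.det_one_add, det_one_add_crossMatrix, sub_eq_add_neg, ← neg_smul, h.det_one_add]
    congr 1
    exact Finset.prod_congr rfl fun i _ ↦ by ring
  have hadd : ∑ i, Real.log (1 - a ^ 2 * e i ^ 2) =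
      ∑ i, Real.log (1 + a * e i) + ∑ i, Real.log (1 - a * e i) := by
    rw [← Finset.sum_add_distrib]
    refine Finset.sum_congr rfl fun i _ ↦ ?_
    rw [← Real.log_mul (h1 i).ne' (h2 i).ne']
    congr 1
    ring
  rw [hadd, ← hsymm]
  ring

open scoped Matrix.Norms.L2Operator in
-- For a unit eigenvector with blocks `a` and `b`, `e² = ‖C b‖² + ‖Cᵀ a‖²`, and both terms carry the
-- factor `‖C‖²`.
lemma IsCorrelationSpectrum.sq_le (h : IsCorrelationSpectrum C O e) (i : Da ⊕ Db) :
    e i ^ 2 ≤ ‖C‖ ^ 2 := by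
  have hnorm : ∀ {m n : Type} [Fintype m] [Fintype n] [DecidableEq n] (A : Matrix m n ℝ) (x : n → ℝ),
      (A *ᵥ x) ⬝ᵥ (A *ᵥ x) ≤ ‖A‖ ^ 2 * (x ⬝ᵥ x) := by
    intro m n _ _ _ A x
    have h1 := l2_opNorm_mulVec A (WithLp.toLp 2 x)
    have h2 := pow_le_pow_left₀ (norm_nonneg _) h1 2
    rw [mul_pow, EuclideanSpace.real_norm_sq_eq, EuclideanSpace.real_norm_sq_eq] at h2
    simpa [dotProduct, ← sq] using h2
  let v : Da ⊕ Db → ℝ := O *ᵥ Pi.single i 1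
  have hv1 : v ⬝ᵥ v = 1 := by
    have : v ⬝ᵥ v = Pi.single i 1 ⬝ᵥ ((Oᵀ * O) *ᵥ Pi.single i 1) := by
      rw [← mulVec_mulVec, dotProduct_mulVec (Pi.single i 1) Oᵀ, vecMul_transpose]
    rw [this, h.left]
    simp
  have hev : crossMatrix C *ᵥ v = e i • v := by
    rw [h.eq, spectralMatrix]
    simp only [v]
    rw [mulVec_mulVec, Matrix.mul_assoc, h.left, Matrix.mul_one, ← mulVec_mulVec,
      diagonal_mulVec_single, ← mulVec_smul]
    congr 1
    ext j
    simp [Pi.single_apply]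
  have hs : v = Sum.elim (v ∘ Sum.inl) (v ∘ Sum.inr) := by ext k; cases k <;> rfl
  have hmul : crossMatrix C *ᵥ v = Sum.elim (C *ᵥ (v ∘ Sum.inr)) (Cᵀ *ᵥ (v ∘ Sum.inl)) := by
    rw [crossMatrix, fromBlocks_mulVec]
    simp
  have hT : ‖Cᵀ‖ = ‖C‖ := by
    rw [← conjTranspose_eq_transpose_of_trivial, l2_opNorm_conjTranspose]
  have h1 := hnorm C (v ∘ Sum.inr)
  have h2 := hnorm Cᵀ (v ∘ Sum.inl)
  rw [hT] at h2
  have h3 : (crossMatrix C *ᵥ v) ⬝ᵥ (crossMatrix C *ᵥ v) = e i ^ 2 := by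
    rw [hev, smul_dotProduct, dotProduct_smul, hv1]
    simp [sq]
  have h4 : (v ∘ Sum.inl) ⬝ᵥ (v ∘ Sum.inl) + (v ∘ Sum.inr) ⬝ᵥ (v ∘ Sum.inr) = 1 := by
    rw [← hv1]
    conv_rhs => rw [hs]
    simp [dotProduct, Fintype.sum_sum_type]
  rw [hmul] at h3
  simp only [dotProduct, Fintype.sum_sum_type, Sum.elim_inl, Sum.elim_inr] at h3 h1 h2 h4
  nlinarith

end Spectrum

/-! ### Whitening -/

section Whitening

open Matrix

variable {Da Db : Type} [Fintype Da] [Fintype Db] [DecidableEq Da] [DecidableEq Db]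
  {μa : Da → ℝ} {μb : Db → ℝ} {Sa : Matrix Da Da ℝ} {Sab : Matrix Da Db ℝ} {Sb : Matrix Db Db ℝ}

open scoped MatrixOrder in
lemma transpose_sqrt (S : Matrix Da Da ℝ) : (CFC.sqrt S)ᵀ = CFC.sqrt S := by
  simpa using (Matrix.nonneg_iff_posSemidef.1 (CFC.sqrt_nonneg S)).isHermitian.eq

open scoped MatrixOrder in
/-- The block diagonal matrix of the square roots of the covariances. -/
def blockSqrt (Sa : Matrix Da Da ℝ) (Sb : Matrix Db Db ℝ) : Matrix (Da ⊕ Db) (Da ⊕ Db) ℝ :=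
  fromBlocks (CFC.sqrt Sa) 0 0 (CFC.sqrt Sb)

open scoped MatrixOrder in
lemma det_blockSqrt (Sa : Matrix Da Da ℝ) (Sb : Matrix Db Db ℝ) :
    (blockSqrt Sa Sb).det = (CFC.sqrt Sa).det * (CFC.sqrt Sb).det :=
  det_fromBlocks_zero₂₁ _ _ _

/-- The covariance of the whitened pair. -/
def whitenedCov (Sa : Matrix Da Da ℝ) (Sab : Matrix Da Db ℝ) (Sb : Matrix Db Db ℝ) :
    Matrix (Da ⊕ Db) (Da ⊕ Db) ℝ := 1 + crossMatrix (normalizedCrossCov Sa Sab Sb)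

open scoped MatrixOrder in
lemma blockSqrt_conj (ha : Sa.PosDef) (hb : Sb.PosDef) :
    blockSqrt Sa Sb * whitenedCov Sa Sab Sb * (blockSqrt Sa Sb)ᵀ = jointCov Sa Sab Sb := by
  have hua : IsUnit (CFC.sqrt Sa).det := (det_sqrt_pos ha).ne'.isUnit
  have hub : IsUnit (CFC.sqrt Sb).det := (det_sqrt_pos hb).ne'.isUnit
  have hC : CFC.sqrt Sa * normalizedCrossCov Sa Sab Sb * CFC.sqrt Sb = Sab := by
    rw [normalizedCrossCov, Matrix.mul_assoc, Matrix.mul_assoc _ _ (CFC.sqrt Sb),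
      nonsing_inv_mul _ hub, Matrix.mul_one, ← Matrix.mul_assoc, mul_nonsing_inv _ hua,
      Matrix.one_mul]
  have hCt : CFC.sqrt Sb * (normalizedCrossCov Sa Sab Sb)ᵀ * CFC.sqrt Sa = Sabᵀ := by
    have := congrArg transpose hC
    rwa [transpose_mul, transpose_mul, transpose_sqrt, transpose_sqrt, ← Matrix.mul_assoc] at this
  have h1 := sqrt_mul_transpose_sqrt ha
  have h2 := sqrt_mul_transpose_sqrt hb
  rw [transpose_sqrt] at h1 h2
  rw [whitenedCov, crossMatrix, ← fromBlocks_one, fromBlocks_add, blockSqrt, fromBlocks_transpose,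
    fromBlocks_multiply, fromBlocks_multiply, jointCov]
  simp [transpose_sqrt, hC, hCt, h1, h2]

lemma det_blockSqrt_pos (ha : Sa.PosDef) (hb : Sb.PosDef) : 0 < (blockSqrt Sa Sb).det := by
  rw [det_blockSqrt]
  exact mul_pos (det_sqrt_pos ha) (det_sqrt_pos hb)

lemma posDef_whitenedCov (h : (jointCov Sa Sab Sb).PosDef) : (whitenedCov Sa Sab Sb).PosDef := by
  have ha := posDef_left h
  have hb := posDef_right h
  have hu : IsUnit (blockSqrt Sa Sb) := (isUnit_iff_isUnit_det _).2
    (det_blockSqrt_pos ha hb).ne'.isUnit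
  refine (IsUnit.posDef_star_right_conjugate_iff hu).1 ?_
  rwa [star_eq_conjTranspose, conjTranspose_eq_transpose_of_trivial, blockSqrt_conj ha hb]

open scoped MatrixOrder in
-- The Jacobians of the two marginal whitenings cancel in the density ratio, leaving `N(0, R)`
-- against the standard law, with `R` the covariance of the whitened pair.
lemma infoDensity_whitened (h : (jointCov Sa Sab Sb).PosDef) (z : Da ⊕ Db → ℝ) :
    infoDensity μa μb Sa Sab Sb (μa + CFC.sqrt Sa *ᵥ (z ∘ Sum.inl))
        (μb + CFC.sqrt Sb *ᵥ (z ∘ Sum.inr)) =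
      -Real.log (whitenedCov Sa Sab Sb).det / 2 -
        z ⬝ᵥ ((whitenedCov Sa Sab Sb)⁻¹ - 1) *ᵥ z / 2 := by
  have ha := posDef_left h
  have hb := posDef_right h
  have hda := det_sqrt_pos ha
  have hdb := det_sqrt_pos hb
  have hd := (posDef_whitenedCov h).det_pos
  have e : Sum.elim (μa + CFC.sqrt Sa *ᵥ (z ∘ Sum.inl)) (μb + CFC.sqrt Sb *ᵥ (z ∘ Sum.inr)) =
      Sum.elim μa μb + blockSqrt Sa Sb *ᵥ z := by
    rw [blockSqrt, fromBlocks_mulVec]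
    ext i
    cases i <;> simp
  have h1 := gaussianDensity_affine μa (R := 1) (S := Sa) hda.ne'
    (by rw [Matrix.mul_one, sqrt_mul_transpose_sqrt ha]) (z ∘ Sum.inl)
  have h2 := gaussianDensity_affine μb (R := 1) (S := Sb) hdb.ne'
    (by rw [Matrix.mul_one, sqrt_mul_transpose_sqrt hb]) (z ∘ Sum.inr)
  have h3 := gaussianDensity_affine (Sum.elim μa μb) (det_blockSqrt_pos ha hb).ne'
    (blockSqrt_conj (Sab := Sab) ha hb) z
  rw [det_blockSqrt, abs_mul] at h3
  rw [abs_of_pos hda] at h1 h3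
  rw [abs_of_pos hdb] at h2 h3
  have hlog : infoDensity μa μb Sa Sab Sb (μa + CFC.sqrt Sa *ᵥ (z ∘ Sum.inl))
        (μb + CFC.sqrt Sb *ᵥ (z ∘ Sum.inr)) = Real.log (gaussianDensity 0 (whitenedCov Sa Sab Sb) z /
        (gaussianDensity 0 1 (z ∘ Sum.inl) * gaussianDensity 0 1 (z ∘ Sum.inr))) := by
    rw [infoDensity, e, ← h1, ← h2, ← h3]
    congr 1
    have p1 := gaussianDensity_pos μa ha (μa + CFC.sqrt Sa *ᵥ (z ∘ Sum.inl))
    have p2 := gaussianDensity_pos μb hb (μb + CFC.sqrt Sb *ᵥ (z ∘ Sum.inr))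
    field_simp
  have hzz : z ⬝ᵥ z = (z ∘ Sum.inl) ⬝ᵥ (z ∘ Sum.inl) + (z ∘ Sum.inr) ⬝ᵥ (z ∘ Sum.inr) := by
    simp [dotProduct, Fintype.sum_sum_type]
  have hratio : gaussianDensity 0 (whitenedCov Sa Sab Sb) z /
        (gaussianDensity 0 1 (z ∘ Sum.inl) * gaussianDensity 0 1 (z ∘ Sum.inr)) =
      (Real.sqrt (whitenedCov Sa Sab Sb).det)⁻¹ *
        Real.exp (-(z ⬝ᵥ ((whitenedCov Sa Sab Sb)⁻¹ - 1) *ᵥ z / 2)) := by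
    simp only [gaussianDensity, sub_zero, inv_one, one_mulVec, det_one, mul_one, sub_mulVec,
      dotProduct_sub, hzz, Fintype.card_sum]
    rw [Real.sqrt_mul (by positivity), pow_add, Real.sqrt_mul (by positivity)]
    have hexp : -(z ⬝ᵥ (whitenedCov Sa Sab Sb)⁻¹ *ᵥ z) / 2 =
        -((z ⬝ᵥ (whitenedCov Sa Sab Sb)⁻¹ *ᵥ z - ((z ∘ Sum.inl) ⬝ᵥ (z ∘ Sum.inl) +
          (z ∘ Sum.inr) ⬝ᵥ (z ∘ Sum.inr))) / 2) + (-((z ∘ Sum.inl) ⬝ᵥ (z ∘ Sum.inl)) / 2 +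
          -((z ∘ Sum.inr) ⬝ᵥ (z ∘ Sum.inr)) / 2) := by ring
    rw [hexp, Real.exp_add, Real.exp_add]
    have := Real.sqrt_pos.2 hd
    field_simp
  rw [hlog, hratio, Real.log_mul (by positivity) (Real.exp_pos _).ne', Real.log_exp, Real.log_inv,
    Real.log_sqrt hd.le]
  ring

lemma integrable_quadratic {D : Type} [Fintype D] (B : Matrix D D ℝ) :
    Integrable (fun x : D → ℝ ↦ x ⬝ᵥ B *ᵥ x) (stdGaussianPi D) := by
  have hmem : ∀ i, MemLp (fun x : D → ℝ ↦ x i) 2 (stdGaussianPi D) := fun i ↦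
    (memLp_id_gaussianReal 2).comp_measurePreserving
      (measurePreserving_eval (fun _ : D ↦ gaussianReal 0 1) i)
  simp only [dotProduct, mulVec, Finset.mul_sum]
  refine integrable_finsetSum _ fun i _ ↦ integrable_finsetSum _ fun j _ ↦ ?_
  exact (hmem i).integrable_mul ((hmem j).const_mul (B i j))

/-- The reflection of the second block preserves the standard law and changes the sign of the form.
-/
lemma integral_crossMatrix (C : Matrix Da Db ℝ) :
    ∫ x, x ⬝ᵥ crossMatrix C *ᵥ x ∂(stdGaussianPi (Da ⊕ Db)) = 0 := by
  have horth : blockReflection Da Db * (blockReflection Da Db)ᵀ = 1 := by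
    rw [transpose_blockReflection, blockReflection_mul_self]
  have h : ∫ x, x ⬝ᵥ crossMatrix C *ᵥ x ∂(stdGaussianPi (Da ⊕ Db)) =
      -∫ x, x ⬝ᵥ crossMatrix C *ᵥ x ∂(stdGaussianPi (Da ⊕ Db)) := by
    conv_lhs => rw [← map_orthogonal_stdGaussianPi horth]
    rw [integral_map (measurable_mulVec _).aemeasurable
      (measurable_quadratic _).aestronglyMeasurable, ← integral_neg]
    refine integral_congr_ae (ae_of_all _ fun x ↦ ?_)
    have e : (blockReflection Da Db *ᵥ x) ⬝ᵥ crossMatrix C *ᵥ (blockReflection Da Db *ᵥ x) =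
        x ⬝ᵥ (blockReflection Da Db * crossMatrix C * blockReflection Da Db) *ᵥ x := by
      conv_rhs => rw [Matrix.mul_assoc, ← mulVec_mulVec, dotProduct_mulVec,
        ← mulVec_transpose, transpose_blockReflection, ← mulVec_mulVec]
    simp only
    rw [e, blockReflection_conj, neg_mulVec, dotProduct_neg]
  linarith

/-- A square root of the joint covariance. -/
def jointRoot (Sa : Matrix Da Da ℝ) (Sab : Matrix Da Db ℝ) (Sb : Matrix Db Db ℝ) :
    Matrix (Da ⊕ Db) (Da ⊕ Db) ℝ :=
  blockSqrt Sa Sb * (open scoped MatrixOrder in CFC.sqrt (whitenedCov Sa Sab Sb))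

lemma jointRoot_mul_transpose (h : (jointCov Sa Sab Sb).PosDef) :
    jointRoot Sa Sab Sb * (jointRoot Sa Sab Sb)ᵀ = jointCov Sa Sab Sb := by
  rw [jointRoot, transpose_mul, Matrix.mul_assoc, ← Matrix.mul_assoc _ _ (blockSqrt Sa Sb)ᵀ,
    sqrt_mul_transpose_sqrt (posDef_whitenedCov h), ← Matrix.mul_assoc,
    blockSqrt_conj (posDef_left h) (posDef_right h)]

lemma det_jointRoot_ne_zero (h : (jointCov Sa Sab Sb).PosDef) : (jointRoot Sa Sab Sb).det ≠ 0 := by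
  rw [jointRoot, det_mul]
  exact (mul_pos (det_blockSqrt_pos (posDef_left h) (posDef_right h))
    (det_sqrt_pos (posDef_whitenedCov h))).ne'

open scoped MatrixOrder in
lemma sqrt_conj_inv_sub_one {D : Type} [Fintype D] [DecidableEq D] {R : Matrix D D ℝ}
    (hR : R.PosDef) : CFC.sqrt R * (R⁻¹ - 1) * CFC.sqrt R = 1 - R := by
  have hs := sqrt_mul_transpose_sqrt hR
  rw [transpose_sqrt] at hs
  have hu : IsUnit (CFC.sqrt R).det := (det_sqrt_pos hR).ne'.isUnit
  have hinv : R⁻¹ = (CFC.sqrt R)⁻¹ * (CFC.sqrt R)⁻¹ := by rw [← Matrix.mul_inv_rev, hs]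
  have h1 : CFC.sqrt R * R⁻¹ * CFC.sqrt R = 1 := by
    rw [hinv, ← Matrix.mul_assoc, mul_nonsing_inv _ hu, Matrix.one_mul, nonsing_inv_mul _ hu]
  rw [Matrix.mul_sub, Matrix.sub_mul, h1, Matrix.mul_one, hs]

open scoped MatrixOrder in
-- In coordinates that are standard under the joint law, the form `R⁻¹ - 1` becomes `1 - R = -E`,
-- whose mean vanishes. This evaluates the mutual information.
lemma infoDensity_jointRoot (h : (jointCov Sa Sab Sb).PosDef) (x : Da ⊕ Db → ℝ) :
    infoDensity μa μb Sa Sab Sb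
      (fun i ↦ (Sum.elim μa μb + jointRoot Sa Sab Sb *ᵥ x) (Sum.inl i))
      (fun j ↦ (Sum.elim μa μb + jointRoot Sa Sab Sb *ᵥ x) (Sum.inr j)) =
      -Real.log (whitenedCov Sa Sab Sb).det / 2 +
        x ⬝ᵥ crossMatrix (normalizedCrossCov Sa Sab Sb) *ᵥ x / 2 := by
  have hR := posDef_whitenedCov h
  have e := infoDensity_whitened (μa := μa) (μb := μb) h (CFC.sqrt (whitenedCov Sa Sab Sb) *ᵥ x)
  have e1 : (fun i ↦ (Sum.elim μa μb + jointRoot Sa Sab Sb *ᵥ x) (Sum.inl i)) =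
      μa + CFC.sqrt Sa *ᵥ ((CFC.sqrt (whitenedCov Sa Sab Sb) *ᵥ x) ∘ Sum.inl) := by
    ext i
    rw [jointRoot, ← mulVec_mulVec, blockSqrt, fromBlocks_mulVec]
    simp
  have e2 : (fun j ↦ (Sum.elim μa μb + jointRoot Sa Sab Sb *ᵥ x) (Sum.inr j)) =
      μb + CFC.sqrt Sb *ᵥ ((CFC.sqrt (whitenedCov Sa Sab Sb) *ᵥ x) ∘ Sum.inr) := by
    ext i
    rw [jointRoot, ← mulVec_mulVec, blockSqrt, fromBlocks_mulVec]
    simp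
  have hquad : (CFC.sqrt (whitenedCov Sa Sab Sb) *ᵥ x) ⬝ᵥ ((whitenedCov Sa Sab Sb)⁻¹ - 1) *ᵥ
      (CFC.sqrt (whitenedCov Sa Sab Sb) *ᵥ x) =
      x ⬝ᵥ (1 - whitenedCov Sa Sab Sb) *ᵥ x := by
    rw [← sqrt_conj_inv_sub_one hR, Matrix.mul_assoc, ← mulVec_mulVec, dotProduct_mulVec x,
      ← mulVec_transpose, transpose_sqrt, ← mulVec_mulVec]
  rw [e1, e2, e, hquad, whitenedCov, sub_add_cancel_left, neg_mulVec, dotProduct_neg]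
  ring

lemma mutualInfo_eq_integral (h : (jointCov Sa Sab Sb).PosDef) :
    mutualInfo μa μb Sa Sab Sb = ∫ z, infoDensity μa μb Sa Sab Sb (fun i ↦ z (Sum.inl i))
      (fun j ↦ z (Sum.inr j)) ∂(densityLaw (Sum.elim μa μb) (jointCov Sa Sab Sb)) := by
  have h2 := integral_withDensity_eq_integral_toReal_smul (μ := volume)
    (measurable_gaussianDensity (Sum.elim μa μb) (jointCov Sa Sab Sb)).ennreal_ofReal
    (ae_of_all _ fun _ ↦ ENNReal.ofReal_lt_top) fun z : Da ⊕ Db → ℝ ↦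
      infoDensity μa μb Sa Sab Sb (fun i ↦ z (Sum.inl i)) (fun j ↦ z (Sum.inr j))
  refine Eq.trans ?_ h2.symm
  unfold mutualInfo
  congr 1
  ext z
  rw [ENNReal.toReal_ofReal (gaussianDensity_pos _ h z).le, smul_eq_mul]

lemma mutualInfo_eq (h : (jointCov Sa Sab Sb).PosDef) :
    mutualInfo μa μb Sa Sab Sb = -Real.log (whitenedCov Sa Sab Sb).det / 2 := by
  have hlaw : (stdGaussianPi (Da ⊕ Db)).map (fun x ↦ Sum.elim μa μb + jointRoot Sa Sab Sb *ᵥ x) =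
      densityLaw (Sum.elim μa μb) (jointCov Sa Sab Sb) :=
    map_affine_stdGaussianPi _ (det_jointRoot_ne_zero h) (jointRoot_mul_transpose h)
  have hsplit : Measurable fun z : Da ⊕ Db → ℝ ↦
      ((fun i ↦ z (Sum.inl i), fun j ↦ z (Sum.inr j)) : (Da → ℝ) × (Db → ℝ)) := by fun_prop
  have hmeas := (measurable_infoDensity (μa := μa) (μb := μb) (Sa := Sa) (Sab := Sab)
    (Sb := Sb)).comp hsplit
  have hmap : Measurable fun x : Da ⊕ Db → ℝ ↦ Sum.elim μa μb + jointRoot Sa Sab Sb *ᵥ x :=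
    (measurable_mulVec _).const_add _
  rw [mutualInfo_eq_integral h, ← hlaw]
  refine (integral_map hmap.aemeasurable hmeas.aestronglyMeasurable).trans ?_
  refine (integral_congr_ae (ae_of_all _ (infoDensity_jointRoot h))).trans ?_
  rw [integral_add (integrable_const _) ((integrable_quadratic _).div_const 2),
    integral_const, integral_div, integral_crossMatrix]
  simp

end Whitening

/-! ### Moments of the likelihood ratio of a Gaussian pair -/

section Moments

open Matrix

variable {Da Db : Type} [Fintype Da] [Fintype Db] [DecidableEq Da] [DecidableEq Db]

lemma lintegral_stdGaussianPi_prod {α β : Type} [Fintype α] [Fintype β]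
    {F : (α → ℝ) × (β → ℝ) → ℝ≥0∞} (hF : Measurable F) :
    ∫⁻ z, F z ∂((stdGaussianPi α).prod (stdGaussianPi β)) =
      ∫⁻ z, F (z ∘ Sum.inl, z ∘ Sum.inr) ∂(stdGaussianPi (α ⊕ β)) :=
  ((measurePreserving_sumPiEquivProdPi fun _ : α ⊕ β ↦ gaussianReal 0 1).lintegral_comp hF).symm

/-- Rotation by an eighth of a turn. -/
lemma lintegral_rotation {D : Type} [Fintype D] [DecidableEq D] {s : ℝ} (hs : s ^ 2 = 1 / 2)
    {F : (D → ℝ) × (D → ℝ) → ℝ≥0∞} (hF : Measurable F) :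
    ∫⁻ z, F (s • (z.1 + z.2), s • (z.2 - z.1)) ∂((stdGaussianPi D).prod (stdGaussianPi D)) =
      ∫⁻ z, F z ∂((stdGaussianPi D).prod (stdGaussianPi D)) := by
  have hrot : Measurable fun z : (D → ℝ) × (D → ℝ) ↦ (s • (z.1 + z.2), s • (z.2 - z.1)) := by
    fun_prop
  let A : Matrix (D ⊕ D) (D ⊕ D) ℝ := fromBlocks (s • 1) (s • 1) (-(s • 1)) (s • 1)
  have hA : A * Aᵀ = 1 := by
    have h2 : s * s + s * s = 1 := by linarith [sq s]
    simp only [A, fromBlocks_transpose, fromBlocks_multiply, transpose_smul, transpose_one,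
      transpose_neg, smul_mul_assoc, mul_smul_comm, Matrix.mul_neg, Matrix.neg_mul, Matrix.one_mul,
      smul_smul, neg_neg, ← add_smul, h2, one_smul, smul_neg, neg_add_cancel,
      fromBlocks_one]
  have hsplit : Measurable fun z : D ⊕ D → ℝ ↦ F (z ∘ Sum.inl, z ∘ Sum.inr) :=
    hF.comp (by fun_prop : Measurable fun z : D ⊕ D → ℝ ↦ (z ∘ Sum.inl, z ∘ Sum.inr))
  rw [lintegral_stdGaussianPi_prod hF]
  refine (lintegral_stdGaussianPi_prod (hF.comp hrot)).trans ?_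
  conv_rhs => rw [← map_orthogonal_stdGaussianPi hA]
  rw [lintegral_map hsplit (measurable_mulVec A)]
  refine lintegral_congr fun z ↦ ?_
  have e : A *ᵥ z = Sum.elim (s • (z ∘ Sum.inl + z ∘ Sum.inr)) (s • (z ∘ Sum.inr - z ∘ Sum.inl)) := by
    rw [fromBlocks_mulVec]
    congr 1
    · ext i; simp [smul_mulVec, mul_add]
    · ext i; simp [smul_mulVec, neg_mulVec, mul_sub]; ring
  simp only [e, Function.comp_apply]
  rfl

lemma cycleWeight_map {X Y X' Y' : Type} [MeasurableSpace X] [MeasurableSpace Y]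
    [MeasurableSpace X'] [MeasurableSpace Y'] {k : X → Y → ℝ≥0∞}
    (hk : Measurable (Function.uncurry k)) {f : X' → X} {g : Y' → Y} (hf : Measurable f)
    (hg : Measurable g) (νX : Measure X') (νY : Measure Y') [SFinite νX] [SFinite νY] :
    cycleWeight k (νX.map f) (νY.map g) = cycleWeight (fun x y ↦ k (f x) (g y)) νX νY := by
  have hgram : ∀ x x', gramKernel k (νY.map g) x x' = ∫⁻ y, k x (g y) * k x' (g y) ∂νY :=
    fun x x' ↦ lintegral_map ((hk.comp measurable_prodMk_left).mul
      (hk.comp measurable_prodMk_left)) hg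
  have hm : Measurable fun z : X × X ↦ gramKernel k (νY.map g) z.1 z.2 ^ 2 :=
    (measurable_gramKernel hk).pow_const 2
  unfold cycleWeight
  rw [lintegral_map hm.lintegral_prod_right' hf]
  refine lintegral_congr fun x ↦ ?_
  refine (lintegral_map (hm.comp (measurable_prodMk_left (x := f x))) hf).trans ?_
  refine lintegral_congr fun x' ↦ ?_
  simp only [Function.comp_apply]
  rw [hgram]
  rfl

/-- A quadratic form in two blocks. -/
def blockQuadratic (B : Matrix (Da ⊕ Db) (Da ⊕ Db) ℝ) (x : Da → ℝ) (y : Db → ℝ) : ℝ :=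
  Sum.elim x y ⬝ᵥ B *ᵥ Sum.elim x y

lemma measurable_blockQuadratic (B : Matrix (Da ⊕ Db) (Da ⊕ Db) ℝ) :
    Measurable fun z : (Da → ℝ) × (Db → ℝ) ↦ blockQuadratic B z.1 z.2 :=
  (measurable_quadratic B).comp measurable_sumElim

lemma blockQuadratic_neg (B : Matrix (Da ⊕ Db) (Da ⊕ Db) ℝ) (x : Da → ℝ) (y : Db → ℝ) :
    blockQuadratic B x (-y) =
      blockQuadratic (blockReflection Da Db * B * blockReflection Da Db) x y := by
  have e : Sum.elim x (-y) = blockReflection Da Db *ᵥ Sum.elim x y := by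
    rw [blockReflection, fromBlocks_mulVec]
    ext i
    cases i <;> simp [neg_mulVec]
  rw [blockQuadratic, e, blockQuadratic, Matrix.mul_assoc, ← mulVec_mulVec,
    dotProduct_mulVec (Sum.elim x y), ← mulVec_transpose, transpose_blockReflection,
    ← mulVec_mulVec]

lemma blockQuadratic_add (B B' : Matrix (Da ⊕ Db) (Da ⊕ Db) ℝ) (x : Da → ℝ) (y : Db → ℝ) :
    blockQuadratic (B + B') x y = blockQuadratic B x y + blockQuadratic B' x y := by
  simp [blockQuadratic, add_mulVec, dotProduct_add]

lemma blockQuadratic_smul (c : ℝ) (B : Matrix (Da ⊕ Db) (Da ⊕ Db) ℝ) (x : Da → ℝ) (y : Db → ℝ) :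
    blockQuadratic (c • B) x y = c * blockQuadratic B x y := by
  simp [blockQuadratic, smul_mulVec, dotProduct_smul]

/-- The sum of a quadratic form over the edges of a four-cycle, in rotated coordinates. -/
lemma blockQuadratic_cycle (B : Matrix (Da ⊕ Db) (Da ⊕ Db) ℝ) {s : ℝ} (hs : s ^ 2 = 1 / 2)
    (x x' : Da → ℝ) (y y' : Db → ℝ) :
    blockQuadratic B x y + blockQuadratic B x' y + blockQuadratic B x y' + blockQuadratic B x' y' =
      2 * blockQuadratic B (s • (x + x')) (s • (y + y')) +
        (blockQuadratic B (s • (x' - x)) (s • (y' - y)) +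
          blockQuadratic B (s • (x' - x)) (-(s • (y' - y)))) := by
  let a : Da ⊕ Db → ℝ := Sum.elim x 0
  let a' : Da ⊕ Db → ℝ := Sum.elim x' 0
  let d : Da ⊕ Db → ℝ := Sum.elim 0 y
  let d' : Da ⊕ Db → ℝ := Sum.elim 0 y'
  have e1 : Sum.elim x y = a + d := by ext i; cases i <;> simp [a, d]
  have e2 : Sum.elim x' y = a' + d := by ext i; cases i <;> simp [a', d]
  have e3 : Sum.elim x y' = a + d' := by ext i; cases i <;> simp [a, d']
  have e4 : Sum.elim x' y' = a' + d' := by ext i; cases i <;> simp [a', d']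
  have e5 : Sum.elim (s • (x + x')) (s • (y + y')) = s • (a + a' + d + d') := by
    ext i; cases i <;> simp [a, a', d, d', mul_add]
  have e6 : Sum.elim (s • (x' - x)) (s • (y' - y)) = s • (a' - a + d' - d) := by
    ext i; cases i <;> simp [a, a', d, d']
  have e7 : Sum.elim (s • (x' - x)) (-(s • (y' - y))) = s • (a' - a - d' + d) := by
    ext i
    cases i
    · simp [a, a', d, d']
    · simp [a, a', d, d']; ring
  simp only [blockQuadratic, e1, e2, e3, e4, e5, e6, e7, mulVec_add, mulVec_sub, mulVec_smul,
    dotProduct_add, add_dotProduct, dotProduct_sub, sub_dotProduct, smul_dotProduct,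
    dotProduct_smul, smul_eq_mul]
  -- As `B` is not assumed symmetric, all sixteen values of the bilinear form are separate unknowns;
  -- the identity is linear in them and needs only `s ^ 2 = 1 / 2`.
  generalize a ⬝ᵥ B *ᵥ a = t1
  generalize a ⬝ᵥ B *ᵥ a' = t2
  generalize a ⬝ᵥ B *ᵥ d = t3
  generalize a ⬝ᵥ B *ᵥ d' = t4
  generalize a' ⬝ᵥ B *ᵥ a = t5
  generalize a' ⬝ᵥ B *ᵥ a' = t6
  generalize a' ⬝ᵥ B *ᵥ d = t7
  generalize a' ⬝ᵥ B *ᵥ d' = t8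
  generalize d ⬝ᵥ B *ᵥ a = t9
  generalize d ⬝ᵥ B *ᵥ a' = t10
  generalize d ⬝ᵥ B *ᵥ d = t11
  generalize d ⬝ᵥ B *ᵥ d' = t12
  generalize d' ⬝ᵥ B *ᵥ a = t13
  generalize d' ⬝ᵥ B *ᵥ a' = t14
  generalize d' ⬝ᵥ B *ᵥ d = t15
  generalize d' ⬝ᵥ B *ᵥ d' = t16
  linear_combination (-2 * (t1 + t2 + t3 + t4 + t5 + t6 + t7 + t8 + t9 + t10 + t11 + t12 + t13 +
    t14 + t15 + t16) - 2 * (t1 - t2 - t5 + t6 + t11 - t12 - t15 + t16)) * hs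

lemma measurable_exp_blockQuadratic (B : Matrix (Da ⊕ Db) (Da ⊕ Db) ℝ) :
    Measurable fun z : (Da → ℝ) × (Db → ℝ) ↦
      ENNReal.ofReal (Real.exp (-blockQuadratic B z.1 z.2 / 2)) :=
  (Real.measurable_exp.comp ((measurable_blockQuadratic B).neg.div_const 2)).ennreal_ofReal

lemma lintegral_blockQuadratic (B : Matrix (Da ⊕ Db) (Da ⊕ Db) ℝ) :
    ∫⁻ z, ENNReal.ofReal (Real.exp (-blockQuadratic B z.1 z.2 / 2))
        ∂((stdGaussianPi Da).prod (stdGaussianPi Db)) =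
      ∫⁻ z, ENNReal.ofReal (Real.exp (-(z ⬝ᵥ B *ᵥ z) / 2)) ∂(stdGaussianPi (Da ⊕ Db)) := by
  rw [lintegral_stdGaussianPi_prod (measurable_exp_blockQuadratic B)]
  refine lintegral_congr fun z ↦ ?_
  have e : Sum.elim (z ∘ Sum.inl) (z ∘ Sum.inr) = z := by ext i; cases i <;> rfl
  simp only [blockQuadratic, e]

/-- Normalized sums and differences of independent standard vectors are again independent and
standard, so the integral factors. -/
lemma lintegral_rotated_mul {F G : (Da → ℝ) → (Db → ℝ) → ℝ≥0∞}
    (hF : Measurable (Function.uncurry F)) (hG : Measurable (Function.uncurry G)) {s : ℝ}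
    (hs : s ^ 2 = 1 / 2) :
    ∫⁻ z : (Da → ℝ) × (Da → ℝ), ∫⁻ w : (Db → ℝ) × (Db → ℝ),
        F (s • (z.1 + z.2)) (s • (w.1 + w.2)) * G (s • (z.2 - z.1)) (s • (w.2 - w.1))
        ∂((stdGaussianPi Db).prod (stdGaussianPi Db)) ∂((stdGaussianPi Da).prod (stdGaussianPi Da)) =
      (∫⁻ z, F z.1 z.2 ∂((stdGaussianPi Da).prod (stdGaussianPi Db))) *
        ∫⁻ z, G z.1 z.2 ∂((stdGaussianPi Da).prod (stdGaussianPi Db)) := by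
  have hFx : ∀ x, Measurable (F x) := fun x ↦ hF.comp measurable_prodMk_left
  have hGx : ∀ x, Measurable (G x) := fun x ↦ hG.comp measurable_prodMk_left
  have hFi : Measurable fun x ↦ ∫⁻ y, F x y ∂(stdGaussianPi Db) := hF.lintegral_prod_right'
  have hGi : Measurable fun x ↦ ∫⁻ y, G x y ∂(stdGaussianPi Db) := hG.lintegral_prod_right'
  have hinner : ∀ z : (Da → ℝ) × (Da → ℝ), ∫⁻ w : (Db → ℝ) × (Db → ℝ),
      F (s • (z.1 + z.2)) (s • (w.1 + w.2)) * G (s • (z.2 - z.1)) (s • (w.2 - w.1))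
        ∂((stdGaussianPi Db).prod (stdGaussianPi Db)) =
      (∫⁻ y, F (s • (z.1 + z.2)) y ∂(stdGaussianPi Db)) *
        ∫⁻ y, G (s • (z.2 - z.1)) y ∂(stdGaussianPi Db) := fun z ↦
    (lintegral_rotation hs (F := fun w : (Db → ℝ) × (Db → ℝ) ↦
      F (s • (z.1 + z.2)) w.1 * G (s • (z.2 - z.1)) w.2)
      (((hFx _).comp measurable_fst).mul ((hGx _).comp measurable_snd))).trans
      (lintegral_prod_mul (hFx _).aemeasurable (hGx _).aemeasurable)
  simp_rw [hinner]
  rw [lintegral_rotation hs (F := fun z : (Da → ℝ) × (Da → ℝ) ↦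
      (∫⁻ y, F z.1 y ∂(stdGaussianPi Db)) * ∫⁻ y, G z.2 y ∂(stdGaussianPi Db))
      ((hFi.comp measurable_fst).mul (hGi.comp measurable_snd)),
    lintegral_prod_mul hFi.aemeasurable hGi.aemeasurable]
  congr 1
  · exact (lintegral_prod _ hF.aemeasurable).symm
  · exact (lintegral_prod _ hG.aemeasurable).symm

/-- The four-cycle integral of a Gaussian kernel. -/
lemma cycleWeight_gaussian (B : Matrix (Da ⊕ Db) (Da ⊕ Db) ℝ) (p c : ℝ) :
    cycleWeight (fun x y ↦ ENNReal.ofReal (Real.exp (p * (c - blockQuadratic B x y / 2))))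
        (stdGaussianPi Da) (stdGaussianPi Db) =
      ENNReal.ofReal (Real.exp (4 * p * c)) *
        ((∫⁻ z, ENNReal.ofReal (Real.exp (-(z ⬝ᵥ ((2 * p) • B) *ᵥ z) / 2))
          ∂(stdGaussianPi (Da ⊕ Db))) *
        ∫⁻ z, ENNReal.ofReal (Real.exp (-(z ⬝ᵥ (p • (B + blockReflection Da Db * B *
          blockReflection Da Db)) *ᵥ z) / 2)) ∂(stdGaussianPi (Da ⊕ Db))) := by
  obtain ⟨s, hs⟩ : ∃ s : ℝ, s ^ 2 = 1 / 2 := ⟨Real.sqrt (1 / 2), Real.sq_sqrt (by norm_num)⟩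
  have hk : Measurable (Function.uncurry fun (x : Da → ℝ) (y : Db → ℝ) ↦
      ENNReal.ofReal (Real.exp (p * (c - blockQuadratic B x y / 2)))) :=
    (Real.measurable_exp.comp ((((measurable_blockQuadratic B).div_const 2).const_sub
      c).const_mul p)).ennreal_ofReal
  have hpt : ∀ (z : (Da → ℝ) × (Da → ℝ)) (w : (Db → ℝ) × (Db → ℝ)),
      (ENNReal.ofReal (Real.exp (p * (c - blockQuadratic B z.1 w.1 / 2))) *
        ENNReal.ofReal (Real.exp (p * (c - blockQuadratic B z.2 w.1 / 2)))) *
      (ENNReal.ofReal (Real.exp (p * (c - blockQuadratic B z.1 w.2 / 2))) *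
        ENNReal.ofReal (Real.exp (p * (c - blockQuadratic B z.2 w.2 / 2)))) =
      ENNReal.ofReal (Real.exp (4 * p * c)) *
        (ENNReal.ofReal (Real.exp (-blockQuadratic ((2 * p) • B)
            (s • (z.1 + z.2)) (s • (w.1 + w.2)) / 2)) *
          ENNReal.ofReal (Real.exp (-blockQuadratic (p • (B + blockReflection Da Db * B *
            blockReflection Da Db)) (s • (z.2 - z.1)) (s • (w.2 - w.1)) / 2))) := fun z w ↦ by
    -- The difference coordinates enter once with each sign of `y`, which turns their form into `B`
    -- plus its reflection.
    have h4 := blockQuadratic_cycle B hs z.1 z.2 w.1 w.2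
    rw [blockQuadratic_neg, ← blockQuadratic_add] at h4
    simp only [blockQuadratic_smul]
    simp_rw [← ENNReal.ofReal_mul (Real.exp_pos _).le, ← Real.exp_add,
      ← ENNReal.ofReal_mul (Real.exp_pos _).le, ← Real.exp_add]
    congr 2
    linear_combination (-p / 2) * h4
  rw [cycleWeight_eq hk]
  simp_rw [hpt, lintegral_const_mul' _ _ ENNReal.ofReal_ne_top]
  congr 1
  rw [← lintegral_blockQuadratic, ← lintegral_blockQuadratic]
  exact lintegral_rotated_mul
    (F := fun x y ↦ ENNReal.ofReal (Real.exp (-blockQuadratic ((2 * p) • B) x y / 2)))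
    (G := fun x y ↦ ENNReal.ofReal (Real.exp (-blockQuadratic (p • (B + blockReflection Da Db * B *
      blockReflection Da Db)) x y / 2)))
    (measurable_exp_blockQuadratic _) (measurable_exp_blockQuadratic _) hs

end Moments

/-! ### Bounds in terms of the mutual information -/

section Bounds

open Matrix

/-- Concavity of the logarithm between `1 - h` and `1`. -/
lemma mul_log_le_log_one_sub {h q : ℝ} (hh : h < 1) (hq : 0 ≤ q) (hq1 : q ≤ 1) :
    q * Real.log (1 - h) ≤ Real.log (1 - q * h) := by
  have h1 := strictConcaveOn_log_Ioi.concaveOn.2 (x := 1 - h) (y := 1)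
    (Set.mem_Ioi.2 (by linarith)) (Set.mem_Ioi.2 one_pos) hq (sub_nonneg.2 hq1) (by ring)
  simp only [smul_eq_mul, Real.log_one, mul_zero, add_zero] at h1
  refine h1.trans (le_of_eq ?_)
  congr 1
  ring

/-- The loss of the four-cycle integral against the product of its edges, for one eigenvalue. -/
lemma cycle_eigenvalue_bound {h w δ : ℝ} (h0 : 0 ≤ h) (hδ : h ≤ δ) (hδ2 : δ ≤ 1 / 2) (hw : 0 ≤ w)
    (hw1 : w ≤ 1) :
    (1 / 2 - w) * Real.log (1 - h) - Real.log (1 + w * h) - Real.log (1 - w ^ 2 * h) / 2 ≤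
      (1 - w ^ 2) / 2 * Real.log (1 - h) - 3 / 2 * δ * Real.log (1 - h) := by
  have hh : h ≤ 1 / 2 := hδ.trans hδ2
  have h1 := mul_log_le_log_one_sub (h := h) (q := w ^ 2) (by linarith) (sq_nonneg w)
    (by nlinarith)
  have hlow : Real.log (1 - h) ≤ -h := by
    have := Real.log_le_sub_one_of_pos (x := 1 - h) (by linarith)
    linarith
  have hup : -(h + h ^ 2) ≤ Real.log (1 - h) := by
    have h3 : Real.exp (-(h + h ^ 2)) ≤ 1 - h := by
      rw [Real.exp_neg, inv_le_comm₀ (Real.exp_pos _) (by linarith)]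
      have h5 := Real.quadratic_le_exp_of_nonneg (x := h + h ^ 2) (by positivity)
      refine le_trans ?_ h5
      rw [inv_le_iff_one_le_mul₀ (by linarith)]
      nlinarith [mul_nonneg h0 h0, mul_nonneg h0 (mul_nonneg h0 h0), mul_nonneg (mul_nonneg h0 h0)
        (sub_nonneg.2 hh), pow_nonneg h0 3, pow_nonneg h0 4, mul_nonneg (pow_nonneg h0 3)
        (sub_nonneg.2 hh), mul_nonneg (pow_nonneg h0 4) (sub_nonneg.2 hh)]
    rw [Real.le_log_iff_exp_le (by linarith)]
    exact h3
  have hplus : w * h - h ^ 2 / 2 ≤ Real.log (1 + w * h) := by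
    have hx : 0 ≤ w * h := mul_nonneg hw h0
    have h2 : w * h - (w * h) ^ 2 / 2 ≤ Real.log (1 + w * h) := by
      refine le_trans ?_ (Real.le_log_one_add_of_nonneg hx)
      rw [le_div_iff₀ (by linarith)]
      nlinarith [pow_nonneg hx 3]
    nlinarith [mul_le_mul hw1 hw1 hw zero_le_one, sq_nonneg h]
  -- After concavity, `-w log (1 - h) - log (1 + w h)` remains. The two expansions bound it by `w h²
  -- + h² / 2 ≤ 3/2 h²`, and `h² ≤ -δ log (1 - h)`.
  nlinarith [mul_nonneg hw (mul_nonneg h0 h0), mul_nonneg h0 (sub_nonneg.2 hδ)]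

variable {Da Db : Type} [Fintype Da] [Fintype Db] [DecidableEq Da] [DecidableEq Db]
  {μa : Da → ℝ} {μb : Db → ℝ} {Sa : Matrix Da Da ℝ} {Sab : Matrix Da Db ℝ} {Sb : Matrix Db Db ℝ}

open scoped MatrixOrder in
lemma infoDensity_whitened_pair (h : (jointCov Sa Sab Sb).PosDef) (x : Da → ℝ) (y : Db → ℝ) :
    infoDensity μa μb Sa Sab Sb (μa + CFC.sqrt Sa *ᵥ x) (μb + CFC.sqrt Sb *ᵥ y) =
      mutualInfo μa μb Sa Sab Sb - blockQuadratic ((whitenedCov Sa Sab Sb)⁻¹ - 1) x y / 2 := by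
  rw [mutualInfo_eq h]
  exact infoDensity_whitened h (Sum.elim x y)

open scoped MatrixOrder in
lemma cycleWeight_likelihoodKernel (h : (jointCov Sa Sab Sb).PosDef) (p : ℝ) :
    cycleWeight (likelihoodKernel p (infoDensity μa μb Sa Sab Sb)) (densityLaw μa Sa)
        (densityLaw μb Sb) =
      cycleWeight (fun x y ↦ ENNReal.ofReal (Real.exp (p * (mutualInfo μa μb Sa Sab Sb -
        blockQuadratic ((whitenedCov Sa Sab Sb)⁻¹ - 1) x y / 2)))) (stdGaussianPi Da)
        (stdGaussianPi Db) := by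
  have hsc := measurable_infoDensity (μa := μa) (μb := μb) (Sa := Sa) (Sab := Sab) (Sb := Sb)
  rw [densityLaw, densityLaw, ← map_sqrt_stdGaussianPi μa (posDef_left h),
    ← map_sqrt_stdGaussianPi μb (posDef_right h), cycleWeight_map
      (measurable_likelihoodKernel p hsc) ((measurable_mulVec _).const_add μa)
      ((measurable_mulVec _).const_add μb)]
  simp only [likelihoodKernel, infoDensity_whitened_pair h]

open scoped MatrixOrder in
lemma lintegral_likelihoodKernel (h : (jointCov Sa Sab Sb).PosDef) (p : ℝ) :
    ∫⁻ z, likelihoodKernel p (infoDensity μa μb Sa Sab Sb) z.1 z.2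
        ∂((densityLaw μa Sa).prod (densityLaw μb Sb)) =
      ENNReal.ofReal (Real.exp (p * mutualInfo μa μb Sa Sab Sb)) *
        ∫⁻ z, ENNReal.ofReal (Real.exp (-(z ⬝ᵥ (p • ((whitenedCov Sa Sab Sb)⁻¹ - 1)) *ᵥ z) / 2))
          ∂(stdGaussianPi (Da ⊕ Db)) := by
  have hsc := measurable_infoDensity (μa := μa) (μb := μb) (Sa := Sa) (Sab := Sab) (Sb := Sb)
  have hma : Measurable fun x ↦ μa + CFC.sqrt Sa *ᵥ x := (measurable_mulVec _).const_add μa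
  have hmb : Measurable fun x ↦ μb + CFC.sqrt Sb *ᵥ x := (measurable_mulVec _).const_add μb
  rw [densityLaw, densityLaw, ← map_sqrt_stdGaussianPi μa (posDef_left h),
    ← map_sqrt_stdGaussianPi μb (posDef_right h), Measure.map_prod_map _ _ hma hmb,
    ← lintegral_blockQuadratic, ← lintegral_const_mul _ (measurable_exp_blockQuadratic _)]
  refine (lintegral_map (measurable_likelihoodKernel p hsc) (hma.prodMap hmb)).trans
    (lintegral_congr fun z ↦ ?_)
  simp only [Function.uncurry, Prod.map, likelihoodKernel, infoDensity_whitened_pair h]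
  rw [← ENNReal.ofReal_mul (Real.exp_pos _).le, ← Real.exp_add, blockQuadratic_smul]
  congr 2
  ring

/-! ### Moments in terms of the correlation spectrum -/

section Spectrum

variable {O : Matrix (Da ⊕ Db) (Da ⊕ Db) ℝ} {e : Da ⊕ Db → ℝ}

lemma exists_spectrum (h : (jointCov Sa Sab Sb).PosDef) :
    ∃ O e, IsCorrelationSpectrum (normalizedCrossCov Sa Sab Sb) O e :=
  exists_isCorrelationSpectrum (posDef_whitenedCov h)

lemma mutualInfo_eq_sum (h : (jointCov Sa Sab Sb).PosDef)
    (hs : IsCorrelationSpectrum (normalizedCrossCov Sa Sab Sb) O e) :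
    mutualInfo μa μb Sa Sab Sb = -(∑ i, Real.log (1 + e i)) / 2 := by
  have h1 := hs.det_one_add 1
  simp only [one_smul, one_mul] at h1
  rw [mutualInfo_eq h, whitenedCov, h1, Real.log_prod fun i _ ↦ (hs.lower i).ne']

lemma IsCorrelationSpectrum.sum_log_one {C : Matrix Da Db ℝ} (hs : IsCorrelationSpectrum C O e) :
    ∑ i, Real.log (1 - e i ^ 2) = 2 * ∑ i, Real.log (1 + e i) := by
  have := hs.sum_log (a := 1) (by simp)
  simp only [one_mul, one_pow] at this
  linarith

/-- The Rényi-type moment of a single pair. -/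
lemma lintegral_likelihoodKernel_le (h : (jointCov Sa Sab Sb).PosDef) {p : ℝ} (hp : 0 ≤ p)
    (hp1 : p ≤ 1) :
    ∫⁻ z, likelihoodKernel p (infoDensity μa μb Sa Sab Sb) z.1 z.2
        ∂((densityLaw μa Sa).prod (densityLaw μb Sb)) ≤
      ENNReal.ofReal (Real.exp (-(p * (1 - p) * mutualInfo μa μb Sa Sab Sb))) := by
  obtain ⟨O, e, hs⟩ := exists_spectrum h
  have ha : |1 - p| ≤ 1 := abs_le.2 ⟨by linarith, by linarith⟩
  have e1 : ∀ i, 1 + p * ((1 + e i)⁻¹ - 1) = (1 + (1 - p) * e i) / (1 + e i) := fun i ↦ by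
    have := (hs.lower i).ne'
    field_simp
    ring
  have hpos := hs.one_add_mul_pos ha
  rw [lintegral_likelihoodKernel h, whitenedCov, hs.inv_one_add, smul_spectralMatrix,
    lintegral_exp_spectralMatrix hs.right, ← ENNReal.ofReal_mul (Real.exp_pos _).le, ← Real.exp_add]
  · refine ENNReal.ofReal_le_ofReal (Real.exp_le_exp.2 ?_)
    simp only [Pi.smul_apply, smul_eq_mul, e1]
    rw [Finset.sum_congr rfl fun i _ ↦ Real.log_div (hpos i).ne' (hs.lower i).ne',
      Finset.sum_sub_distrib, hs.sum_log ha]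
    have hz := mutualInfo_eq_sum (μa := μa) (μb := μb) h hs
    -- Concavity applied to each eigenvalue; no smallness of the correlations is needed for a single
    -- pair.
    have hle : (1 - p) ^ 2 * ∑ i, Real.log (1 - e i ^ 2) ≤
        ∑ i, Real.log (1 - (1 - p) ^ 2 * e i ^ 2) := by
      rw [Finset.mul_sum]
      exact Finset.sum_le_sum fun i _ ↦ mul_log_le_log_one_sub (hs.sq_lt_one i) (sq_nonneg _)
        (by nlinarith)
    rw [hs.sum_log_one] at hle
    generalize (∑ i, Real.log (1 - (1 - p) ^ 2 * e i ^ 2)) = T at hle ⊢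
    generalize (∑ i, Real.log (1 + e i)) = S at hle hz ⊢
    rw [hz]
    nlinarith
  · intro i
    simp only [Pi.smul_apply, smul_eq_mul, e1]
    exact div_pos (hpos i) (hs.lower i)

/-- The sum coordinates contribute the factors `(1 - (2p - 1) e) / (1 + e)`, the difference
coordinates `(1 + (2p - 1) e²) / (1 - e²)`. Symmetry of the spectrum expresses the denominators
through the mutual information. -/
lemma cycleWeight_likelihoodKernel_eq (h : (jointCov Sa Sab Sb).PosDef)
    (hs : IsCorrelationSpectrum (normalizedCrossCov Sa Sab Sb) O e) {p : ℝ} (hp : 1 / 2 ≤ p)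
    (hp1 : p ≤ 1) :
    cycleWeight (likelihoodKernel p (infoDensity μa μb Sa Sab Sb)) (densityLaw μa Sa)
        (densityLaw μb Sb) =
      ENNReal.ofReal (Real.exp ((4 * p - 3) * mutualInfo μa μb Sa Sab Sb -
        (∑ i, Real.log (1 - (2 * p - 1) ^ 2 * e i ^ 2)) / 4 -
        (∑ i, Real.log (1 + (2 * p - 1) * e i ^ 2)) / 2)) := by
  have ha : |-(2 * p - 1)| ≤ 1 := abs_le.2 ⟨by linarith, by linarith⟩
  have e1 : ∀ i, 1 + 2 * p * ((1 + e i)⁻¹ - 1) = (1 + -(2 * p - 1) * e i) / (1 + e i) := fun i ↦ by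
    have := (hs.lower i).ne'
    field_simp
    ring
  have hsq : ∀ i, 0 < 1 - e i ^ 2 := fun i ↦ by linarith [hs.sq_lt_one i]
  have e2 : ∀ i, 1 + p * (((1 + e i)⁻¹ - 1) + ((1 - e i)⁻¹ - 1)) =
      (1 + (2 * p - 1) * e i ^ 2) / (1 - e i ^ 2) := fun i ↦ by
    have h1 := (hs.lower i).ne'
    have h2 := (hs.upper i).ne'
    have h3 : 1 - e i ^ 2 = (1 + e i) * (1 - e i) := by ring
    rw [h3]
    field_simp
    ring
  have hpos := hs.one_add_mul_pos ha
  have hpos2 : ∀ i, 0 < 1 + (2 * p - 1) * e i ^ 2 := fun i ↦ by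
    have := mul_nonneg (by linarith : 0 ≤ 2 * p - 1) (sq_nonneg (e i))
    linarith
  rw [cycleWeight_likelihoodKernel h, cycleWeight_gaussian, whitenedCov, hs.inv_one_sub,
    hs.inv_one_add, spectralMatrix_add, smul_spectralMatrix, smul_spectralMatrix,
    lintegral_exp_spectralMatrix hs.right, lintegral_exp_spectralMatrix hs.right,
    ← ENNReal.ofReal_mul (Real.exp_pos _).le, ← Real.exp_add,
    ← ENNReal.ofReal_mul (Real.exp_pos _).le, ← Real.exp_add]
  · simp only [Pi.smul_apply, Pi.add_apply, smul_eq_mul, e1, e2]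
    rw [Finset.sum_congr rfl fun i _ ↦ Real.log_div (hpos i).ne' (hs.lower i).ne',
      Finset.sum_congr rfl fun i _ ↦ Real.log_div (hpos2 i).ne' (hsq i).ne',
      Finset.sum_sub_distrib, Finset.sum_sub_distrib, hs.sum_log ha, hs.sum_log_one,
      mutualInfo_eq_sum h hs, neg_sq]
    congr 2
    ring
  · intro i
    simp only [Pi.smul_apply, Pi.add_apply, smul_eq_mul, e2]
    exact div_pos (hpos2 i) (hsq i)
  · intro i
    simp only [Pi.smul_apply, smul_eq_mul, e1]
    exact div_pos (hpos i) (hs.lower i)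

end Spectrum

lemma ofReal_exp_pow_four (x : ℝ) :
    ENNReal.ofReal (Real.exp x) ^ 4 = ENNReal.ofReal (Real.exp (4 * x)) := by
  rw [← ENNReal.ofReal_pow (Real.exp_pos _).le, ← Real.exp_nat_mul]
  norm_num

/-- At `2p - 1 = 0` both correction sums vanish and `(4p - 3) ζ = -ζ` is the exact exponent,
whatever the correlations. -/
lemma cycleWeight_half (h : (jointCov Sa Sab Sb).PosDef) :
    cycleWeight (likelihoodKernel (1 / 2) (infoDensity μa μb Sa Sab Sb)) (densityLaw μa Sa)
        (densityLaw μb Sb) ≤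
      ENNReal.ofReal (Real.exp (-mutualInfo μa μb Sa Sab Sb / 4)) ^ 4 := by
  obtain ⟨O, e, hs⟩ := exists_spectrum h
  rw [cycleWeight_likelihoodKernel_eq h hs le_rfl (by norm_num), ofReal_exp_pow_four]
  refine ENNReal.ofReal_le_ofReal (Real.exp_le_exp.2 (le_of_eq ?_))
  norm_num
  ring

/-- Low correlation makes the four-cycle integral comparable with the product of its edges. -/
lemma cycleWeight_le (h : (jointCov Sa Sab Sb).PosDef) {p δ : ℝ} (hp : 1 / 2 ≤ p) (hp1 : p ≤ 1)
    (hδ : maxCorrelation Sa Sab Sb ^ 2 ≤ δ) (hδ2 : δ ≤ 1 / 2) :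
    cycleWeight (likelihoodKernel p (infoDensity μa μb Sa Sab Sb)) (densityLaw μa Sa)
        (densityLaw μb Sb) ≤
      ENNReal.ofReal (Real.exp (-(p * (1 - p) * mutualInfo μa μb Sa Sab Sb) +
        3 / 4 * δ * mutualInfo μa μb Sa Sab Sb)) ^ 4 := by
  obtain ⟨O, e, hs⟩ := exists_spectrum h
  rw [cycleWeight_likelihoodKernel_eq h hs hp hp1, ofReal_exp_pow_four]
  refine ENNReal.ofReal_le_ofReal (Real.exp_le_exp.2 ?_)
  have hle := Finset.sum_le_sum fun (i : Da ⊕ Db) (_ : i ∈ Finset.univ) ↦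
    cycle_eigenvalue_bound (sq_nonneg (e i)) ((hs.sq_le i).trans hδ) hδ2
      (by linarith : 0 ≤ 2 * p - 1) (by linarith)
  -- The logarithms of `1 - e²` sum to `-4 ζ`, so the eigenvalue errors add up to `3 δ ζ` in the
  -- four-cycle exponent, that is `3/4 δ ζ` per edge.
  simp only [Finset.sum_sub_distrib, ← Finset.mul_sum, ← Finset.sum_div, hs.sum_log_one] at hle
  have hz := mutualInfo_eq_sum (μa := μa) (μb := μb) h hs
  generalize (∑ i, Real.log (1 - (2 * p - 1) ^ 2 * e i ^ 2)) = T at hle ⊢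
  generalize (∑ i, Real.log (1 + (2 * p - 1) * e i ^ 2)) = R at hle ⊢
  generalize (∑ i, Real.log (1 + e i)) = S at hle hz
  rw [hz]
  nlinarith

variable {U V Ω : Type} [Fintype U] [Fintype V] [MeasurableSpace Ω] {P : Measure Ω} {M : U ↪ V}
  {A : U → Da → Ω → ℝ} {B : V → Db → Ω → ℝ}

lemma chainBound_databases (hS : (jointCov Sa Sab Sb).PosDef)
    (h : IsCorrelatedDatabases P M μa μb Sa Sab Sb A B) {p ρ : ℝ} (hρ : 0 ≤ ρ)
    (hQ : cycleWeight (likelihoodKernel p (infoDensity μa μb Sa Sab Sb)) (densityLaw μa Sa)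
      (densityLaw μb Sb) ≤ ENNReal.ofReal ρ ^ 4) :
    ChainBound P M (fun ω u v ↦ infoDensity μa μb Sa Sab Sb (fun i ↦ A u i ω) (fun j ↦ B v j ω))
      p ρ := by
  have := isProbabilityMeasure_densityLaw μa (posDef_left hS)
  have := isProbabilityMeasure_densityLaw μb (posDef_right hS)
  have := isProbabilityMeasure_pairLaw (μa := μa) (μb := μb) hS
  exact chainBound_sample (isCorrelatedSample_databases hS h)
    (measurable_infoDensity (μa := μa) (μb := μb) (Sa := Sa) (Sab := Sab) (Sb := Sb)) hρ hQ

lemma IsCorrelatedSample.aemeasurable_score {X Y : Type} [MeasurableSpace X] [MeasurableSpace Y]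
    {νX : Measure X} {νY : Measure Y} {sc : X → Y → ℝ} {a : U → Ω → X} {b : V → Ω → Y}
    (h : IsCorrelatedSample P M νX νY sc a b) (hsc : Measurable (Function.uncurry sc)) (u : U)
    (v : V) : AEMeasurable (fun ω ↦ sc (a u ω) (b v ω)) P :=
  hsc.comp_aemeasurable ((h.law_left u).aemeasurable.prodMk (h.law_right v).aemeasurable)

end Bounds

/-! ### Uniform error bounds -/

section Uniform

/-- The exponential moments of centred scores with signal strength `ζ` and correlation `r`. -/
structure HasExponentialMoments {U V Ω : Type} [Fintype U] [Fintype V] [MeasurableSpace Ω]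
    (P : Measure Ω) (M : U ↪ V) (S : Ω → U → V → ℝ) (ζ r : ℝ) : Prop where
  aemeasurable : ∀ u v, AEMeasurable (fun ω ↦ S ω u v) P
  matched : ∀ p : ℝ, 0 ≤ p → p ≤ 1 → ∀ u,
    ∫⁻ ω, ENNReal.ofReal (Real.exp (-(1 - p) * S ω u (M u))) ∂P ≤
      ENNReal.ofReal (Real.exp (-(p * (1 - p) * ζ)))
  unmatched : ∀ p : ℝ, 0 ≤ p → p ≤ 1 → ∀ u v, M u ≠ v →
    ∫⁻ ω, ENNReal.ofReal (Real.exp (p * S ω u v)) ∂P ≤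
      ENNReal.ofReal (Real.exp (-(p * (1 - p) * ζ)))
  half : ChainBound P M S (1 / 2) (Real.exp (-ζ / 4))
  low_correlation : r ^ 2 ≤ 1 / 2 → ∀ p : ℝ, 1 / 2 ≤ p → p < 1 →
    ChainBound P M S p (Real.exp (-(p * (1 - p) * ζ) + 3 / 4 * r ^ 2 * ζ))

/-- The common form of the error bounds of the two models. -/
def UniformErrorBound (alg : Algorithm) (β : ℝ) (τ : ℕ → ℕ → ℝ → ℝ)
    (hyp : (n : ℕ) → (α ζ r : ℝ) → Prop) : Prop :=
  ∃ e : ℕ → ℝ, Tendsto e atTop (𝓝 0) ∧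
    ∀ (U V Ω : Type) [Fintype U] [Fintype V] [MeasurableSpace Ω]
      (P : Measure Ω) [IsProbabilityMeasure P] (M : U ↪ V) (S : Ω → U → V → ℝ)
      (n N : ℕ) (ζ r : ℝ),
      Fintype.card U = n → Fintype.card V = N → 2 ≤ n → n < N →
      HasExponentialMoments P M S ζ r →
      hyp n (excessExponent n N) ζ r →
      ∀ m : Ω → U → V → ℝ, (∀ᵐ ω ∂P, alg.IsOutput (S ω) (τ n N ζ) (m ω)) →
        ∫⁻ ω, (alg.numErrors M (m ω) : ℝ≥0∞) ∂P ≤ ENNReal.ofReal ((n : ℝ) ^ (1 - β + e n))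

/-! ### Reduction of both models to exponential moments -/

section Models

variable {alg : Algorithm} {β : ℝ} {τ : ℕ → ℕ → ℝ → ℝ}

lemma hasExponentialMoments_planted {U V Ω : Type} [Fintype U] [Fintype V] [MeasurableSpace Ω]
    {P : Measure Ω} {M : U ↪ V} {μ : ℝ} {W : U → V → Ω → ℝ} (hW : IsPlantedMatching P M μ W) :
    HasExponentialMoments P M (fun ω u v ↦ μ * W u v ω - μ ^ 2 / 2) (μ ^ 2 / 2) 0 where
  aemeasurable := aemeasurable_plantedScore hW
  matched p _ _ u := by
    have := lintegral_exp_sum_pairs hW p [(u, M u)] (List.nodup_singleton _)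
    simp only [List.map_cons, List.map_nil, List.sum_cons, List.sum_nil, add_zero, pairWeight,
      if_true, List.length_cons, List.length_nil, zero_add, pow_one] at this
    rw [← this, neg_sub]
  unmatched p _ _ u v huv := by
    have := lintegral_exp_sum_pairs hW p [(u, v)] (List.nodup_singleton _)
    simp only [List.map_cons, List.map_nil, List.sum_cons, List.sum_nil, add_zero, pairWeight,
      if_neg huv, List.length_cons, List.length_nil, zero_add, pow_one] at this
    rw [← this]
  half := by
    convert chainBound_planted hW (1 / 2) using 2
    ring
  low_correlation _ p _ _ := by
    convert chainBound_planted hW p using 2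
    ring

lemma hasExponentialMoments_databases {U V Da Db Ω : Type} [Fintype U] [Fintype V] [Fintype Da]
    [Fintype Db] [DecidableEq Da] [DecidableEq Db] [MeasurableSpace Ω] {P : Measure Ω} {M : U ↪ V}
    {μa : Da → ℝ} {μb : Db → ℝ} {Sa : Matrix Da Da ℝ} {Sab : Matrix Da Db ℝ} {Sb : Matrix Db Db ℝ}
    {A : U → Da → Ω → ℝ} {B : V → Db → Ω → ℝ} (hS : (jointCov Sa Sab Sb).PosDef)
    (h : IsCorrelatedDatabases P M μa μb Sa Sab Sb A B) :
    HasExponentialMoments P M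
      (fun ω u v ↦ infoDensity μa μb Sa Sab Sb (fun i ↦ A u i ω) (fun j ↦ B v j ω))
      (mutualInfo μa μb Sa Sab Sb) (maxCorrelation Sa Sab Sb) := by
  have hsc := measurable_infoDensity (μa := μa) (μb := μb) (Sa := Sa) (Sab := Sab) (Sb := Sb)
  have := isProbabilityMeasure_densityLaw μa (posDef_left hS)
  have := isProbabilityMeasure_densityLaw μb (posDef_right hS)
  have hsample := isCorrelatedSample_databases hS h
  refine ⟨fun u v ↦ hsample.aemeasurable_score hsc u v, fun p hp hp1 u ↦ ?_,
    fun p hp hp1 u v huv ↦ ?_, chainBound_databases hS h (Real.exp_pos _).le (cycleWeight_half hS),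
    fun hr p hp hp1 ↦ chainBound_databases hS h (Real.exp_pos _).le
      (cycleWeight_le hS hp hp1.le le_rfl hr)⟩
  · rw [neg_sub]
    exact (lintegral_exp_matched hsample hsc p u).le.trans (lintegral_likelihoodKernel_le hS hp hp1)
  · exact (lintegral_exp_unmatched hsample hsc p huv).le.trans
      (lintegral_likelihoodKernel_le hS hp hp1)

open scoped Matrix.Norms.L2Operator in
lemma maxCorrelation_nonneg {Da Db : Type} [Fintype Da] [Fintype Db] [DecidableEq Da]
    [DecidableEq Db] {Sa : Matrix Da Da ℝ} {Sab : Matrix Da Db ℝ} {Sb : Matrix Db Db ℝ} :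
    0 ≤ maxCorrelation Sa Sab Sb := norm_nonneg _

/-- The planted score exceeds its log-likelihood ratio by `ζ`, hence the shifted threshold.
Independent entries behave like zero correlation. -/
lemma UniformErrorBound.planted {hyp : ℕ → ℝ → ℝ → ℝ → Prop} {hyp' : ℕ → ℝ → ℝ → Prop}
    (h : UniformErrorBound alg β (fun n N ζ ↦ τ n N ζ - ζ) hyp)
    (himp : ∀ n α ζ, hyp' n α ζ → hyp n α ζ 0) : PlantedErrorBound alg β τ hyp' := by
  obtain ⟨e, he, hb⟩ := h
  refine ⟨e, he, ?_⟩
  rintro U V Ω _ _ _ P _ M μ W n N ζ hU hV hn hN - rfl hW hh m hm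
  exact hb U V Ω P M _ n N _ 0 hU hV hn hN (hasExponentialMoments_planted hW) (himp _ _ _ hh) m
    (hm.mono fun ω hω ↦ isOutput_sub_const hω)

lemma UniformErrorBound.databases {hyp hyp' : ℕ → ℝ → ℝ → ℝ → Prop}
    (h : UniformErrorBound alg β τ hyp)
    (himp : ∀ n α ζ r, 0 ≤ r → hyp' n α ζ r → hyp n α ζ r) : DatabaseErrorBound alg β τ hyp' := by
  obtain ⟨e, he, hb⟩ := h
  refine ⟨e, he, ?_⟩
  rintro U V Da Db Ω _ _ _ _ _ _ _ P _ M μa μb Sa Sab Sb A B n N ζ hU hV hn hN hS rfl hAB hh m hm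
  exact hb U V Ω P M _ n N _ _ hU hV hn hN (hasExponentialMoments_databases hS hAB)
    (himp _ _ _ _ maxCorrelation_nonneg hh) m hm

end Models

/-! ### From exponential moments to rates -/

section Rates

variable {U V Ω : Type} [Fintype U] [Fintype V] [MeasurableSpace Ω] {P : Measure Ω} {M : U ↪ V}
  {S : Ω → U → V → ℝ} {n N : ℕ} {ζ r p ρ τ : ℝ} {m : Ω → U → V → ℝ}

lemma ChainBound.likelihoodRate (hb : ChainBound P M S p ρ)
    (hS : ∀ u v, AEMeasurable (fun ω ↦ S ω u v) P) (hρ : 0 ≤ ρ) (hp : 1 / 2 ≤ p) (hp1 : p < 1)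
    (hU : Fintype.card U = n) (hV : Fintype.card V = N) (hN : n < N)
    (hm : ∀ᵐ ω ∂P, Algorithm.maxLikelihood.IsOutput (S ω) τ (m ω)) :
    LikelihoodRate (∫⁻ ω, (Algorithm.maxLikelihood.numErrors M (m ω) : ℝ≥0∞) ∂P) n N p ρ := by
  subst hU hV
  exact fun t η x₀ hη hx₀ hx ↦ lintegral_maxLikelihood_le hS hρ hb hp hp1 hN hm t η x₀ hη hx₀ hx

lemma ChainBound.rowRate (hb : ChainBound P M S p ρ)
    (hS : ∀ u v, AEMeasurable (fun ω ↦ S ω u v) P) (hρ : 0 ≤ ρ) (hp : 1 / 2 ≤ p) (hp1 : p < 1)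
    (hU : Fintype.card U = n) (hV : Fintype.card V = N)
    (hm : ∀ᵐ ω ∂P, Algorithm.maxRow.IsOutput (S ω) τ (m ω)) :
    RowRate (∫⁻ ω, (Algorithm.maxRow.numErrors M (m ω) : ℝ≥0∞) ∂P) n N p ρ := by
  subst hU hV
  exact fun t ↦ lintegral_maxRow_le hS hρ hb hp hp1 hm t

/-- Low correlation in the range where the signal strength is logarithmic. -/
lemma HasExponentialMoments.chainBound_of_le (h : HasExponentialMoments P M S ζ r) (hn : 2 ≤ n)
    {β γ κ : ℝ} (hβ : 0 < β) (hr : r ^ 2 * max γ 1 ≤ κ) (hκ : κ ≤ 1 / 2)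
    (hζ : ζ ≤ 2 * (γ + β) * Real.log n + 2) (hp : 1 / 2 ≤ p) (hp1 : p < 1) :
    ChainBound P M S p
      (Real.exp (-(p * (1 - p) * ζ) + 3 / 4 * (6 + 2 * β) * κ * Real.log n)) := by
  have hr0 : 0 ≤ r ^ 2 := sq_nonneg r
  have hr1 : r ^ 2 ≤ κ := le_trans (le_mul_of_one_le_right hr0 (le_max_right _ _)) hr
  have hrγ : r ^ 2 * γ ≤ κ := le_trans (mul_le_mul_of_nonneg_left (le_max_left _ _) hr0) hr
  refine (h.low_correlation (hr1.trans hκ) p hp hp1).mono (Real.exp_pos _).le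
    (Real.exp_le_exp.2 (add_le_add_right ?_ _))
  -- This absorbs the additive `2` in the bound for `ζ` into `4 log n`, whence the `6` in the
  -- constant.
  have hL : 1 / 2 ≤ Real.log n := by
    have h1 : Real.log 2 ≤ Real.log n := Real.log_le_log two_pos (by exact_mod_cast hn)
    linarith [Real.log_two_gt_d9]
  have h1 : r ^ 2 * ζ ≤ r ^ 2 * (2 * (γ + β) * Real.log n + 2) := mul_le_mul_of_nonneg_left hζ hr0
  have h2 : r ^ 2 * γ * Real.log n ≤ κ * Real.log n := mul_le_mul_of_nonneg_right hrγ (by linarith)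
  have h3 : r ^ 2 * Real.log n ≤ κ * Real.log n := mul_le_mul_of_nonneg_right hr1 (by linarith)
  have h4 : r ^ 2 * 2 ≤ 4 * (r ^ 2 * Real.log n) := by nlinarith
  nlinarith

end Rates

/-! ### Uniform bounds for each boundary -/

variable {β : ℝ} (τ : ℕ → ℕ → ℝ → ℝ)

/-- A bound with constants for large `n`, where the errors are misaligned users. -/
lemma UniformErrorBound.of_eventually {alg : Algorithm} {hyp : ℕ → ℝ → ℝ → ℝ → Prop}
    (halg : ∀ (U V : Type) (M : U ↪ V) (m : U → V → ℝ),
      alg.numErrors M m = misalignedUsers M m) {C : ℝ} (hC : 0 < C)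
    {ω : ℕ → ℝ} (hω : Tendsto ω atTop (𝓝 0)) (n₀ : ℕ)
    (h : ∀ (U V Ω : Type) [Fintype U] [Fintype V] [MeasurableSpace Ω]
      (P : Measure Ω) [IsProbabilityMeasure P] (M : U ↪ V) (S : Ω → U → V → ℝ)
      (n N : ℕ) (ζ r : ℝ), Fintype.card U = n → Fintype.card V = N → 2 ≤ n → n₀ ≤ n → n < N →
      HasExponentialMoments P M S ζ r → hyp n (excessExponent n N) ζ r →
      ∀ m : Ω → U → V → ℝ, (∀ᵐ ω ∂P, alg.IsOutput (S ω) (τ n N ζ) (m ω)) →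
        ∫⁻ ω, (alg.numErrors M (m ω) : ℝ≥0∞) ∂P ≤ ENNReal.ofReal (C * (n : ℝ) ^ (1 - β + ω n))) :
    UniformErrorBound alg β τ hyp := by
  obtain ⟨e, he, hexp⟩ := exists_exponent β hC hω n₀
  refine ⟨e, he, ?_⟩
  intro U V Ω _ _ _ P _ M S n N ζ r hU hV hn hN hmom hh m hm
  rcases le_or_gt n₀ n with hle | hlt
  · exact (h U V Ω P M S n N ζ r hU hV hn hle hN hmom hh m hm).trans
      (ENNReal.ofReal_le_ofReal ((hexp n hn).1 hle))
  · refine le_trans (lintegral_mono (g := fun _ ↦ (n : ℝ≥0∞)) fun ω ↦ ?_) ?_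
    · rw [halg, ← hU]
      exact Nat.cast_le.2 (misalignedUsers_le_card M (m ω))
    · rw [lintegral_const, measure_univ, mul_one, ← ENNReal.ofReal_natCast]
      exact ENNReal.ofReal_le_ofReal ((hexp n hn).2 hlt)

/-- The rate holds for every `n ≥ 2`. This matters because wrong pairs can outnumber the users, so
the trivial bound for small `n` would fail here. -/
lemma uniform_thresholdTesting (hβ : 0 < β) :
    UniformErrorBound .thresholdTesting β (fun n _ ζ ↦ densityThreshold β n ζ) fun n α ζ _ ↦
      (√(max α 1 + β) + √β) ^ 2 * Real.log n ≤ ζ := by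
  obtain ⟨e, he, hexp⟩ := exists_exponent β (C := 3) (by norm_num) (ω := fun _ ↦ 0)
    tendsto_const_nhds 0
  refine ⟨e, he, ?_⟩
  intro U V Ω _ _ _ P _ M S n N ζ r hU hV hn hN hmom hh m hm
  have hb := thresholdRate (E := ∫⁻ ω, (Algorithm.thresholdTesting.numErrors M (m ω) : ℝ≥0∞) ∂P)
    hβ hn hN hh fun p hp hp1 ↦ by
      subst hU hV
      exact lintegral_thresholdTesting_le hmom.aemeasurable hp (sub_nonneg.2 hp1)
        (Real.exp_pos _).le (Real.exp_pos _).le (hmom.matched p hp hp1) (hmom.unmatched p hp hp1) hm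
  refine hb.trans (ENNReal.ofReal_le_ofReal ?_)
  simpa using (hexp n hn).1 (Nat.zero_le n)

/-- In the relevant range `ζ` is of order `max α 1 * log n`, so a vanishing `r ^ 2 * max α 1` makes
the correlation loss `o(log n)`. -/
lemma uniform_maxRow_parabolic (hβ : 0 < β) {κ : ℕ → ℝ} (hκ0 : ∀ n, 0 ≤ κ n)
    (hκ : Tendsto κ atTop (𝓝 0)) :
    UniformErrorBound .maxRow β τ fun n α ζ r ↦
      r ^ 2 * max α 1 ≤ κ n ∧ β ≤ max α 1 ∧ (√(max α 1) + √β) ^ 2 * Real.log n ≤ ζ := by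
  obtain ⟨n₀, hn₀⟩ := eventually_atTop.1 (hκ.eventually_le_const (by norm_num : (0 : ℝ) < 1 / 2))
  refine UniformErrorBound.of_eventually τ (fun _ _ _ _ ↦ rfl) (C := 3) (by norm_num)
    (ω := fun n ↦ 2 * (3 / 4 * (6 + 2 * β) * κ n)) ?_ n₀ ?_
  · simpa using (hκ.const_mul (3 / 4 * (6 + 2 * β))).const_mul 2
  intro U V Ω _ _ _ P _ M S n N ζ r hU hV hn hle hN hmom ⟨hr, hβα, hζ⟩ m hm
  have hκn := hκ0 n
  refine rowRate_parabolic hβ (by positivity) hn hN hβα hζ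
    (hmom.half.rowRate hmom.aemeasurable (Real.exp_pos _).le le_rfl (by norm_num) hU hV hm)
    fun hζ' p hp hp1 ↦ ?_
  refine (hmom.chainBound_of_le (γ := max (excessExponent n N) 1) hn hβ ?_ (hn₀ n hle)
    (by linarith) hp hp1).rowRate hmom.aemeasurable (Real.exp_pos _).le hp hp1 hU hV hm
  rwa [max_eq_left (le_max_right _ _)]

lemma uniform_maxRow_linear :
    UniformErrorBound .maxRow β τ fun n α ζ _ ↦ 2 * (max α 1 + β) * Real.log n ≤ ζ := by
  refine UniformErrorBound.of_eventually τ (fun _ _ _ _ ↦ rfl) (C := 3) (by norm_num)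
    (ω := fun _ ↦ 0) tendsto_const_nhds 0 ?_
  intro U V Ω _ _ _ P _ M S n N ζ r hU hV hn _ hN hmom hζ m hm
  rw [add_zero]
  exact rowRate_linear hn hN hζ
    (hmom.half.rowRate hmom.aemeasurable (Real.exp_pos _).le le_rfl (by norm_num) hU hV hm)

/-- The elliptic and parabolic boundaries of maximum likelihood estimation. -/
lemma uniform_maxLikelihood_parabolic (hβ : 0 < β) {κ : ℕ → ℝ} (hκ0 : ∀ n, 0 ≤ κ n)
    (hκ : Tendsto κ atTop (𝓝 0)) :
    UniformErrorBound .maxLikelihood β τ fun n α ζ r ↦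
      ∃ γ, r ^ 2 * max γ 1 ≤ κ n ∧ α ≤ γ ∧ β ≤ γ ∧ 1 ≤ β + γ ∧
        (√γ + √β) ^ 2 * Real.log n ≤ ζ := by
  obtain ⟨n₀, hn₀⟩ := eventually_atTop.1 (hκ.eventually_le_const (by norm_num : (0 : ℝ) < 1 / 2))
  obtain ⟨C, hC, ω', hω', n₁, hrate⟩ := likelihoodRate_parabolic hβ
    (ω := fun n ↦ 3 / 4 * (6 + 2 * β) * κ n)
    (fun n ↦ mul_nonneg (by positivity) (hκ0 n))
    (by simpa using hκ.const_mul (3 / 4 * (6 + 2 * β)))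
  refine UniformErrorBound.of_eventually τ (fun _ _ _ _ ↦ rfl) hC hω' (max n₀ n₁) ?_
  intro U V Ω _ _ _ P _ M S n N ζ r hU hV hn hle hN hmom ⟨γ, hr, hαγ, hβγ, h1, hζ⟩ m hm
  exact hrate n N ζ γ _ hn (le_of_max_le_right hle) hN hβγ h1 hαγ hζ
    (hmom.half.likelihoodRate hmom.aemeasurable (Real.exp_pos _).le le_rfl (by norm_num) hU hV hN hm)
    fun hζ' p hp hp1 ↦ (hmom.chainBound_of_le hn hβ hr (hn₀ n (le_of_max_le_left hle)) hζ' hp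
      hp1).likelihoodRate hmom.aemeasurable (Real.exp_pos _).le hp hp1 hU hV hN hm

lemma uniform_maxLikelihood_vertical :
    UniformErrorBound .maxLikelihood β τ fun n α ζ _ ↦
      β ≤ 1 - α ∧ 2 * Real.log n + 2 * Real.log ((3 + √5) / 2) ≤ ζ := by
  obtain ⟨C, hC, hrate⟩ := likelihoodRate_vertical β
  refine UniformErrorBound.of_eventually τ (fun _ _ _ _ ↦ rfl) hC
    (ω := fun _ ↦ 0) tendsto_const_nhds 0 ?_
  intro U V Ω _ _ _ P _ M S n N ζ r hU hV hn _ hN hmom ⟨hβ, hζ⟩ m hm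
  rw [add_zero]
  exact hrate n N ζ _ hn hN hβ hζ
    (hmom.half.likelihoodRate hmom.aemeasurable (Real.exp_pos _).le le_rfl (by norm_num) hU hV hN hm)

/-- The gap `c / log n` between `β` and `1 - α` becomes the margin `log n + c ≤ ζ / 2` that keeps
the series convergent. -/
lemma uniform_maxLikelihood_linear {c : ℝ} (hc : 0 < c) :
    UniformErrorBound .maxLikelihood β τ fun n α ζ _ ↦
      1 - α + c / Real.log n ≤ β ∧ 2 * (α + β) * Real.log n ≤ ζ := by
  obtain ⟨C, hC, hrate⟩ := likelihoodRate_linear β hc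
  refine UniformErrorBound.of_eventually τ (fun _ _ _ _ ↦ rfl) hC
    (ω := fun _ ↦ 0) tendsto_const_nhds 0 ?_
  intro U V Ω _ _ _ P _ M S n N ζ r hU hV hn _ hN hmom ⟨hβ, hζ⟩ m hm
  have hL := log_natCast_pos hn
  rw [add_zero]
  refine hrate n N ζ _ _ hn hN le_rfl ?_ hζ
    (hmom.half.likelihoodRate hmom.aemeasurable (Real.exp_pos _).le le_rfl (by norm_num) hU hV hN hm)
  have h1 := mul_le_mul_of_nonneg_right hβ hL.le
  rw [add_mul, div_mul_cancel₀ _ hL.ne'] at h1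
  linarith

lemma ellipse_eq {β : ℝ} (hβ : 0 < β) (hβ1 : β ≤ 1 / 2) :
    (√(1 - β) + √β) ^ 2 = 1 + 2 * √(β * (1 - β)) := by
  rw [Real.sqrt_mul hβ.le, add_sq, Real.sq_sqrt hβ.le, Real.sq_sqrt (by linarith)]
  ring

lemma sq_mul_le_of_le {r κ x K : ℝ} (hr : 0 ≤ r) (hκ : r ≤ κ) (hx : x ≤ K) :
    r ^ 2 * max x 1 ≤ κ ^ 2 * max K 1 :=
  mul_le_mul (pow_le_pow_left₀ hr hκ 2) (max_le_max_right 1 hx) (by positivity) (sq_nonneg κ)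

lemma tendsto_sq_mul {κ : ℕ → ℝ} (hκ : Tendsto κ atTop (𝓝 0)) (K : ℝ) :
    Tendsto (fun n ↦ κ n ^ 2 * K) atTop (𝓝 0) := by
  simpa using (hκ.pow 2).mul_const K

end Uniform

end Alignment

end

/-! ### The theorem -/

open Alignment Real in
theorem theorem3 (β : ℝ) (hβ : 0 < β) :
    -- Planted matching: threshold testing, parabolic boundary
    (∃ τ, PlantedErrorBound .thresholdTesting β τ fun n α ζ ↦
      (√(max α 1 + β) + √β) ^ 2 * log n ≤ ζ) ∧
    -- Planted matching: maximum row estimation, parabolic and linear boundaries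
    (∀ τ, PlantedErrorBound .maxRow β τ fun n α ζ ↦
      β ≤ max α 1 ∧ (√(max α 1) + √β) ^ 2 * log n ≤ ζ) ∧
    (∀ τ, PlantedErrorBound .maxRow β τ fun n α ζ ↦
      max α 1 < β ∧ 2 * (max α 1 + β) * log n ≤ ζ) ∧
    -- Planted matching: maximum likelihood, elliptic, parabolic, vertical and linear boundaries
    (∀ τ, PlantedErrorBound .maxLikelihood β τ fun n α ζ ↦
      β ≤ min (1 - α) (1 / 2) ∧ (1 + 2 * √(β * (1 - β))) * log n ≤ ζ) ∧
    (∀ τ, PlantedErrorBound .maxLikelihood β τ fun n α ζ ↦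
      1 - α < β ∧ β ≤ α ∧ (√α + √β) ^ 2 * log n ≤ ζ) ∧
    (∀ τ, PlantedErrorBound .maxLikelihood β τ fun n α ζ ↦
      1 / 2 < β ∧ β ≤ 1 - α ∧ 2 * log n + 2 * log ((3 + √5) / 2) ≤ ζ) ∧
    (∀ τ, ∀ c > 0, PlantedErrorBound .maxLikelihood β τ fun n α ζ ↦
      max α (1 - α) < β ∧ 1 - α + c / log n ≤ β ∧ 2 * (α + β) * log n ≤ ζ) ∧
    -- Database alignment: threshold testing, parabolic boundary
    (∃ τ, DatabaseErrorBound .thresholdTesting β τ fun n α ζ _ ↦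
      (√(max α 1 + β) + √β) ^ 2 * log n ≤ ζ) ∧
    -- Database alignment: maximum row estimation, parabolic (low per-feature correlation) and
    -- linear boundaries
    (∀ τ, ∀ κ : ℕ → ℝ, Filter.Tendsto κ Filter.atTop (nhds 0) → ∀ K : ℝ,
      DatabaseErrorBound .maxRow β τ fun n α ζ r ↦
        r ≤ κ n ∧ α ≤ K ∧ β ≤ max α 1 ∧ (√(max α 1) + √β) ^ 2 * log n ≤ ζ) ∧
    (∀ τ, DatabaseErrorBound .maxRow β τ fun n α ζ _ ↦
      max α 1 < β ∧ 2 * (max α 1 + β) * log n ≤ ζ) ∧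
    -- Database alignment: maximum likelihood, elliptic and parabolic (both with low per-feature
    -- correlation), vertical and linear boundaries
    (∀ τ, ∀ κ : ℕ → ℝ, Filter.Tendsto κ Filter.atTop (nhds 0) →
      DatabaseErrorBound .maxLikelihood β τ fun n α ζ r ↦
        r ≤ κ n ∧ β ≤ min (1 - α) (1 / 2) ∧ (1 + 2 * √(β * (1 - β))) * log n ≤ ζ) ∧
    (∀ τ, ∀ κ : ℕ → ℝ, Filter.Tendsto κ Filter.atTop (nhds 0) → ∀ K : ℝ,
      DatabaseErrorBound .maxLikelihood β τ fun n α ζ r ↦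
        r ≤ κ n ∧ α ≤ K ∧ 1 - α < β ∧ β ≤ α ∧ (√α + √β) ^ 2 * log n ≤ ζ) ∧
    (∀ τ, DatabaseErrorBound .maxLikelihood β τ fun n α ζ _ ↦
      1 / 2 < β ∧ β ≤ 1 - α ∧ 2 * log n + 2 * log ((3 + √5) / 2) ≤ ζ) ∧
    (∀ τ, ∀ c > 0, DatabaseErrorBound .maxLikelihood β τ fun n α ζ _ ↦
      max α (1 - α) < β ∧ 1 - α + c / log n ≤ β ∧ 2 * (α + β) * log n ≤ ζ) := by
  have hnn : ∀ (κ : ℕ → ℝ) (K : ℝ) (n : ℕ), 0 ≤ κ n ^ 2 * max K 1 := fun κ K n ↦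
    mul_nonneg (sq_nonneg _) (zero_le_one.trans (le_max_right _ _))
  have hzero : Filter.Tendsto (fun _ : ℕ ↦ (0 : ℝ)) Filter.atTop (nhds 0) := tendsto_const_nhds
  refine ⟨⟨fun n _ ζ ↦ densityThreshold β n ζ + ζ, ?_⟩, fun τ ↦ ?_, fun τ ↦ ?_, fun τ ↦ ?_,
    fun τ ↦ ?_, fun τ ↦ ?_, fun τ c hc ↦ ?_, ⟨fun n _ ζ ↦ densityThreshold β n ζ, ?_⟩,
    fun τ κ hκ K ↦ ?_, fun τ ↦ ?_, fun τ κ hκ ↦ ?_, fun τ κ hκ K ↦ ?_, fun τ ↦ ?_,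
    fun τ c hc ↦ ?_⟩
  · refine UniformErrorBound.planted (hyp := fun n α ζ _ ↦
      (√(max α 1 + β) + √β) ^ 2 * log n ≤ ζ) ?_ fun n α ζ h ↦ h
    simpa only [add_sub_cancel_right] using uniform_thresholdTesting hβ
  · exact (uniform_maxRow_parabolic _ hβ (fun _ ↦ le_rfl) hzero).planted fun n α ζ h ↦
      ⟨by simp, h⟩
  · exact (uniform_maxRow_linear _).planted fun n α ζ h ↦ h.2
  · refine (uniform_maxLikelihood_parabolic _ hβ (fun _ ↦ le_rfl) hzero).planted
      fun n α ζ ⟨h1, h2⟩ ↦ ?_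
    rw [le_min_iff] at h1
    -- The ellipse is the parabola at `γ = 1 - β`: errors there do not improve for smaller `α`.
    exact ⟨1 - β, by simp, by linarith, by linarith, by linarith, by rwa [ellipse_eq hβ h1.2]⟩
  · exact (uniform_maxLikelihood_parabolic _ hβ (fun _ ↦ le_rfl) hzero).planted
      fun n α ζ ⟨h1, h2, h3⟩ ↦ ⟨α, by simp, le_rfl, h2, by linarith, h3⟩
  · exact (uniform_maxLikelihood_vertical _).planted fun n α ζ h ↦ h.2
  · exact (uniform_maxLikelihood_linear _ hc).planted fun n α ζ h ↦ h.2
  · exact (uniform_thresholdTesting hβ).databases fun n α ζ r _ h ↦ h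
  -- Boundedness of `α` by `K` turns `r ≤ κ n` into `r ^ 2 * max α 1 ≤ κ n ^ 2 * max K 1`, which
  -- tends to zero.
  · exact (uniform_maxRow_parabolic τ hβ (hnn κ K) (tendsto_sq_mul hκ _)).databases
      fun n α ζ r hr ⟨h1, h2, h3⟩ ↦ ⟨sq_mul_le_of_le hr h1 h2, h3⟩
  · exact (uniform_maxRow_linear τ).databases fun n α ζ r _ h ↦ h.2
  · refine (uniform_maxLikelihood_parabolic τ hβ (hnn κ (1 - β)) (tendsto_sq_mul hκ _)).databases
      fun n α ζ r hr ⟨h0, h1, h2⟩ ↦ ?_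
    rw [le_min_iff] at h1
    -- No bound on `α` is assumed, since `γ` is the fixed number `1 - β`.
    exact ⟨1 - β, sq_mul_le_of_le hr h0 le_rfl, by linarith, by linarith, by linarith,
      by rwa [ellipse_eq hβ h1.2]⟩
  · exact (uniform_maxLikelihood_parabolic τ hβ (hnn κ K) (tendsto_sq_mul hκ _)).databases
      fun n α ζ r hr ⟨h0, hK, h1, h2, h3⟩ ↦
        ⟨α, sq_mul_le_of_le hr h0 hK, le_rfl, h2, by linarith, h3⟩
  · exact (uniform_maxLikelihood_vertical τ).databases fun n α ζ r _ h ↦ h.2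
  · exact (uniform_maxLikelihood_linear τ hc).databases fun n α ζ r _ h ↦ h.2
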